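/- **Model.** There are $N\ge 2$ service providers (SPs) with licensed bandwidths $B_i>0$, a mass $N_m>0$ of mobile users and a mass $N_f>0$ of fixed users (both non-atomic). If SP $i$ puts bandwidth $B_{i,M}$ into macro-cells and $B_{i,S}$ into small-cells ($B_{i,M},B_{i,S}\ge 0$, $B_{i,M}+B_{i,S}\le B_i$), these offer total rates $C_{i,M}=B_{i,M}R_0$ and $C_{i,S}=\lambda_S B_{i,S}R_0$, where $R_0>0$, $\lambda_S>1$. A free unlicensed network (WiFi) offers the total rate $C_U=\lambda_U B_U R_0>0$, shared equally by its users. Users have utility $u(r)=r^{1-\alpha}/(1-\alpha)$, $\alpha\in(0,1)$. At unit price $p$ a user demands the rate $D(p)=(1/p)^{1/\alpha}$ and has net payoff $u(D(p))-pD(p)$, so a service with total rate $C$ and price $p$ can serve at most a mass $Cp^{1/\alpha}$ of users (nobody if $p=0$). Mobile users can only use macro-cells, where they have priority; fixed users use macro-cells, small-cells or WiFi. The payoff of WiFi with a mass $K_U>0$ of users is $u(C_U/K_U)$. *User association* at given bandwidths and prices $p_{i,M},p_{i,S}\ge0$: first the mobile users, then the fixed users, take the services that give them the largest net payoff, a service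 being used only if all better ones (for fixed users, licensed or not) have no room left; every fixed user is served, a mobile user is unserved only if all macro-cells are full, and no fixed user on WiFi would prefer a licensed service that has room. Users allocate themselves among licensed services of equal price in proportion to the capacities, and once a service is full, the leftover demand fills the remaining ones in the same way. The revenue of SP $i$ is $S_i=K_{i,M}\,p_{i,M}D(p_{i,M})+K_{i,S}\,p_{i,S}D(p_{i,S})$, where $K_{i,M}$, $K_{i,S}$ are the masses of users in its macro- and small-cells. *Game.* In stage 1 the SPs simultaneously choose feasible splits $(B_{i,M},B_{i,S})$; in stage 2, knowing all splits, they simultaneously choose prices $p_{i,M},p_{i,S}\in[0,\infty)$. SP $i$ maximizes $S_i$. A subgame-perfect Nash equilibrium (in pure strategies) consists of a feasible bandwidth profile and, for every feasible bandwidth profile, a Nash equilibrium of the price stage that follows it, such that no SP can raise its revenue by deviating from its split when prices respond in this way. **Theorem (Nash Equilibrium).** For all bandwidths and prices as above the user association is uniquely determined. A subgame-perfect Nash equilibrium always exists, and it is unique: any two have the same bandwidth profile, and after every feasible bandwidth profile they have the same user association and the same price for every service with positive bandwidth (the price of a service without bandwidth is immaterial). In the equilibrium: 1. (separate service) no fixed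 users are in macro-cells; 2. every fixed user in a small-cell gets a strictly higher rate than every mobile user served in a macro-cell; 3. exactly one of the following holds: - MSNE: $B_{i,M}>0$ and $B_{i,S}>0$ for all $i$; - MPNE: some SPs have $B_{i,M},B_{i,S}>0$, and the remaining SPs, at least one, have $B_{i,M}>0$, $B_{i,S}=0$; - MNE: $B_{i,M}>0$ and $B_{i,S}=0$ for all $i$. -/

import Mathlib

/-! Market model: `N` service providers (SPs), each with a macro-cell and a small-cell service on
licensed spectrum, together with a free unlicensed (WiFi) network. -/

namespace HetNet

/-- The two licensed services of an SP. -/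
inductive Tier : Type
  | macro_cell : Tier
  | small_cell : Tier

/-- The exogenous parameters of the market, with their standing sign conditions. -/
structure Market (N : ℕ) where
  /-- fairness parameter of the users' utility -/
  α : ℝ
  /-- mass (density) of fixed users -/
  Nf : ℝ
  /-- mass (density) of mobile users -/
  Nm : ℝ
  /-- spectral efficiency of macro-cells -/
  R₀ : ℝ
  /-- relative rate gain of small-cells -/
  lamS : ℝ
  /-- relative rate gain of WiFi -/
  lamU : ℝ
  /-- unlicensed bandwidth -/
  BU : ℝ
  /-- total licensed bandwidth of each SP -/
  B : Fin N → ℝ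
  α_pos : 0 < α
  α_lt_one : α < 1
  Nf_pos : 0 < Nf
  Nm_pos : 0 < Nm
  R₀_pos : 0 < R₀
  one_lt_lamS : 1 < lamS
  lamU_pos : 0 < lamU
  BU_pos : 0 < BU
  B_pos : ∀ i, 0 < B i

/-- A bandwidth profile: the bandwidth that each SP puts into each of its two tiers. -/
abbrev Bandwidths (N : ℕ) : Type := Fin N → Tier → ℝ

/-- A price profile: the price per unit rate that each SP charges in each of its two tiers. -/
abbrev Prices (N : ℕ) : Type := Fin N → Tier → ℝ

/-- An association of users with services: the mass of mobile users in the macro-cells of each SP,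
the mass of fixed users in each tier of each SP, and the mass of fixed users on WiFi. -/
structure Association (N : ℕ) where
  mobile : Fin N → ℝ
  fixed : Fin N → Tier → ℝ
  wifi : ℝ

instance (N : ℕ) : Nonempty (Association N) := ⟨⟨0, 0, 0⟩⟩

namespace Association

variable {N : ℕ}

/-- Total mass of users in a tier of an SP (mobile users only connect to macro-cells). -/
def load (K : Association N) (i : Fin N) : Tier → ℝ
  | .macro_cell => K.mobile i + K.fixed i .macro_cell
  | .small_cell => K.fixed i .small_cell

end Association

namespace Market

variable {N : ℕ}

/-- Total rate of the WiFi network. -/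
def wifiRate (g : Market N) : ℝ := g.lamU * g.BU * g.R₀

/-- The `α`-fair utility of a service rate. -/
noncomputable def utility (g : Market N) (r : ℝ) : ℝ := r ^ (1 - g.α) / (1 - g.α)

/-- Rate demanded by a user at a positive unit price `p`, the maximizer of `u r - p * r`. -/
noncomputable def demand (g : Market N) (p : ℝ) : ℝ := (1 / p) ^ (1 / g.α)

/-- Net payoff of a user who is served at a positive unit price `p`. -/
noncomputable def netPayoff (g : Market N) (p : ℝ) : ℝ :=
  g.utility (g.demand p) - p * g.demand p

/-- Total rate (capacity) that SP `i` offers in a tier, given the bandwidth profile. -/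
def capacity (g : Market N) (b : Bandwidths N) (i : Fin N) : Tier → ℝ
  | .macro_cell => b i .macro_cell * g.R₀
  | .small_cell => g.lamS * b i .small_cell * g.R₀

/-- The largest mass `K` of users that a service of capacity `C` can serve at price `p`, that is,
`K * demand p ≤ C`. At `p = 0` the demanded rate is infinite, so the service serves nobody; the
formula returns `0` there. -/
noncomputable def maxUsers (g : Market N) (b : Bandwidths N) (p : Prices N) (i : Fin N)
    (t : Tier) : ℝ :=
  g.capacity b i t * p i t ^ (1 / g.α)

/-- The association that the users form, given bandwidths and prices. Mobile users have priority
in macro-cells. Every class of users goes to the available services of largest net payoff;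
services of equal price are filled in proportion to their capacities as long as they have room,
and leftover demand goes on to the remaining services. The users on WiFi share its rate equally. -/
structure IsUserAssociation (g : Market N) (b : Bandwidths N) (p : Prices N)
    (K : Association N) : Prop where
  mobile_nonneg : ∀ i, 0 ≤ K.mobile i
  fixed_nonneg : ∀ i t, 0 ≤ K.fixed i t
  /-- An empty WiFi network would offer an unlimited rate, so it is never empty. -/
  wifi_pos : 0 < K.wifi
  load_le : ∀ i t, K.load i t ≤ g.maxUsers b p i t
  mobile_le : ∑ i, K.mobile i ≤ g.Nm
  /-- Mobile users stay unserved only if all macro-cells are full of mobile users. -/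
  mobile_unserved : ∑ i, K.mobile i < g.Nm →
    ∀ i, K.mobile i = g.maxUsers b p i .macro_cell
  /-- Mobile users take a macro service only if all better ones are full of mobile users. -/
  mobile_choice : ∀ i j, 0 < K.mobile i →
    g.netPayoff (p i .macro_cell) < g.netPayoff (p j .macro_cell) →
    K.mobile j = g.maxUsers b p j .macro_cell
  /-- Macro services of equal price get mobile users in proportion to their capacities. -/
  mobile_tie : ∀ i j, p i .macro_cell = p j .macro_cell →
    K.mobile i * g.capacity b j .macro_cell = K.mobile j * g.capacity b i .macro_cell
  /-- All fixed users are served. -/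
  fixed_total : ∑ i, (K.fixed i .macro_cell + K.fixed i .small_cell) + K.wifi = g.Nf
  /-- Fixed users take a licensed service only if all better licensed ones are full. -/
  fixed_choice : ∀ i t j s, 0 < K.fixed i t →
    g.netPayoff (p i t) < g.netPayoff (p j s) → K.load j s = g.maxUsers b p j s
  /-- Fixed users take a licensed service only if WiFi is not better. -/
  fixed_not_wifi : ∀ i t, 0 < K.fixed i t →
    g.utility (g.wifiRate / K.wifi) ≤ g.netPayoff (p i t)
  /-- Fixed users stay on WiFi only if all better licensed services are full. -/
  wifi_choice : ∀ i t, g.utility (g.wifiRate / K.wifi) < g.netPayoff (p i t) →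
    K.load i t = g.maxUsers b p i t
  /-- Among services of equal price, one that gets less fixed users per unit of capacity than
  another is full. -/
  fixed_tie : ∀ i t j s, p i t = p j s →
    K.fixed i t * g.capacity b j s < K.fixed j s * g.capacity b i t →
    K.load i t = g.maxUsers b p i t

/-- The association formed by the users, given bandwidths and prices. -/
noncomputable def association (g : Market N) (b : Bandwidths N) (p : Prices N) : Association N :=
  Classical.epsilon (g.IsUserAssociation b p)

/-- Revenue that SP `i` collects from a tier. -/
noncomputable def tierRevenue (g : Market N) (b : Bandwidths N) (p : Prices N) (i : Fin N)
    (t : Tier) : ℝ :=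
  (g.association b p).load i t * (p i t * g.demand (p i t))

/-- Revenue of SP `i`. -/
noncomputable def revenue (g : Market N) (b : Bandwidths N) (p : Prices N) (i : Fin N) : ℝ :=
  g.tierRevenue b p i .macro_cell + g.tierRevenue b p i .small_cell

/-- The bandwidth splits available to SP `i`. -/
def FeasibleSplit (g : Market N) (i : Fin N) (β : Tier → ℝ) : Prop :=
  (∀ t, 0 ≤ β t) ∧ β .macro_cell + β .small_cell ≤ g.B i

/-- Feasible bandwidth profiles. -/
def Feasible (g : Market N) (b : Bandwidths N) : Prop := ∀ i, g.FeasibleSplit i (b i)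

/-- Nash equilibria (in pure strategies) of the price stage after the bandwidth profile `b`. -/
def IsPriceEquilibrium (g : Market N) (b : Bandwidths N) (p : Prices N) : Prop :=
  (∀ i t, 0 ≤ p i t) ∧
    ∀ (i : Fin N) (q : Tier → ℝ), (∀ t, 0 ≤ q t) →
      g.revenue b (Function.update p i q) i ≤ g.revenue b p i

/-- Subgame-perfect Nash equilibria of the two-stage game. A strategy profile consists of a
bandwidth profile `b` and of a price profile `π b'` for each bandwidth profile `b'` that may be
observed. The prices are in equilibrium in every price subgame, and no SP gains by deviating from
its bandwidth split when prices respond according to `π`. -/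
structure IsSubgamePerfect (g : Market N) (b : Bandwidths N) (π : Bandwidths N → Prices N) :
    Prop where
  feasible : g.Feasible b
  price_equilibrium : ∀ b', g.Feasible b' → g.IsPriceEquilibrium b' (π b')
  bandwidth_equilibrium : ∀ (i : Fin N) (β : Tier → ℝ), g.FeasibleSplit i β →
    g.revenue (Function.update b i β) (π (Function.update b i β)) i ≤ g.revenue b (π b) i

end Market

variable {N : ℕ}

/-- The SP with split `β` allocates bandwidth to both macro- and small-cells. -/
def UsesBoth (β : Tier → ℝ) : Prop := 0 < β .macro_cell ∧ 0 < β .small_cell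

/-- The SP with split `β` allocates bandwidth to macro-cells only. -/
def MacroOnly (β : Tier → ℝ) : Prop := 0 < β .macro_cell ∧ β .small_cell = 0

/-- Macro-Small type: all SPs use both tiers. -/
def IsMSNE (b : Bandwidths N) : Prop := ∀ i, UsesBoth (b i)

/-- Macro-Preferred type: some SPs use both tiers, and the remaining ones (at least one) use
macro-cells only. -/
def IsMPNE (b : Bandwidths N) : Prop :=
  (∃ i, UsesBoth (b i)) ∧ (∃ i, MacroOnly (b i)) ∧ ∀ i, UsesBoth (b i) ∨ MacroOnly (b i)

/-- Macro-only type: all SPs use macro-cells only. -/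
def IsMNE (b : Bandwidths N) : Prop := ∀ i, MacroOnly (b i)

end HetNet

/-!
The idea is to measure the price `p` of a service by `z = p ^ (1 / α)`, the mass of users that the
service can serve per unit of capacity. Cheaper services are those with smaller `z`, a service of
capacity `C` serves at most `C * z` users, and fixed users prefer a licensed service to WiFi if and
only if the mass of users on WiFi exceeds `wifiCapacity * z`. So WiFi acts like a service of capacity
`wifiCapacity` whose price adjusts to the market, and the users' association is described by linear
conditions (`Market.IsFilling`, `Market.isUserAssociation_iff`). It exists because services can be
filled in order of price up to a marginal price (`exists_isPriceOrdered`), and is unique because two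
such fillings are comparable (`IsPriceOrdered.le_of_lt`).

In the price stage, a service with load `L` and capacity `C` earns `L * z ^ (α - 1)`, hence at most
`C ^ (1 - α) * L ^ α`, with equality if it is full; this is concave in `L`. In an equilibrium all
services are full, since an SP with spare room can lower its prices without losing users. Prices are
then market-clearing, since otherwise an SP could raise a price, if need be moving users between its
two tiers, and keep both of them full (`Market.IsNash.exists_isClearing`). Conversely, at
market-clearing prices no SP can raise its total load, nor that of its small-cells if these have the
higher marginal revenue, so by concavity it cannot gain (`Market.IsClearing.isNash`).

Hence the revenue of an SP with capacity `x` in macro-cells and `y` in small-cells is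
`x * (Nm / CM) ^ α + y * (Nf / T) ^ α`, with `CM` the total macro capacity and `T` the total capacity
of small-cells and WiFi, as long as the markets of mobile and fixed users are separate, and
`(x + y) * ((Nm + Nf) / (CM + T)) ^ α` otherwise. In the second case moving bandwidth to the more
efficient small-cells pays, so equilibria are separate and satisfy first-order conditions
(`Market.IsSplitSolution`). The market shares of the SPs add up to `1` in macro-cells but to less than
`1` in small-cells, because of WiFi; comparing them gives `lamS * (Nf / T) ^ α < (Nm / CM) ^ α`
(`Market.lamS_mul_lt`), so that small-cells are strictly cheaper than macro-cells and every SP has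
macro-cells. The conditions are sufficient by concavity (`Market.IsBestSplit.of_marginal`), they
determine the total capacities and then the splits (`Market.IsSplitSolution.unique`), and they have a
solution by the intermediate value theorem (`Market.exists_isSplitSolution`).
-/

open Filter Topology

namespace HetNet

instance : Fintype Tier :=
  ⟨⟨{.macro_cell, .small_cell}, by simp⟩, by rintro (_ | _) <;> simp⟩

lemma Tier.sum_eq (f : Tier → ℝ) : ∑ t, f t = f .macro_cell + f .small_cell := by
  change ((({.macro_cell, .small_cell} : Multiset Tier).map f).sum) = _
  simp

/-! ### Filling services in order of price -/

/-- The masses `f` fill the rooms `r` of services with prices `z` and capacities `C`: cheaper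
services first, and at equal prices in proportion to the capacities as long as there is room. -/
structure IsPriceOrdered {ι : Type*} (C z r f : ι → ℝ) : Prop where
  nonneg : ∀ i, 0 ≤ f i
  le_room : ∀ i, f i ≤ r i
  choice : ∀ i j, 0 < f i → z j < z i → f j = r j
  tie : ∀ i j, z i = z j → f i * C j < f j * C i → f i = r i

/-- Two price-ordered fillings are comparable, so a filling is determined by its total mass. -/
lemma IsPriceOrdered.le_of_lt {ι : Type*} {C z r f f' : ι → ℝ} (hC : ∀ i, 0 < r i → 0 < C i)
    (h : IsPriceOrdered C z r f) (h' : IsPriceOrdered C z r f') {i : ι} (hi : f i < f' i) (j : ι) :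
    f j ≤ f' j := by
  by_contra! hj
  have hfi := h.nonneg i
  have hfj := h'.nonneg j
  have hri := h'.le_room i
  have hrj := h.le_room j
  have hCi : 0 < C i := hC i (by linarith)
  have hCj : 0 < C j := hC j (by linarith)
  rcases lt_trichotomy (z i) (z j) with hz | hz | hz
  · have := h.choice j i (by linarith) hz
    linarith
  · have h1 : ¬ f i * C j < f j * C i := fun H => by
      have := h.tie i j hz H
      linarith
    have h2 : ¬ f' j * C i < f' i * C j := fun H => by
      have := h'.tie j i hz.symm H
      linarith
    have h3 := mul_lt_mul_of_pos_right hi hCj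
    have h4 := mul_lt_mul_of_pos_right hj hCi
    linarith
  · have := h'.choice i j (by linarith) hz
    linarith

/-- There is a marginal price `φ` below which all rooms are filled and above which they are empty,
while an outside option takes the mass `W * φ`. At the marginal price the masses are
`min (r i) (κ * C i)`, with `κ` adjusted to the total mass. -/
lemma exists_isPriceOrdered {ι : Type*} [Fintype ι] (C z r : ι → ℝ) {W n : ℝ} (hC : ∀ i, 0 ≤ C i)
    (hz : ∀ i, 0 ≤ z i) (hr : ∀ i, 0 ≤ r i) (hrC : ∀ i, r i ≤ C i * z i) (hW : 0 ≤ W)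
    (hn : 0 < n) {X : ℝ} (hX : n < (∑ i, if z i < X then r i else 0) + W * X) :
    ∃ (φ : ℝ) (f : ι → ℝ), 0 < φ ∧ IsPriceOrdered C z r f ∧ ∑ i, f i + W * φ = n ∧
      (∀ i, z i < φ → f i = r i) ∧ ∀ i, φ < z i → f i = 0 := by
  classical
  set A : ℝ → ℝ := fun x => (∑ i, if z i < x then r i else 0) + W * x with hA
  have hmono : Monotone A := by
    intro x y hxy
    have : ∀ i ∈ Finset.univ, (if z i < x then r i else 0) ≤ (if z i < y then r i else 0) := by
      intro i _
      split_ifs with h1 h2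
      · exact le_rfl
      · exact absurd (h1.trans_le hxy) h2
      · exact hr i
      · exact le_rfl
    exact add_le_add (Finset.sum_le_sum this) (mul_le_mul_of_nonneg_left hxy hW)
  set S : Set ℝ := {x | A x ≤ n}
  have h0 : (0 : ℝ) ∈ S := by
    have : A 0 = 0 := by
      simp only [hA, mul_zero, add_zero]
      exact Finset.sum_eq_zero fun i _ => if_neg (not_lt.2 (hz i))
    change A 0 ≤ n
    rw [this]; exact hn.le
  have hbdd : BddAbove S := ⟨X, fun x hx => by
    by_contra! h
    exact absurd (hmono h.le) (not_le.2 (lt_of_le_of_lt hx hX))⟩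
  set φ := sSup S
  -- the supply strictly below `φ` is at most `n`: it is already offered at prices close to `φ`
  have hlow : A φ ≤ n := by
    by_cases hφ0 : φ ∈ S
    · exact hφ0
    have hlt : ∀ᶠ x in 𝓝[<] φ, ∀ i, z i < φ → z i < x := by
      rw [eventually_all]
      intro i
      by_cases hi : z i < φ
      · filter_upwards [Ioo_mem_nhdsLT hi] with x hx _ using hx.1
      · exact Eventually.of_forall fun _ h => absurd h hi
    have hlim : Tendsto (fun x => (∑ i, if z i < φ then r i else 0) + W * x) (𝓝[<] φ)
        (𝓝 (A φ)) := by
      have : Continuous fun x => (∑ i, if z i < φ then r i else 0) + W * x := by fun_prop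
      exact (this.tendsto φ).mono_left nhdsWithin_le_nhds
    refine le_of_tendsto hlim ?_
    filter_upwards [hlt, self_mem_nhdsWithin] with x hx hxφ
    obtain ⟨y, hy, hxy⟩ := exists_lt_of_lt_csSup ⟨0, h0⟩ hxφ
    refine le_trans ?_ ((hmono hxy.le).trans hy)
    refine add_le_add (Finset.sum_le_sum fun i _ => ?_) le_rfl
    split_ifs with h1 h2
    · exact le_rfl
    · exact absurd (hx i h1) h2
    · exact hr i
    · exact le_rfl
  -- the supply up to and including `φ` is at least `n`
  have hup : n ≤ (∑ i, if z i ≤ φ then r i else 0) + W * φ := by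
    have hgt : ∀ᶠ x in 𝓝[>] φ, ∀ i, z i < x → z i ≤ φ := by
      rw [eventually_all]
      intro i
      by_cases hi : φ < z i
      · filter_upwards [Ioo_mem_nhdsGT hi] with x hx h using absurd h (not_lt.2 hx.2.le)
      · exact Eventually.of_forall fun _ _ => not_lt.1 hi
    have hlim : Tendsto (fun x => (∑ i, if z i ≤ φ then r i else 0) + W * x) (𝓝[>] φ)
        (𝓝 ((∑ i, if z i ≤ φ then r i else 0) + W * φ)) := by
      have : Continuous fun x => (∑ i, if z i ≤ φ then r i else 0) + W * x := by fun_prop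
      exact (this.tendsto φ).mono_left nhdsWithin_le_nhds
    refine ge_of_tendsto hlim ?_
    filter_upwards [hgt, self_mem_nhdsWithin] with x hx hxφ
    have hxS : n < A x := by
      by_contra! h
      exact absurd (le_csSup hbdd h) (not_le.2 hxφ)
    refine hxS.le.trans (add_le_add (Finset.sum_le_sum fun i _ => ?_) le_rfl)
    split_ifs with h1 h2
    · exact le_rfl
    · exact absurd (hx i h1) h2
    · exact hr i
    · exact le_rfl
  have hφ : 0 < φ := by
    by_contra! h
    have : (∑ i, if z i ≤ φ then r i else 0) ≤ 0 := by
      refine Finset.sum_nonpos fun i _ => ?_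
      split_ifs with hi
      · have h1 : z i = 0 := le_antisymm (hi.trans h) (hz i)
        have := hrC i
        rw [h1, mul_zero] at this
        exact this
      · exact le_rfl
    nlinarith
  set G : ℝ → ι → ℝ := fun κ i => if z i < φ then r i else if z i = φ then min (r i) (κ * C i) else 0
    with hG
  have hGc : Continuous fun κ => ∑ i, G κ i + W * φ := by
    refine Continuous.add (continuous_finsetSum _ fun i _ => ?_) continuous_const
    simp only [hG]
    split_ifs <;> fun_prop
  have hG0 : ∑ i, G 0 i + W * φ ≤ n := by
    refine le_trans (le_of_eq ?_) hlow
    simp only [hA, hG]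
    congr 1
    refine Finset.sum_congr rfl fun i _ => ?_
    split_ifs
    · rfl
    · simp [hr i]
    · rfl
  have hG1 : n ≤ ∑ i, G φ i + W * φ := by
    refine hup.trans (le_of_eq ?_)
    simp only [hG]
    congr 1
    refine Finset.sum_congr rfl fun i _ => ?_
    rcases lt_trichotomy (z i) φ with h | h | h
    · rw [if_pos h.le, if_pos h]
    · rw [if_pos h.le, if_neg h.not_lt, if_pos h, min_eq_left]
      rw [mul_comm, ← h]; exact hrC i
    · rw [if_neg (not_le.2 h), if_neg (not_lt.2 h.le), if_neg h.ne']
  obtain ⟨κ, hκ, hκn⟩ := intermediate_value_Icc hφ.le hGc.continuousOn ⟨hG0, hG1⟩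
  refine ⟨φ, G κ, hφ, ⟨fun i => ?_, fun i => ?_, fun i j hi hij => ?_, fun i j hij hlt => ?_⟩, hκn,
    fun i hi => ?_, fun i hi => ?_⟩
  · simp only [hG]
    split_ifs
    · exact hr i
    · exact le_min (hr i) (mul_nonneg hκ.1 (hC i))
    · exact le_rfl
  · simp only [hG]
    split_ifs
    · exact le_rfl
    · exact min_le_left _ _
    · exact hr i
  · simp only [hG] at hi ⊢
    rw [if_pos]
    split_ifs at hi with h1 h2
    · exact hij.trans h1
    · exact h2 ▸ hij
    · exact absurd hi (lt_irrefl _)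
  · simp only [hG] at hlt ⊢
    rw [← hij] at hlt
    split_ifs at hlt ⊢ with h1 h2
    · rfl
    · refine min_eq_left (le_of_not_ge fun h => ?_)
      rw [min_eq_right h] at hlt
      have := mul_le_mul_of_nonneg_right (min_le_right (r j) (κ * C j)) (hC i)
      nlinarith
    · simp at hlt
  · simp only [hG]; rw [if_pos hi]
  · simp only [hG]; rw [if_neg (not_lt.2 hi.le), if_neg hi.ne']

/-! ### Loads in terms of users per unit of capacity -/

namespace Market

variable {N : ℕ}

/-- Mass of users on WiFi per unit of `z`, at which WiFi is as good as a licensed service with price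
`p = z ^ α`: WiFi competes like a service with this capacity. -/
noncomputable def wifiCapacity (g : Market N) : ℝ := g.wifiRate / g.α ^ (1 / (1 - g.α))

/-- The users' association in terms of `z = p ^ (1 / α)`, the mass of users that a service with
price `p` can serve per unit of capacity, for arbitrary capacities `C`. In these terms all
conditions are linear. -/
structure IsFilling (g : Market N) (C z : Fin N → Tier → ℝ) (K : Association N) : Prop where
  mobile_nonneg : ∀ i, 0 ≤ K.mobile i
  fixed_nonneg : ∀ i t, 0 ≤ K.fixed i t
  wifi_pos : 0 < K.wifi
  load_le : ∀ i t, K.load i t ≤ C i t * z i t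
  mobile_le : ∑ i, K.mobile i ≤ g.Nm
  mobile_unserved : ∑ i, K.mobile i < g.Nm →
    ∀ i, K.mobile i = C i .macro_cell * z i .macro_cell
  mobile_choice : ∀ i j, 0 < K.mobile i → z j .macro_cell < z i .macro_cell →
    K.mobile j = C j .macro_cell * z j .macro_cell
  mobile_tie : ∀ i j, z i .macro_cell = z j .macro_cell →
    K.mobile i * C j .macro_cell = K.mobile j * C i .macro_cell
  fixed_total : ∑ i, (K.fixed i .macro_cell + K.fixed i .small_cell) + K.wifi = g.Nf
  fixed_choice : ∀ i t j s, 0 < K.fixed i t → z j s < z i t → K.load j s = C j s * z j s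
  fixed_not_wifi : ∀ i t, 0 < K.fixed i t → g.wifiCapacity * z i t ≤ K.wifi
  wifi_choice : ∀ i t, g.wifiCapacity * z i t < K.wifi → K.load i t = C i t * z i t
  fixed_tie : ∀ i t j s, z i t = z j s → K.fixed i t * C j s < K.fixed j s * C i t →
    K.load i t = C i t * z i t

lemma wifiRate_pos (g : Market N) : 0 < g.wifiRate :=
  mul_pos (mul_pos g.lamU_pos g.BU_pos) g.R₀_pos

lemma wifiCapacity_pos (g : Market N) : 0 < g.wifiCapacity :=
  div_pos g.wifiRate_pos (Real.rpow_pos_of_pos g.α_pos _)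

lemma one_sub_α_pos (g : Market N) : 0 < 1 - g.α := sub_pos.2 g.α_lt_one

lemma netPayoff_eq (g : Market N) {p : ℝ} (hp : 0 < p) :
    g.netPayoff p = g.α / (1 - g.α) * ((p ^ (1 / g.α))⁻¹) ^ (1 - g.α) := by
  have hα := g.α_pos.ne'
  have h1 := g.one_sub_α_pos.ne'
  have hd : g.demand p = (p ^ (1 / g.α))⁻¹ := by
    rw [demand, one_div p, Real.inv_rpow hp.le]
  set z := p ^ (1 / g.α) with hz
  have hz0 : 0 < z := Real.rpow_pos_of_pos hp _
  have hpz : p = z ^ g.α := by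
    rw [hz, ← Real.rpow_mul hp.le, one_div_mul_cancel hα, Real.rpow_one]
  have h2 : p * z⁻¹ = (z⁻¹) ^ (1 - g.α) := by
    rw [Real.inv_rpow hz0.le, ← Real.rpow_neg hz0.le, neg_sub, Real.rpow_sub_one hz0.ne', hpz]
    rfl
  rw [netPayoff, hd, utility, h2]
  field_simp
  ring

lemma netPayoff_lt_iff (g : Market N) {p q : ℝ} (hp : 0 < p) (hq : 0 < q) :
    g.netPayoff p < g.netPayoff q ↔ q ^ (1 / g.α) < p ^ (1 / g.α) := by
  rw [netPayoff_eq g hp, netPayoff_eq g hq,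
    mul_lt_mul_iff_right₀ (div_pos g.α_pos g.one_sub_α_pos),
    Real.rpow_lt_rpow_iff (inv_nonneg.2 (Real.rpow_nonneg hp.le _))
      (inv_nonneg.2 (Real.rpow_nonneg hq.le _)) g.one_sub_α_pos,
    inv_lt_inv₀ (Real.rpow_pos_of_pos hp _) (Real.rpow_pos_of_pos hq _)]

lemma netPayoff_eq_utility (g : Market N) {p : ℝ} (hp : 0 < p) :
    g.netPayoff p = g.utility (g.α ^ (1 / (1 - g.α)) / p ^ (1 / g.α)) := by
  have hz : 0 < p ^ (1 / g.α) := Real.rpow_pos_of_pos hp _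
  have ha : 0 < g.α ^ (1 / (1 - g.α)) := Real.rpow_pos_of_pos g.α_pos _
  have h1 : (g.α ^ (1 / (1 - g.α))) ^ (1 - g.α) = g.α := by
    rw [← Real.rpow_mul g.α_pos.le, one_div_mul_cancel g.one_sub_α_pos.ne', Real.rpow_one]
  rw [utility, div_eq_mul_inv _ (p ^ (1 / g.α)), Real.mul_rpow ha.le (inv_nonneg.2 hz.le), h1,
    netPayoff_eq g hp]
  ring

lemma utility_wifi_lt_iff (g : Market N) {p w : ℝ} (hp : 0 < p) (hw : 0 < w) :
    g.utility (g.wifiRate / w) < g.netPayoff p ↔ g.wifiCapacity * p ^ (1 / g.α) < w := by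
  have hz : 0 < p ^ (1 / g.α) := Real.rpow_pos_of_pos hp _
  have ha : 0 < g.α ^ (1 / (1 - g.α)) := Real.rpow_pos_of_pos g.α_pos _
  rw [g.netPayoff_eq_utility hp, utility, utility, div_lt_div_iff_of_pos_right g.one_sub_α_pos,
    Real.rpow_lt_rpow_iff (div_nonneg g.wifiRate_pos.le hw.le)
      (div_nonneg ha.le hz.le) g.one_sub_α_pos, wifiCapacity,
    div_lt_div_iff₀ hw hz, div_mul_eq_mul_div, div_lt_iff₀ ha, mul_comm w]

lemma utility_wifi_le_iff (g : Market N) {p w : ℝ} (hp : 0 < p) (hw : 0 < w) :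
    g.utility (g.wifiRate / w) ≤ g.netPayoff p ↔ g.wifiCapacity * p ^ (1 / g.α) ≤ w := by
  have hz : 0 < p ^ (1 / g.α) := Real.rpow_pos_of_pos hp _
  have ha : 0 < g.α ^ (1 / (1 - g.α)) := Real.rpow_pos_of_pos g.α_pos _
  rw [g.netPayoff_eq_utility hp, utility, utility, div_le_div_iff_of_pos_right g.one_sub_α_pos,
    Real.rpow_le_rpow_iff (div_nonneg g.wifiRate_pos.le hw.le)
      (div_nonneg ha.le hz.le) g.one_sub_α_pos, wifiCapacity,
    div_le_div_iff₀ hw hz, div_mul_eq_mul_div, div_le_iff₀ ha, mul_comm w]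

/-- The prices in terms of the mass of users served per unit of capacity. -/
noncomputable def perCapacity (g : Market N) (p : Prices N) : Fin N → Tier → ℝ :=
  fun i t => p i t ^ (1 / g.α)

lemma perCapacity_nonneg (g : Market N) {p : Prices N} (hp : ∀ i t, 0 ≤ p i t) (i : Fin N)
    (t : Tier) : 0 ≤ g.perCapacity p i t := Real.rpow_nonneg (hp i t) _

lemma perCapacity_eq_iff (g : Market N) {p q : Prices N} (hp : ∀ i t, 0 ≤ p i t)
    (hq : ∀ i t, 0 ≤ q i t) (i j : Fin N) (t s : Tier) :
    g.perCapacity p i t = g.perCapacity q j s ↔ p i t = q j s :=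
  Real.rpow_left_inj (hp i t) (hq j s) (one_div_ne_zero g.α_pos.ne')

end Market

lemma Association.mobile_le_load {N : ℕ} {K : Association N} {i : Fin N}
    (h : 0 ≤ K.fixed i .macro_cell) : K.mobile i ≤ K.load i .macro_cell := by
  simp only [Association.load]; linarith

lemma Association.fixed_le_load {N : ℕ} {K : Association N} {i : Fin N}
    (h : 0 ≤ K.mobile i) (t : Tier) : K.fixed i t ≤ K.load i t := by
  cases t <;> simp only [Association.load] <;> linarith

lemma Association.load_nonneg {N : ℕ} {K : Association N} {i : Fin N}
    (h : 0 ≤ K.mobile i) (h' : ∀ t, 0 ≤ K.fixed i t) (t : Tier) : 0 ≤ K.load i t :=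
  (h' t).trans (Association.fixed_le_load h t)

namespace Market

variable {N : ℕ} {g : Market N}

lemma isUserAssociation_iff {b : Bandwidths N} {p : Prices N} (hp : ∀ i t, 0 ≤ p i t)
    {K : Association N} :
    g.IsUserAssociation b p K ↔ g.IsFilling (g.capacity b) (g.perCapacity p) K := by
  have hzero : ∀ i t, p i t = 0 → g.maxUsers b p i t = 0 := fun i t h => by
    rw [maxUsers, h, Real.zero_rpow (one_div_ne_zero g.α_pos.ne'), mul_zero]
  have hpos : (∀ i, 0 ≤ K.mobile i) → (∀ i t, 0 ≤ K.fixed i t) →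
      (∀ i t, K.load i t ≤ g.maxUsers b p i t) → ∀ i t, 0 < K.load i t → 0 < p i t :=
    fun _ _ hl i t h => (hp i t).lt_of_ne fun h0 => by
      have := hl i t
      rw [hzero i t h0.symm] at this
      linarith
  -- a service with price zero serves nobody, so being full means nothing there
  have hfull0 : (∀ i, 0 ≤ K.mobile i) → (∀ i t, 0 ≤ K.fixed i t) →
      (∀ i t, K.load i t ≤ g.maxUsers b p i t) → ∀ i t, p i t = 0 →
      K.load i t = g.maxUsers b p i t ∧
        (t = .macro_cell → K.mobile i = g.maxUsers b p i .macro_cell) := by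
    intro h1 h2 h3 i t h0
    have h4 := h3 i t
    have h5 := Association.load_nonneg (h1 i) (h2 i) t
    rw [hzero i t h0] at h4 ⊢
    refine ⟨le_antisymm h4 h5, ?_⟩
    rintro rfl
    rw [hzero i _ h0]
    exact le_antisymm ((Association.mobile_le_load (h2 i _)).trans h4) (h1 i)
  constructor
  · intro h
    have hpos := hpos h.mobile_nonneg h.fixed_nonneg h.load_le
    have hfull0 := hfull0 h.mobile_nonneg h.fixed_nonneg h.load_le
    refine ⟨h.mobile_nonneg, h.fixed_nonneg, h.wifi_pos, h.load_le, h.mobile_le,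
      h.mobile_unserved, fun i j hi hij => ?_, fun i j hij => ?_, h.fixed_total,
      fun i t j s hi hij => ?_, fun i t hi => ?_, fun i t hi => ?_, fun i t j s hij => ?_⟩
    · rcases (hp j .macro_cell).eq_or_lt with hj | hj
      · exact (hfull0 j _ hj.symm).2 rfl
      · exact h.mobile_choice i j hi ((g.netPayoff_lt_iff
          (hpos i _ (hi.trans_le (Association.mobile_le_load (h.fixed_nonneg i _)))) hj).2 hij)
    · exact h.mobile_tie i j ((g.perCapacity_eq_iff hp hp ..).1 hij)
    · rcases (hp j s).eq_or_lt with hj | hj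
      · exact (hfull0 j _ hj.symm).1
      · exact h.fixed_choice i t j s hi ((g.netPayoff_lt_iff
          (hpos i _ (hi.trans_le (Association.fixed_le_load (h.mobile_nonneg i) _))) hj).2 hij)
    · exact (g.utility_wifi_le_iff (hpos i _ (hi.trans_le
        (Association.fixed_le_load (h.mobile_nonneg i) _))) h.wifi_pos).1 (h.fixed_not_wifi i t hi)
    · rcases (hp i t).eq_or_lt with hj | hj
      · exact (hfull0 i _ hj.symm).1
      · exact h.wifi_choice i t ((g.utility_wifi_lt_iff hj h.wifi_pos).2 hi)
    · exact h.fixed_tie i t j s ((g.perCapacity_eq_iff hp hp ..).1 hij)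
  · intro h
    have hpos := hpos h.mobile_nonneg h.fixed_nonneg h.load_le
    have hfull0 := hfull0 h.mobile_nonneg h.fixed_nonneg h.load_le
    refine ⟨h.mobile_nonneg, h.fixed_nonneg, h.wifi_pos, h.load_le, h.mobile_le,
      h.mobile_unserved, fun i j hi hij => ?_, fun i j hij => ?_, h.fixed_total,
      fun i t j s hi hij => ?_, fun i t hi => ?_, fun i t hi => ?_, fun i t j s hij => ?_⟩
    · rcases (hp j .macro_cell).eq_or_lt with hj | hj
      · exact (hfull0 j _ hj.symm).2 rfl
      · exact h.mobile_choice i j hi ((g.netPayoff_lt_iff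
          (hpos i _ (hi.trans_le (Association.mobile_le_load (h.fixed_nonneg i _)))) hj).1 hij)
    · exact h.mobile_tie i j ((g.perCapacity_eq_iff hp hp ..).2 hij)
    · rcases (hp j s).eq_or_lt with hj | hj
      · exact (hfull0 j _ hj.symm).1
      · exact h.fixed_choice i t j s hi ((g.netPayoff_lt_iff
          (hpos i _ (hi.trans_le (Association.fixed_le_load (h.mobile_nonneg i) _))) hj).1 hij)
    · exact (g.utility_wifi_le_iff (hpos i _ (hi.trans_le
        (Association.fixed_le_load (h.mobile_nonneg i) _))) h.wifi_pos).2 (h.fixed_not_wifi i t hi)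
    · rcases (hp i t).eq_or_lt with hj | hj
      · exact (hfull0 i _ hj.symm).1
      · exact h.wifi_choice i t ((g.utility_wifi_lt_iff hj h.wifi_pos).1 hi)
    · exact h.fixed_tie i t j s ((g.perCapacity_eq_iff hp hp ..).2 hij)

/-- What the mobile users leave of a service to the fixed users. -/
def room (C z : Fin N → Tier → ℝ) (m : Fin N → ℝ) (i : Fin N) : Tier → ℝ
  | .macro_cell => C i .macro_cell * z i .macro_cell - m i
  | .small_cell => C i .small_cell * z i .small_cell

lemma load_eq_iff {C z : Fin N → Tier → ℝ} {K : Association N} (i : Fin N) (t : Tier) :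
    K.load i t = C i t * z i t ↔ K.fixed i t = room C z K.mobile i t := by
  cases t <;> simp only [Association.load, room]
  constructor <;> intro h <;> linarith

lemma load_le_iff {C z : Fin N → Tier → ℝ} {K : Association N} (i : Fin N) (t : Tier) :
    K.load i t ≤ C i t * z i t ↔ K.fixed i t ≤ room C z K.mobile i t := by
  cases t <;> simp only [Association.load, room]
  constructor <;> intro h <;> linarith

lemma room_le {C z : Fin N → Tier → ℝ} {m : Fin N → ℝ} (hm : ∀ i, 0 ≤ m i) (i : Fin N) (t : Tier) :
    room C z m i t ≤ C i t * z i t := by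
  cases t <;> simp only [room, le_refl]
  linarith [hm i]

namespace IsFilling

variable {C z : Fin N → Tier → ℝ} {K K' : Association N}

lemma load_nonneg (h : g.IsFilling C z K) (i : Fin N) (t : Tier) : 0 ≤ K.load i t :=
  Association.load_nonneg (h.mobile_nonneg i) (h.fixed_nonneg i) t

lemma mobile_le_load (h : g.IsFilling C z K) (i : Fin N) : K.mobile i ≤ K.load i .macro_cell :=
  Association.mobile_le_load (h.fixed_nonneg i _)

lemma isPriceOrdered_mobile (h : g.IsFilling C z K) :
    IsPriceOrdered (fun i => C i .macro_cell) (fun i => z i .macro_cell)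
      (fun i => C i .macro_cell * z i .macro_cell) K.mobile :=
  ⟨h.mobile_nonneg, fun i => (h.mobile_le_load i).trans (h.load_le i _),
    h.mobile_choice, fun i j hij hlt => absurd (h.mobile_tie i j hij) hlt.ne⟩

lemma isPriceOrdered_fixed (h : g.IsFilling C z K) :
    IsPriceOrdered (fun x : Fin N × Tier => C x.1 x.2) (fun x => z x.1 x.2)
      (fun x => room C z K.mobile x.1 x.2) (fun x => K.fixed x.1 x.2) :=
  ⟨fun _ => h.fixed_nonneg _ _, fun x => (load_le_iff x.1 x.2).1 (h.load_le _ _),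
    fun x y hx hxy => (load_eq_iff y.1 y.2).1 (h.fixed_choice x.1 x.2 y.1 y.2 hx hxy),
    fun x y hxy hlt => (load_eq_iff x.1 x.2).1 (h.fixed_tie x.1 x.2 y.1 y.2 hxy hlt)⟩

lemma mobile_le_mobile (hC : ∀ i t, 0 ≤ C i t) (h : g.IsFilling C z K)
    (h' : g.IsFilling C z K') (i : Fin N) : K.mobile i ≤ K'.mobile i := by
  by_contra! hi
  have hpos : ∀ i, 0 < C i .macro_cell * z i .macro_cell → 0 < C i .macro_cell := fun i hi =>
    (hC i _).lt_of_ne fun h0 => by rw [← h0, zero_mul] at hi; exact lt_irrefl _ hi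
  have hle := h'.isPriceOrdered_mobile.le_of_lt hpos h.isPriceOrdered_mobile hi
  have hlt : ∑ i, K'.mobile i < ∑ i, K.mobile i :=
    Finset.sum_lt_sum (fun j _ => hle j) ⟨i, Finset.mem_univ _, hi⟩
  have := h'.mobile_unserved (hlt.trans_le h.mobile_le) i
  have := (h.mobile_le_load i).trans (h.load_le i _)
  linarith

lemma fixed_le_fixed (hC : ∀ i t, 0 ≤ C i t) (h : g.IsFilling C z K)
    (h' : g.IsFilling C z K') (hm : K.mobile = K'.mobile) (i : Fin N) (t : Tier) :
    K.fixed i t ≤ K'.fixed i t := by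
  by_contra! hi
  have hpos : ∀ x : Fin N × Tier, 0 < room C z K.mobile x.1 x.2 → 0 < C x.1 x.2 := fun x hx =>
    (hC _ _).lt_of_ne fun h0 => by
      have := hx.trans_le (room_le h.mobile_nonneg x.1 x.2)
      rw [← h0, zero_mul] at this
      exact lt_irrefl _ this
  have hf' := h'.isPriceOrdered_fixed
  rw [← hm] at hf'
  have hle := hf'.le_of_lt hpos h.isPriceOrdered_fixed (i := (i, t)) hi
  have hlt : ∑ j, (K'.fixed j .macro_cell + K'.fixed j .small_cell) <
      ∑ j, (K.fixed j .macro_cell + K.fixed j .small_cell) := by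
    refine Finset.sum_lt_sum (fun j _ => add_le_add (hle (j, _)) (hle (j, _)))
      ⟨i, Finset.mem_univ _, ?_⟩
    cases t
    · exact add_lt_add_of_lt_of_le hi (hle (i, .small_cell))
    · exact add_lt_add_of_le_of_lt (hle (i, .macro_cell)) hi
  have h1 := h.fixed_total
  have h2 := h'.fixed_total
  have h3 := h.fixed_not_wifi i t ((h'.fixed_nonneg i t).trans_lt hi)
  have h4 := h'.wifi_choice i t (by linarith)
  rw [load_eq_iff, ← hm] at h4
  have := (load_le_iff i t).1 (h.load_le i t)
  linarith

lemma unique (hC : ∀ i t, 0 ≤ C i t) (h : g.IsFilling C z K) (h' : g.IsFilling C z K') :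
    K = K' := by
  have hm : K.mobile = K'.mobile := funext fun i =>
    le_antisymm (h.mobile_le_mobile hC h' i) (h'.mobile_le_mobile hC h i)
  have hf : K.fixed = K'.fixed := funext fun i => funext fun t =>
    le_antisymm (h.fixed_le_fixed hC h' hm i t) (h'.fixed_le_fixed hC h hm.symm i t)
  have h1 := h.fixed_total
  have h2 := h'.fixed_total
  rw [hf] at h1
  obtain ⟨m, f, w⟩ := K
  obtain ⟨m', f', w'⟩ := K'
  simp only [Association.mk.injEq] at *
  exact ⟨hm, hf, by linarith⟩

end IsFilling

lemma exists_mobile (g : Market N) {C z : Fin N → Tier → ℝ} (hC : ∀ i t, 0 ≤ C i t)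
    (hz : ∀ i t, 0 ≤ z i t) : ∃ m : Fin N → ℝ,
      IsPriceOrdered (fun i => C i .macro_cell) (fun i => z i .macro_cell)
        (fun i => C i .macro_cell * z i .macro_cell) m ∧
      (∀ i j, z i .macro_cell = z j .macro_cell →
        m i * C j .macro_cell = m j * C i .macro_cell) ∧ ∑ i, m i ≤ g.Nm ∧
      (∑ i, m i < g.Nm → ∀ i, m i = C i .macro_cell * z i .macro_cell) := by
  have hCz : ∀ i, 0 ≤ C i .macro_cell * z i .macro_cell := fun i => mul_nonneg (hC i _) (hz i _)
  rcases le_or_gt (∑ i, C i .macro_cell * z i .macro_cell) g.Nm with hN | hN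
  · refine ⟨fun i => C i .macro_cell * z i .macro_cell,
      ⟨hCz, fun _ => le_rfl, fun _ _ _ _ => rfl, fun _ _ _ _ => rfl⟩, fun i j hij => ?_, hN,
      fun _ _ => rfl⟩
    simp only [hij]; ring
  · have hX : ∀ i, z i .macro_cell < ∑ j, z j .macro_cell + 1 := fun i => by
      have := Finset.single_le_sum (f := fun j => z j .macro_cell) (fun j _ => hz j _)
        (Finset.mem_univ i)
      linarith
    obtain ⟨φ, m, hφ, hm, hsum, -, -⟩ := exists_isPriceOrdered (fun i => C i .macro_cell)
      (fun i => z i .macro_cell) (fun i => C i .macro_cell * z i .macro_cell) (W := 0) (n := g.Nm)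
      (X := ∑ j, z j .macro_cell + 1) (fun i => hC i _) (fun i => hz i _) hCz (fun _ => le_rfl)
      le_rfl g.Nm_pos (by simpa only [hX, if_true, zero_mul, add_zero] using hN)
    have hle : ∀ i j, z i .macro_cell = z j .macro_cell →
        m j * C i .macro_cell ≤ m i * C j .macro_cell := fun i j hij => by
      by_contra! hlt
      have h1 := hm.tie i j hij hlt
      have h2 := mul_le_mul_of_nonneg_right (hm.le_room j) (hC i .macro_cell)
      rw [h1, hij] at hlt
      linarith
    refine ⟨m, hm, fun i j hij => le_antisymm (hle j i hij.symm) (hle i j hij), by linarith,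
      fun h => by linarith⟩

lemma exists_isFilling (g : Market N) {C z : Fin N → Tier → ℝ} (hC : ∀ i t, 0 ≤ C i t)
    (hz : ∀ i t, 0 ≤ z i t) : ∃ K, g.IsFilling C z K := by
  obtain ⟨m, hm, htie, hle, hun⟩ := g.exists_mobile hC hz
  have hroom : ∀ i t, 0 ≤ room C z m i t := by
    rintro i (_ | _)
    · exact sub_nonneg.2 (hm.le_room i)
    · exact mul_nonneg (hC _ _) (hz _ _)
  have hW := g.wifiCapacity_pos
  have hX : g.Nf < (∑ x : Fin N × Tier, if z x.1 x.2 < (g.Nf + 1) / g.wifiCapacity then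
      room C z m x.1 x.2 else 0) + g.wifiCapacity * ((g.Nf + 1) / g.wifiCapacity) := by
    rw [mul_div_cancel₀ _ hW.ne']
    have : 0 ≤ ∑ x : Fin N × Tier, if z x.1 x.2 < (g.Nf + 1) / g.wifiCapacity then
        room C z m x.1 x.2 else 0 := Finset.sum_nonneg fun x _ => by
      split_ifs
      exacts [hroom _ _, le_rfl]
    linarith
  obtain ⟨φ, f, hφ, hf, hsum, hlow, hhigh⟩ := exists_isPriceOrdered (fun x : Fin N × Tier => C x.1 x.2)
    (fun x => z x.1 x.2) (fun x => room C z m x.1 x.2) (fun _ => hC _ _) (fun _ => hz _ _)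
    (fun _ => hroom _ _) (fun _ => room_le hm.nonneg _ _) hW.le g.Nf_pos hX
  refine ⟨⟨m, fun i t => f (i, t), g.wifiCapacity * φ⟩, hm.nonneg, fun i t => hf.nonneg _,
    mul_pos hW hφ, fun i t => (load_le_iff i t).2 (hf.le_room (i, t)), hle, hun, hm.choice, htie, ?_,
    fun i t j s h1 h2 => (load_eq_iff j s).2 (hf.choice (i, t) (j, s) h1 h2),
    fun i t hi => ?_, fun i t hi => ?_,
    fun i t j s h1 h2 => (load_eq_iff i t).2 (hf.tie (i, t) (j, s) h1 h2)⟩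
  · rw [← hsum, Fintype.sum_prod_type]
    simp only [Tier.sum_eq]
  · refine mul_le_mul_of_nonneg_left (le_of_not_gt fun h => ?_) hW.le
    exact hi.ne' (hhigh (i, t) h)
  · exact (load_eq_iff i t).2 (hlow (i, t) (lt_of_mul_lt_mul_left hi hW.le))

end Market

namespace Market

variable {N : ℕ} {g : Market N} {C z : Fin N → Tier → ℝ} {K K' : Association N} {i : Fin N}
  {y : Tier → ℝ}

/-! ### Deviations in the price stage -/

/-- Revenue of SP `i` if its prices, per unit of capacity, are `y`. -/
noncomputable def payoff (g : Market N) (K : Association N) (i : Fin N) (y : Tier → ℝ) : ℝ :=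
  K.load i .macro_cell * y .macro_cell ^ (g.α - 1) +
    K.load i .small_cell * y .small_cell ^ (g.α - 1)

/-- Price equilibria in terms of prices per unit of capacity. -/
def IsNash (g : Market N) (C z : Fin N → Tier → ℝ) : Prop :=
  ∀ (K : Association N) (i : Fin N) (y : Tier → ℝ) (K' : Association N), g.IsFilling C z K →
    (∀ t, 0 ≤ y t) → g.IsFilling C (Function.update z i y) K' →
    g.payoff K' i y ≤ g.payoff K i (z i)

/-- Mass of users that the services of tier `t` with price at most `x` of the SPs other than `i`
can serve. -/
noncomputable def supply (C z : Fin N → Tier → ℝ) (i : Fin N) (t : Tier) (x : ℝ) : ℝ :=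
  ∑ j ∈ Finset.univ.erase i, if z j t ≤ x then C j t * z j t else 0

/-- A condition under which the macro-cells of SP `i` are full after its deviation to the prices
`y`: there are enough mobile users, or enough users altogether, to fill all services that are as
cheap. -/
def MacroFills (g : Market N) (C z : Fin N → Tier → ℝ) (i : Fin N) (y : Tier → ℝ) : Prop :=
  C i .macro_cell * y .macro_cell = 0 ∨
    supply C z i .macro_cell (y .macro_cell) + C i .macro_cell * y .macro_cell ≤ g.Nm ∨
    supply C z i .macro_cell (y .macro_cell) + supply C z i .small_cell (y .macro_cell) +
      C i .macro_cell * y .macro_cell + C i .small_cell * y .small_cell +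
      g.wifiCapacity * y .macro_cell ≤ g.Nm + g.Nf

/-- A condition under which the small-cells of SP `i` are full after its deviation to the prices
`y`: there are enough fixed users to fill the small-cells that are as cheap, and enough users to
fill all services that are as cheap. -/
def SmallFills (g : Market N) (C z : Fin N → Tier → ℝ) (i : Fin N) (y : Tier → ℝ) : Prop :=
  C i .small_cell * y .small_cell = 0 ∨
    (supply C z i .small_cell (y .small_cell) + C i .small_cell * y .small_cell +
      g.wifiCapacity * y .small_cell ≤ g.Nf ∧
    supply C z i .macro_cell (y .small_cell) + supply C z i .small_cell (y .small_cell) +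
      C i .macro_cell * y .macro_cell + C i .small_cell * y .small_cell +
      g.wifiCapacity * y .small_cell ≤ g.Nm + g.Nf)

lemma sum_eq_add_erase (i : Fin N) (f : Fin N → ℝ) :
    ∑ j, f j = f i + ∑ j ∈ Finset.univ.erase i, f j :=
  (Finset.add_sum_erase _ f (Finset.mem_univ i)).symm

namespace IsFilling

lemma total (h : g.IsFilling C z K) (i : Fin N) :
    K.load i .macro_cell + K.load i .small_cell +
      ∑ j ∈ Finset.univ.erase i, K.load j .macro_cell +
      ∑ j ∈ Finset.univ.erase i, K.load j .small_cell + K.wifi = ∑ j, K.mobile j + g.Nf := by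
  have h1 := h.fixed_total
  have h2 := sum_eq_add_erase i fun j => K.load j .macro_cell
  have h3 := sum_eq_add_erase i fun j => K.load j .small_cell
  simp only [Association.load, Finset.sum_add_distrib] at h1 h2 h3 ⊢
  linarith

lemma total_small (h : g.IsFilling C z K) (i : Fin N) :
    K.load i .small_cell + ∑ j ∈ Finset.univ.erase i, K.load j .small_cell + K.wifi +
      ∑ j, K.fixed j .macro_cell = g.Nf := by
  have h1 := h.fixed_total
  have h3 := sum_eq_add_erase i fun j => K.load j .small_cell
  simp only [Association.load, Finset.sum_add_distrib] at h1 h3 ⊢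
  linarith

lemma sum_fixed_macro_nonneg (h : g.IsFilling C z K) : 0 ≤ ∑ j, K.fixed j .macro_cell :=
  Finset.sum_nonneg fun j _ => h.fixed_nonneg j _

lemma load_le_supply (h : g.IsFilling C (Function.update z i y) K) {t : Tier} {x : ℝ}
    (hx : ∀ j, j ≠ i → 0 < K.load j t → z j t ≤ x) :
    ∑ j ∈ Finset.univ.erase i, K.load j t ≤ supply C z i t x := by
  refine Finset.sum_le_sum fun j hj => ?_
  have hji := Finset.ne_of_mem_erase hj
  have h1 := h.load_le j t
  rw [Function.update_of_ne hji] at h1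
  rcases (h.load_nonneg j t).eq_or_lt with h0 | h0
  · rw [← h0] at h1 ⊢
    split_ifs <;> linarith
  · rwa [if_pos (hx j hji h0)]

lemma load_macro_eq (h : g.IsFilling C (Function.update z i y) K) (hM : g.MacroFills C z i y) :
    K.load i .macro_cell = C i .macro_cell * y .macro_cell := by
  have hle := h.load_le i .macro_cell
  rw [Function.update_self] at hle
  refine hle.antisymm (le_of_not_gt fun hlt => ?_)
  have hmi := h.mobile_le_load i
  have hmN : ∑ j, K.mobile j = g.Nm := h.mobile_le.antisymm (le_of_not_gt fun hN => by
    have := h.mobile_unserved hN i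
    rw [Function.update_self] at this
    linarith)
  have hz : ∀ j, j ≠ i → 0 < K.mobile j → z j .macro_cell ≤ y .macro_cell := fun j hj h0 => by
    by_contra! hlt'
    have := h.mobile_choice j i h0 (by
      rwa [Function.update_self, Function.update_of_ne hj])
    rw [Function.update_self] at this
    linarith
  have hzf : ∀ j, j ≠ i → ∀ t, 0 < K.fixed j t → z j t ≤ y .macro_cell := fun j hj t h0 => by
    by_contra! hlt'
    have := h.fixed_choice j t i .macro_cell h0 (by
      rwa [Function.update_self, Function.update_of_ne hj])
    rw [Function.update_self] at this
    linarith
  rcases hM with h0 | hM | hM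
  · rw [h0] at hlt
    exact absurd hlt (not_lt.2 (h.load_nonneg _ _))
  · have h1 : ∑ j ∈ Finset.univ.erase i, K.mobile j ≤
        supply C z i .macro_cell (y .macro_cell) := by
      refine Finset.sum_le_sum fun j hj => ?_
      have hji := Finset.ne_of_mem_erase hj
      have h1 := (h.mobile_le_load j).trans (h.load_le j _)
      rw [Function.update_of_ne hji] at h1
      rcases (h.mobile_nonneg j).eq_or_lt with h0 | h0
      · rw [← h0] at h1 ⊢
        split_ifs <;> linarith
      · rwa [if_pos (hz j hji h0)]
    have h2 := sum_eq_add_erase i K.mobile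
    linarith
  · have h1 := h.load_le_supply (t := .macro_cell) (x := y .macro_cell) fun j hj h0 => by
      by_cases hm : 0 < K.mobile j
      · exact hz j hj hm
      · refine hzf j hj _ ?_
        simp only [Association.load] at h0
        linarith
    have h2 := h.load_le_supply (t := .small_cell) (x := y .macro_cell) fun j hj h0 =>
      hzf j hj _ h0
    have h3 := h.total i
    have h4 := h.load_le i .small_cell
    rw [Function.update_self] at h4
    have h5 : K.wifi ≤ g.wifiCapacity * y .macro_cell := by
      by_contra! hw
      have := h.wifi_choice i .macro_cell (by rwa [Function.update_self])
      rw [Function.update_self] at this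
      linarith
    linarith

lemma load_small_eq (h : g.IsFilling C (Function.update z i y) K) (hS : g.SmallFills C z i y) :
    K.load i .small_cell = C i .small_cell * y .small_cell := by
  have hle := h.load_le i .small_cell
  have hleM := h.load_le i .macro_cell
  rw [Function.update_self] at hle hleM
  refine hle.antisymm (le_of_not_gt fun hlt => ?_)
  rcases hS with h0 | ⟨hS, hT⟩
  · rw [h0] at hlt
    exact absurd hlt (not_lt.2 (h.load_nonneg _ _))
  have hzf : ∀ j t, 0 < K.fixed j t → Function.update z i y j t ≤ y .small_cell := fun j t h0 => by
    by_contra! hlt'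
    have := h.fixed_choice j t i .small_cell h0 (by rwa [Function.update_self])
    rw [Function.update_self] at this
    linarith
  have hzf' : ∀ j, j ≠ i → ∀ t, 0 < K.fixed j t → z j t ≤ y .small_cell := fun j hj t h0 => by
    have := hzf j t h0
    rwa [Function.update_of_ne hj] at this
  have h2 := h.load_le_supply (t := .small_cell) (x := y .small_cell) fun j hj h0 =>
      hzf' j hj _ h0
  have h5 : K.wifi ≤ g.wifiCapacity * y .small_cell := by
    by_contra! hw
    have := h.wifi_choice i .small_cell (by rwa [Function.update_self])
    rw [Function.update_self] at this
    linarith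
  by_cases hf : ∃ k, 0 < K.fixed k .macro_cell
  · -- a macro-cell with fixed users has room for mobile users, who are all served at least as cheap
    obtain ⟨k, hk⟩ := hf
    have hmk : K.mobile k ≠ C k .macro_cell * Function.update z i y k .macro_cell := fun heq => by
      have := h.load_le k .macro_cell
      simp only [Association.load] at this
      linarith
    have hz : ∀ j, j ≠ i → 0 < K.mobile j → z j .macro_cell ≤ y .small_cell := fun j hj h0 => by
      refine le_trans ?_ (hzf k _ hk)
      by_contra! hlt'
      exact hmk (h.mobile_choice j k h0 (by rwa [Function.update_of_ne hj]))
    have h1 := h.load_le_supply (t := .macro_cell) (x := y .small_cell) fun j hj h0 => by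
      by_cases hm : 0 < K.mobile j
      · exact hz j hj hm
      · refine hzf' j hj _ ?_
        simp only [Association.load] at h0
        linarith
    have hmN : ∑ j, K.mobile j = g.Nm := h.mobile_le.antisymm (le_of_not_gt fun hN =>
      hmk (h.mobile_unserved hN k))
    have h3 := h.total i
    linarith
  · push Not at hf
    have h3 := h.total_small i
    have h4 : ∑ j, K.fixed j .macro_cell ≤ 0 := Finset.sum_nonpos fun j _ => hf j
    linarith

lemma supply_le (h : g.IsFilling C z K) {t : Tier} {x : ℝ}
    (hx : ∀ j, j ≠ i → z j t ≤ x → K.load j t = C j t * z j t) :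
    supply C z i t x ≤ ∑ j ∈ Finset.univ.erase i, K.load j t := by
  refine Finset.sum_le_sum fun j hj => ?_
  split_ifs with h'
  · exact (hx j (Finset.ne_of_mem_erase hj) h').ge
  · exact h.load_nonneg j t

lemma supply_le_mobile (h : g.IsFilling C z K) {x : ℝ}
    (hx : ∀ j, j ≠ i → z j .macro_cell ≤ x → K.mobile j = C j .macro_cell * z j .macro_cell) :
    supply C z i .macro_cell x ≤ ∑ j ∈ Finset.univ.erase i, K.mobile j := by
  refine Finset.sum_le_sum fun j hj => ?_
  split_ifs with h'
  · exact (hx j (Finset.ne_of_mem_erase hj) h').ge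
  · exact h.mobile_nonneg j

/-- Cheaper macro-cells for no more users than before are full. -/
lemma macroFills_of_lt (h : g.IsFilling C z K)
    (hsum : C i .macro_cell * y .macro_cell + C i .small_cell * y .small_cell ≤
      K.load i .macro_cell + K.load i .small_cell)
    (hle : C i .macro_cell * y .macro_cell ≤ K.load i .macro_cell)
    (hlt : y .macro_cell < z i .macro_cell) (hpos : 0 < K.load i .macro_cell) :
    g.MacroFills C z i y := by
  right
  rcases (h.fixed_nonneg i .macro_cell).eq_or_lt with hf | hf
  · left
    have hm : K.mobile i = K.load i .macro_cell := by simp [Association.load, ← hf]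
    have h1 := h.supply_le_mobile (i := i) (x := y .macro_cell) fun j _ hj =>
      h.mobile_choice i j (hm ▸ hpos) (hj.trans_lt hlt)
    have h2 := sum_eq_add_erase i K.mobile
    have h3 := h.mobile_le
    linarith
  · right
    have h1 : ∀ t, supply C z i t (y .macro_cell) ≤ ∑ j ∈ Finset.univ.erase i, K.load j t :=
      fun t => h.supply_le fun j _ hj =>
        h.fixed_choice i _ j t hf (hj.trans_lt hlt)
    have h2 := h.total i
    have h3 := h.mobile_le
    have h4 := h.fixed_not_wifi i _ hf
    have h5 := mul_lt_mul_of_pos_left hlt g.wifiCapacity_pos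
    linarith [h1 .macro_cell, h1 .small_cell]

/-- Cheaper small-cells for no more users than before are full. -/
lemma smallFills_of_lt (h : g.IsFilling C z K)
    (hsum : C i .macro_cell * y .macro_cell + C i .small_cell * y .small_cell ≤
      K.load i .macro_cell + K.load i .small_cell)
    (hle : C i .small_cell * y .small_cell ≤ K.load i .small_cell)
    (hlt : y .small_cell < z i .small_cell) (hpos : 0 < K.load i .small_cell) :
    g.SmallFills C z i y := by
  right
  have hf : 0 < K.fixed i .small_cell := hpos
  have h1 : ∀ t, supply C z i t (y .small_cell) ≤ ∑ j ∈ Finset.univ.erase i, K.load j t :=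
    fun t => h.supply_le fun j _ hj =>
      h.fixed_choice i _ j t hf (hj.trans_lt hlt)
  have h2 := h.total i
  have h2' := h.total_small i
  have h3 := h.mobile_le
  have h4 := h.fixed_not_wifi i _ hf
  have h5 := mul_lt_mul_of_pos_left hlt g.wifiCapacity_pos
  have h6 := h.sum_fixed_macro_nonneg
  constructor <;> linarith [h1 .macro_cell, h1 .small_cell]

end IsFilling

lemma mul_rpow_sub_one (g : Market N) {x : ℝ} (hx : 0 ≤ x) : x * x ^ (g.α - 1) = x ^ g.α := by
  rcases hx.eq_or_lt with rfl | hx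
  · rw [zero_mul, Real.zero_rpow g.α_pos.ne']
  · rw [Real.rpow_sub_one hx.ne']; field_simp

/-- A deviation that keeps both services of SP `i` full yields their capacities times the prices. -/
lemma IsNash.le_payoff (hN : g.IsNash C z) (hC : ∀ i t, 0 ≤ C i t) (hz : ∀ i t, 0 ≤ z i t)
    (h : g.IsFilling C z K) (hy : ∀ t, 0 ≤ y t) (hM : g.MacroFills C z i y)
    (hS : g.SmallFills C z i y) :
    C i .macro_cell * y .macro_cell ^ g.α + C i .small_cell * y .small_cell ^ g.α ≤
      g.payoff K i (z i) := by
  have hz' : ∀ j t, 0 ≤ Function.update z i y j t := fun j t => by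
    by_cases hj : j = i
    · subst hj; rw [Function.update_self]; exact hy t
    · rw [Function.update_of_ne hj]; exact hz j t
  obtain ⟨K', h'⟩ := g.exists_isFilling hC hz'
  refine le_trans (le_of_eq ?_) (hN K i y K' h hy h')
  rw [payoff, h'.load_macro_eq hM, h'.load_small_eq hS, mul_assoc, mul_assoc,
    g.mul_rpow_sub_one (hy _), g.mul_rpow_sub_one (hy _)]

end Market

/-- A function on the two tiers, given by its values. -/
def tierPair (a b : ℝ) : Tier → ℝ
  | .macro_cell => a
  | .small_cell => b

@[simp] lemma tierPair_macro (a b : ℝ) : tierPair a b .macro_cell = a := rfl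

@[simp] lemma tierPair_small (a b : ℝ) : tierPair a b .small_cell = b := rfl

lemma tierPair_nonneg {a b : ℝ} (ha : 0 ≤ a) (hb : 0 ≤ b) (t : Tier) : 0 ≤ tierPair a b t := by
  cases t <;> assumption

lemma eventually_add_mul_lt {a b : ℝ} (h : a < b) (k : ℝ) :
    ∀ᶠ δ in 𝓝[>] (0 : ℝ), a + k * δ < b := by
  have : Continuous fun δ : ℝ => a + k * δ := by fun_prop
  have h1 : Tendsto (fun δ : ℝ => a + k * δ) (𝓝 0) (𝓝 a) := by
    simpa using this.tendsto 0
  exact (h1.mono_left nhdsWithin_le_nhds).eventually_lt_const h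

namespace Market

variable {N : ℕ} {g : Market N} {C z : Fin N → Tier → ℝ} {K : Association N} {i : Fin N}

/-- Concavity of `x ^ α`: the tangent at `y` lies above the graph. -/
lemma rpow_le_tangent (g : Market N) {x y : ℝ} (hx : 0 ≤ x) (hy : 0 < y) :
    x ^ g.α ≤ y ^ g.α + g.α * y ^ (g.α - 1) * (x - y) := by
  have h1 : x = y * (1 + (x / y - 1)) := by field_simp; ring
  have h2 : -1 ≤ x / y - 1 := by have := div_nonneg hx hy.le; linarith
  have h3 := rpow_one_add_le_one_add_mul_self h2 g.α_pos.le g.α_lt_one.le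
  have h4 : x ^ g.α = y ^ g.α * (1 + (x / y - 1)) ^ g.α := by
    rw [← Real.mul_rpow hy.le (by linarith), ← h1]
  have h5 : y ^ g.α = y * y ^ (g.α - 1) := (g.mul_rpow_sub_one hy.le).symm
  have h6 := mul_le_mul_of_nonneg_left h3 (Real.rpow_nonneg hy.le g.α)
  rw [← h4] at h6
  refine h6.trans (le_of_eq ?_)
  rw [h5]
  field_simp

lemma rpow_sub_one_lt (g : Market N) {x y : ℝ} (hx : 0 < x) (hxy : x < y) :
    y ^ (g.α - 1) < x ^ (g.α - 1) :=
  Real.rpow_lt_rpow_of_neg hx hxy (by linarith [g.α_lt_one])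

/-- Moving users from an expensive to a cheap service, both being full, raises the revenue. -/
lemma transfer_gain (g : Market N) {c d a a' s s' : ℝ} (hc : 0 < c) (hd : 0 ≤ d) (ha : 0 ≤ a)
    (haa : a < a') (has : a' < s') (hs : 0 ≤ s) (h : c * (a' - a) = d * (s - s')) :
    c * a ^ g.α + d * s ^ g.α < c * a' ^ g.α + d * s' ^ g.α := by
  have ha' : 0 < a' := ha.trans_lt haa
  have h1 := mul_le_mul_of_nonneg_left (g.rpow_le_tangent ha ha') hc.le
  have h2 := mul_le_mul_of_nonneg_left (g.rpow_le_tangent hs (ha'.trans has)) hd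
  have h3 := mul_lt_mul_of_pos_left (g.rpow_sub_one_lt ha' has)
    (mul_pos (mul_pos hc (sub_pos.2 haa)) g.α_pos)
  have h4 : d * (g.α * s' ^ (g.α - 1) * (s - s')) =
      c * (a' - a) * g.α * s' ^ (g.α - 1) := by rw [h]; ring
  linarith

/-! ### Uniqueness of price equilibria -/

lemma payoff_full (h : ∀ t, K.load i t = C i t * z i t) (hz : ∀ i t, 0 ≤ z i t) :
    g.payoff K i (z i) =
      C i .macro_cell * z i .macro_cell ^ g.α + C i .small_cell * z i .small_cell ^ g.α := by
  rw [payoff, h, h, mul_assoc, mul_assoc, g.mul_rpow_sub_one (hz _ _),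
    g.mul_rpow_sub_one (hz _ _)]

lemma IsFilling.load_eq_zero (h : g.IsFilling C z K) {t : Tier} (hC : C i t = 0) :
    K.load i t = 0 :=
  le_antisymm (by simpa [hC] using h.load_le i t) (h.load_nonneg i t)

/-- In equilibrium every service is full or empty: otherwise its SP could charge the lower prices at
which its present users just fill its services, and lose none of them. -/
lemma IsNash.full_or_empty (hN : g.IsNash C z) (hC : ∀ i t, 0 ≤ C i t) (hz : ∀ i t, 0 ≤ z i t)
    (h : g.IsFilling C z K) (i : Fin N) (t : Tier) :
    K.load i t = C i t * z i t ∨ K.load i t = 0 := by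
  set k : Tier → ℝ := fun t => K.load i t / C i t with hk
  have hk0 : ∀ t, 0 ≤ k t := fun t => div_nonneg (h.load_nonneg i t) (hC i t)
  have hCk : ∀ t, C i t * k t = K.load i t := fun t => by
    rcases (hC i t).eq_or_lt with h0 | h0
    · rw [← h0, zero_mul, h.load_eq_zero h0.symm]
    · rw [hk]; field_simp
  have hkz : ∀ t, 0 < K.load i t → 0 < C i t ∧ 0 < k t ∧ k t ≤ z i t := fun t ht => by
    have hCt : 0 < C i t := (hC i t).lt_of_ne fun h0 => by
      rw [h.load_eq_zero h0.symm] at ht; exact lt_irrefl _ ht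
    exact ⟨hCt, div_pos ht hCt, by rw [div_le_iff₀ hCt, mul_comm]; exact h.load_le i t⟩
  have hdev : ∀ θ ∈ Set.Ioo (0 : ℝ) 1, θ ^ g.α *
      (C i .macro_cell * k .macro_cell ^ g.α + C i .small_cell * k .small_cell ^ g.α) ≤
        g.payoff K i (z i) := fun θ hθ => by
    have h1 : ∀ t, C i t * (θ * k t) = θ * K.load i t := fun t => by rw [← hCk]; ring
    have h2 : ∀ t, θ * K.load i t ≤ K.load i t := fun t =>
      mul_le_of_le_one_left (h.load_nonneg i t) hθ.2.le
    have h3 : ∀ t, 0 < K.load i t → θ * k t < z i t := fun t ht => by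
      obtain ⟨-, h4, h5⟩ := hkz t ht
      nlinarith [hθ.2]
    have hsum : C i .macro_cell * (θ * k .macro_cell) + C i .small_cell * (θ * k .small_cell) ≤
        K.load i .macro_cell + K.load i .small_cell := by
      rw [h1, h1]; exact add_le_add (h2 _) (h2 _)
    have hM : g.MacroFills C z i (fun t => θ * k t) := by
      rcases (h.load_nonneg i .macro_cell).eq_or_lt with h0 | h0
      · left; rw [h1, ← h0, mul_zero]
      · exact h.macroFills_of_lt hsum (by rw [h1]; exact h2 _) (h3 _ h0) h0
    have hS : g.SmallFills C z i (fun t => θ * k t) := by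
      rcases (h.load_nonneg i .small_cell).eq_or_lt with h0 | h0
      · left; rw [h1, ← h0, mul_zero]
      · exact h.smallFills_of_lt hsum (by rw [h1]; exact h2 _) (h3 _ h0) h0
    refine le_trans (le_of_eq ?_)
      (hN.le_payoff hC hz h (fun t => mul_nonneg hθ.1.le (hk0 t)) hM hS)
    rw [Real.mul_rpow hθ.1.le (hk0 _), Real.mul_rpow hθ.1.le (hk0 _)]
    ring
  have hle : C i .macro_cell * k .macro_cell ^ g.α + C i .small_cell * k .small_cell ^ g.α ≤
      g.payoff K i (z i) := by
    have hlim : Tendsto (fun θ : ℝ => θ ^ g.α * (C i .macro_cell * k .macro_cell ^ g.α +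
        C i .small_cell * k .small_cell ^ g.α)) (𝓝[<] 1)
        (𝓝 (C i .macro_cell * k .macro_cell ^ g.α + C i .small_cell * k .small_cell ^ g.α)) := by
      have : ContinuousAt (fun θ : ℝ => θ ^ g.α * (C i .macro_cell * k .macro_cell ^ g.α +
        C i .small_cell * k .small_cell ^ g.α)) 1 :=
        (Real.continuousAt_rpow_const _ _ (Or.inl one_ne_zero)).mul continuousAt_const
      have h1 := this.tendsto
      simp only [Real.one_rpow, one_mul] at h1
      exact h1.mono_left nhdsWithin_le_nhds
    refine le_of_tendsto hlim ?_
    filter_upwards [Ioo_mem_nhdsLT zero_lt_one] with θ hθ using hdev θ hθ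
  have heq : ∀ t, C i t * k t ^ g.α = K.load i t * k t ^ (g.α - 1) := fun t => by
    rw [← g.mul_rpow_sub_one (hk0 t), ← mul_assoc, hCk]
  have hterm : ∀ t, K.load i t * z i t ^ (g.α - 1) ≤ C i t * k t ^ g.α := fun t => by
    rw [heq]
    rcases (h.load_nonneg i t).eq_or_lt with h0 | h0
    · rw [← h0, zero_mul, zero_mul]
    · obtain ⟨-, h4, h5⟩ := hkz t h0
      refine mul_le_mul_of_nonneg_left ?_ h0.le
      rcases h5.eq_or_lt with h5 | h5
      · rw [h5]
      · exact (g.rpow_sub_one_lt h4 h5).le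
  by_contra! hne
  have h0 : 0 < K.load i t := (h.load_nonneg i t).lt_of_ne hne.2.symm
  obtain ⟨h3, h4, h5⟩ := hkz t h0
  have h6 : k t < z i t := h5.lt_of_ne fun h6 => hne.1 (by rw [← hCk, h6])
  have hstrict : K.load i t * z i t ^ (g.α - 1) < C i t * k t ^ g.α := by
    rw [heq]
    exact mul_lt_mul_of_pos_left (g.rpow_sub_one_lt h4 h6) h0
  have hM := hterm .macro_cell
  have hS := hterm .small_cell
  rw [payoff] at hle
  cases t <;> linarith

lemma supply_add_le (hC : ∀ i t, 0 ≤ C i t) (i : Fin N) (t : Tier) {x : ℝ} (hx : 0 ≤ x) :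
    supply C z i t x + C i t * x ≤ (∑ j, C j t) * x := by
  rw [sum_eq_add_erase i, add_mul, add_comm, Finset.sum_mul]
  refine add_le_add le_rfl (Finset.sum_le_sum fun j _ => ?_)
  split_ifs with h
  · exact mul_le_mul_of_nonneg_left h (hC _ _)
  · exact mul_nonneg (hC _ _) hx

/-- In equilibrium macro-cells are not empty: the first users pay more than those that the SP might
have to withdraw from its small-cells. -/
lemma IsNash.load_macro_pos (hN : g.IsNash C z) (hC : ∀ i t, 0 ≤ C i t) (hz : ∀ i t, 0 ≤ z i t)
    (h : g.IsFilling C z K) (hc : 0 < C i .macro_cell) : 0 < K.load i .macro_cell := by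
  refine (h.load_nonneg _ _).lt_of_ne fun h0 => ?_
  set c := C i .macro_cell with hcdef
  set d := C i .small_cell with hddef
  have hfill : ∀ᶠ ε in 𝓝[>] (0 : ℝ), ∀ y, g.MacroFills C z i (tierPair ε y) := by
    filter_upwards [eventually_add_mul_lt g.Nm_pos (∑ j, C j .macro_cell), self_mem_nhdsWithin]
      with ε h1 h2 y
    right; left
    have := supply_add_le (z := z) hC i .macro_cell (le_of_lt h2)
    simp only [tierPair_macro]
    linarith
  rcases (h.load_nonneg i .small_cell).eq_or_lt with hS | hS
  · obtain ⟨ε, hε, hε0⟩ := (hfill.and self_mem_nhdsWithin).exists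
    have h1 := hN.le_payoff hC hz h (tierPair_nonneg (le_of_lt hε0) le_rfl) (hε 0)
      (Or.inl (by simp))
    rw [payoff, ← h0, ← hS] at h1
    have h2 := mul_pos hc (Real.rpow_pos_of_pos hε0 g.α)
    simp only [tierPair_macro, tierPair_small, Real.zero_rpow g.α_pos.ne'] at h1
    linarith
  · have hfull : K.load i .small_cell = d * z i .small_cell :=
      (hN.full_or_empty hC hz h i _).resolve_right hS.ne'
    have hd : 0 < d := (hC _ _).lt_of_ne fun hd => by
      rw [hfull, hddef, ← hd, zero_mul] at hS; exact lt_irrefl _ hS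
    have hzS : 0 < z i .small_cell := by
      by_contra! hle
      rw [hfull] at hS
      nlinarith
    obtain ⟨ε, hε, hε1, hε0⟩ := (hfill.and ((eventually_add_mul_lt hzS (1 + c / d)).and
      self_mem_nhdsWithin)).exists
    have hcd : 0 < c / d * ε := mul_pos (div_pos hc hd) hε0
    have hd' : d * (z i .small_cell - c / d * ε) = d * z i .small_cell - c * ε := by
      field_simp
    have h1 := hN.le_payoff hC hz h (y := tierPair ε (z i .small_cell - c / d * ε))
      (tierPair_nonneg hε0.le (by linarith)) (hε _) (h.smallFills_of_lt
        (by simp only [tierPair_macro, tierPair_small, ← hddef, ← hcdef, hd', hfull, ← h0]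
            linarith)
        (by simp only [tierPair_small, ← hddef, hd', hfull]
            have := mul_pos hc hε0
            linarith)
        (by simp only [tierPair_small]; linarith) hS)
    have h2 := g.transfer_gain (a := 0) (a' := ε) (s := z i .small_cell)
      (s' := z i .small_cell - c / d * ε) hc hd.le le_rfl hε0 (by linarith) hzS.le
      (by field_simp; ring)
    rw [payoff, ← h0, hfull, mul_assoc, g.mul_rpow_sub_one hzS.le] at h1
    simp only [tierPair_macro, tierPair_small, Real.zero_rpow g.α_pos.ne'] at h1 h2
    linarith

/-- In equilibrium small-cells are not empty, for the same reason as macro-cells. -/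
lemma IsNash.load_small_pos (hN : g.IsNash C z) (hC : ∀ i t, 0 ≤ C i t) (hz : ∀ i t, 0 ≤ z i t)
    (h : g.IsFilling C z K) (hd : 0 < C i .small_cell) : 0 < K.load i .small_cell := by
  refine (h.load_nonneg _ _).lt_of_ne fun h0 => ?_
  set c := C i .macro_cell with hcdef
  set d := C i .small_cell with hddef
  have htot := h.total i
  have htot' := h.total_small i
  have hsum : ∀ t, 0 ≤ ∑ j ∈ Finset.univ.erase i, K.load j t := fun t =>
    Finset.sum_nonneg fun j _ => h.load_nonneg j t
  have hsM := hsum .macro_cell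
  have hsS := hsum .small_cell
  have hfM := h.sum_fixed_macro_nonneg
  have hNm := h.mobile_le
  have hfill : ∀ᶠ ε in 𝓝[>] (0 : ℝ), ∀ y, c * y ≤ K.load i .macro_cell →
      g.SmallFills C z i (tierPair y ε) := by
    filter_upwards [eventually_add_mul_lt h.wifi_pos
      (∑ j, C j .macro_cell + ∑ j, C j .small_cell + g.wifiCapacity), self_mem_nhdsWithin]
      with ε h1 h2 y hy
    rw [Set.mem_Ioi] at h2
    have h3 := supply_add_le (z := z) hC i .macro_cell h2.le
    have h4 := supply_add_le (z := z) hC i .small_cell h2.le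
    have h5 : 0 ≤ (∑ j, C j .macro_cell) * ε :=
      mul_nonneg (Finset.sum_nonneg fun j _ => hC j _) h2.le
    have h6 := mul_nonneg (hC i .macro_cell) h2.le
    right
    simp only [tierPair_macro, tierPair_small]
    constructor <;> linarith
  rcases (h.load_nonneg i .macro_cell).eq_or_lt with hM | hM
  · obtain ⟨ε, hε, hε0⟩ := (hfill.and self_mem_nhdsWithin).exists
    have h1 := hN.le_payoff hC hz h (tierPair_nonneg le_rfl (le_of_lt hε0))
      (Or.inl (by simp)) (hε 0 (by rw [mul_zero]; exact h.load_nonneg _ _))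
    rw [payoff, ← h0, ← hM] at h1
    have h2 := mul_pos hd (Real.rpow_pos_of_pos hε0 g.α)
    simp only [tierPair_macro, tierPair_small, Real.zero_rpow g.α_pos.ne'] at h1
    linarith
  · have hfull : K.load i .macro_cell = c * z i .macro_cell :=
      (hN.full_or_empty hC hz h i _).resolve_right hM.ne'
    have hc : 0 < c := (hC _ _).lt_of_ne fun hc => by
      rw [hfull, hcdef, ← hc, zero_mul] at hM; exact lt_irrefl _ hM
    have hzM : 0 < z i .macro_cell := by
      by_contra! hle
      rw [hfull] at hM
      nlinarith
    obtain ⟨ε, hε, hε1, hε0⟩ := (hfill.and ((eventually_add_mul_lt hzM (1 + d / c)).and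
      self_mem_nhdsWithin)).exists
    have hcd : 0 < d / c * ε := mul_pos (div_pos hd hc) hε0
    have hc' : c * (z i .macro_cell - d / c * ε) = c * z i .macro_cell - d * ε := by
      field_simp
    have hdε := mul_pos hd hε0
    have h1 := hN.le_payoff hC hz h (y := tierPair (z i .macro_cell - d / c * ε) ε)
      (tierPair_nonneg (by linarith) hε0.le) (h.macroFills_of_lt
        (by simp only [tierPair_macro, tierPair_small, ← hddef, ← hcdef, hc', hfull, ← h0]
            linarith)
        (by simp only [tierPair_macro, ← hcdef, hc', hfull]
            linarith)
        (by simp only [tierPair_macro]; linarith) hM) (hε _ (by rw [hc', hfull]; linarith))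
    have h2 := g.transfer_gain (a := 0) (a' := ε) (s := z i .macro_cell)
      (s' := z i .macro_cell - d / c * ε) hd hc.le le_rfl hε0 (by linarith) hzM.le
      (by field_simp; ring)
    rw [payoff, ← h0, hfull, mul_assoc, g.mul_rpow_sub_one hzM.le] at h1
    simp only [tierPair_macro, tierPair_small, Real.zero_rpow g.α_pos.ne'] at h1 h2
    linarith

/-- In equilibrium all services are full. -/
lemma IsNash.full (hN : g.IsNash C z) (hC : ∀ i t, 0 ≤ C i t) (hz : ∀ i t, 0 ≤ z i t)
    (h : g.IsFilling C z K) (i : Fin N) (t : Tier) : K.load i t = C i t * z i t := by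
  rcases (hC i t).eq_or_lt with h0 | h0
  · rw [h.load_eq_zero h0.symm, ← h0, zero_mul]
  · refine (hN.full_or_empty hC hz h i t).resolve_right (ne_of_gt ?_)
    cases t
    · exact hN.load_macro_pos hC hz h h0
    · exact hN.load_small_pos hC hz h h0

lemma IsNash.pos (hN : g.IsNash C z) (hC : ∀ i t, 0 ≤ C i t) (hz : ∀ i t, 0 ≤ z i t)
    (h : g.IsFilling C z K) {i : Fin N} {t : Tier} (h0 : 0 < C i t) : 0 < z i t := by
  refine (hz i t).lt_of_ne fun hz0 => ?_
  have h1 := hN.full hC hz h i t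
  rw [← hz0, mul_zero] at h1
  cases t
  · exact (hN.load_macro_pos hC hz h h0).ne' h1
  · exact (hN.load_small_pos hC hz h h0).ne' h1

end Market

namespace Market

variable {N : ℕ} {g : Market N} {C z : Fin N → Tier → ℝ} {K : Association N} {i : Fin N}

/-! ### Market clearing -/

/-- Market-clearing prices (per unit of capacity) at total capacities `CM` of the macro-cells and
`CS` of the small-cells. Either macro-cells serve exactly the mobile users, at a price that is at
least that of the small-cells, or all services have the same price and there are fixed users in the
macro-cells. The price of macro-cells is arbitrary above `zS` if they have no capacity. -/
structure IsClearing (g : Market N) (CM CS zM zS : ℝ) : Prop where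
  pos : 0 < zS
  le : zS ≤ zM
  clears : (CM = 0 ∨ CM * zM = g.Nm) ∧ (CS + g.wifiCapacity) * zS = g.Nf ∨
    zM = zS ∧ 0 < CM ∧ g.Nm ≤ CM * zM ∧ (CM + CS + g.wifiCapacity) * zS = g.Nm + g.Nf

lemma eventually_transfer {c d a s : ℝ} (hd : 0 < d)
    (has : a < s) : ∀ᶠ δ in 𝓝[>] (0 : ℝ), 0 < δ ∧ a + δ < s - c / d * δ ∧
      d * (s - c / d * δ) = d * s - c * δ := by
  filter_upwards [eventually_add_mul_lt has (1 + c / d), self_mem_nhdsWithin] with δ h1 h2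
  exact ⟨h2, by linarith, by field_simp⟩

/-- If a macro-cell were cheaper than WiFi to the marginal fixed user, its SP would raise its price,
if need be at the same time lowering the price of its small-cells. -/
lemma IsNash.wifi_le_macro (hN : g.IsNash C z) (hC : ∀ i t, 0 ≤ C i t) (hz : ∀ i t, 0 ≤ z i t)
    (h : g.IsFilling C z K) (hc : 0 < C i .macro_cell) :
    K.wifi ≤ g.wifiCapacity * z i .macro_cell := by
  by_contra! hlt
  have hW := g.wifiCapacity_pos
  have hfull := fun j t => hN.full hC hz h j t
  have hsup : ∀ t x, supply C z i t x ≤ ∑ j ∈ Finset.univ.erase i, K.load j t :=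
    fun t x => h.supply_le fun j _ _ => hfull j t
  have htot := h.total i
  have htot' := h.total_small i
  have hfM := h.sum_fixed_macro_nonneg
  have hNm := h.mobile_le
  have hM := hfull i .macro_cell
  have hS := hfull i .small_cell
  rw [hM, hS] at htot
  rw [hS] at htot'
  by_cases hcase : C i .small_cell = 0 ∨ g.wifiCapacity * z i .small_cell < K.wifi
  · have hsmall : ∀ᶠ δ in 𝓝[>] (0 : ℝ),
        g.SmallFills C z i (tierPair (z i .macro_cell + δ) (z i .small_cell)) := by
      rcases hcase with h0 | h0
      · exact Eventually.of_forall fun δ => Or.inl (by rw [h0, zero_mul])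
      · filter_upwards [eventually_add_mul_lt h0 (C i .macro_cell)] with δ hδ
        right
        simp only [tierPair_macro, tierPair_small]
        have h1 := hsup .macro_cell (z i .small_cell)
        have h2 := hsup .small_cell (z i .small_cell)
        constructor <;> linarith
    obtain ⟨δ, h1, h2, h3⟩ := (hsmall.and ((eventually_add_mul_lt hlt
      (C i .macro_cell + g.wifiCapacity)).and self_mem_nhdsWithin)).exists
    have h4 := hsup .macro_cell (z i .macro_cell + δ)
    have h5 := hsup .small_cell (z i .macro_cell + δ)
    have hzM := hz i .macro_cell
    have h6 := hN.le_payoff hC hz h (tierPair_nonneg (by linarith) (hz i _))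
      (Or.inr (Or.inr (by simp only [tierPair_macro, tierPair_small]; linarith))) h1
    rw [payoff_full (hfull i) hz] at h6
    simp only [tierPair_macro, tierPair_small] at h6
    have h7 := mul_lt_mul_of_pos_left
      (Real.rpow_lt_rpow hzM (lt_add_of_pos_right (z i .macro_cell) h3) g.α_pos) hc
    linarith
  · push Not at hcase
    have hd : 0 < C i .small_cell := (hC _ _).lt_of_ne hcase.1.symm
    have hMS : z i .macro_cell < z i .small_cell :=
      lt_of_mul_lt_mul_left (hlt.trans_le hcase.2) hW.le
    have hSpos := hN.load_small_pos hC hz h hd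
    have hw := h.fixed_not_wifi i .small_cell hSpos
    obtain ⟨δ, ⟨hδ, h1, h2⟩, h3⟩ := ((eventually_transfer (c := C i .macro_cell) hd
      hMS).and (eventually_add_mul_lt hlt g.wifiCapacity)).exists
    have h4 := hsup .macro_cell (z i .macro_cell + δ)
    have h5 := hsup .small_cell (z i .macro_cell + δ)
    have hzM := hz i .macro_cell
    have hcd : 0 < C i .macro_cell / C i .small_cell * δ := mul_pos (div_pos hc hd) hδ
    have hcδ := mul_pos hc hδ
    have h6 := hN.le_payoff hC hz h (y := tierPair (z i .macro_cell + δ)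
      (z i .small_cell - C i .macro_cell / C i .small_cell * δ))
      (tierPair_nonneg (by linarith) (by linarith))
      (Or.inr (Or.inr (by simp only [tierPair_macro, tierPair_small, h2]; linarith)))
      (h.smallFills_of_lt (by simp only [tierPair_macro, tierPair_small, h2, hM, hS]; linarith)
        (by simp only [tierPair_small, h2, hS]; linarith)
        (by simp only [tierPair_small]; linarith) hSpos)
    rw [payoff_full (hfull i) hz] at h6
    simp only [tierPair_macro, tierPair_small] at h6
    have h7 := g.transfer_gain (a' := z i .macro_cell + δ) (s := z i .small_cell) hc hd.le hzM
      (by linarith) h1 (hz _ _) (by field_simp; ring)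
    linarith

/-- The price of small-cells makes the marginal fixed user indifferent to WiFi: below it, their SP
would raise the price, moving users there from its macro-cells if need be. -/
lemma IsNash.small_eq_wifi (hN : g.IsNash C z) (hC : ∀ i t, 0 ≤ C i t) (hz : ∀ i t, 0 ≤ z i t)
    (h : g.IsFilling C z K) (hd : 0 < C i .small_cell) :
    g.wifiCapacity * z i .small_cell = K.wifi := by
  have hSpos := hN.load_small_pos hC hz h hd
  refine (h.fixed_not_wifi i .small_cell hSpos).antisymm (le_of_not_gt fun hlt => ?_)
  have hW := g.wifiCapacity_pos
  have hfull := fun j t => hN.full hC hz h j t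
  have hsup : ∀ t x, supply C z i t x ≤ ∑ j ∈ Finset.univ.erase i, K.load j t :=
    fun t x => h.supply_le fun j _ _ => hfull j t
  have htot := h.total i
  have htot' := h.total_small i
  have hfM := h.sum_fixed_macro_nonneg
  have hNm := h.mobile_le
  have hM := hfull i .macro_cell
  have hS := hfull i .small_cell
  rw [hM, hS] at htot
  rw [hS] at htot'
  have hzS := hz i .small_cell
  rcases (hC i .macro_cell).eq_or_lt with hc | hc
  · obtain ⟨δ, h2, h3⟩ := ((eventually_add_mul_lt hlt
      (C i .small_cell + g.wifiCapacity)).and self_mem_nhdsWithin).exists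
    have h4 := hsup .macro_cell (z i .small_cell + δ)
    have h5 := hsup .small_cell (z i .small_cell + δ)
    have h6 := hN.le_payoff hC hz h (y := tierPair (z i .macro_cell) (z i .small_cell + δ))
      (tierPair_nonneg (hz i _) (by linarith)) (Or.inl (by rw [← hc, zero_mul]))
      (Or.inr (by simp only [tierPair_macro, tierPair_small]; constructor <;> linarith))
    rw [payoff_full (hfull i) hz] at h6
    simp only [tierPair_macro, tierPair_small] at h6
    have h7 := mul_lt_mul_of_pos_left
      (Real.rpow_lt_rpow hzS (lt_add_of_pos_right (z i .small_cell) h3) g.α_pos) hd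
    linarith
  · have hSM : z i .small_cell < z i .macro_cell :=
      lt_of_mul_lt_mul_left (hlt.trans_le (hN.wifi_le_macro hC hz h hc)) hW.le
    have hMpos := hN.load_macro_pos hC hz h hc
    obtain ⟨δ, ⟨hδ, h1, h2⟩, h3⟩ := ((eventually_transfer (c := C i .small_cell) hc
      hSM).and (eventually_add_mul_lt hlt (C i .small_cell + g.wifiCapacity))).exists
    have h4 := hsup .macro_cell (z i .small_cell + δ)
    have h5 := hsup .small_cell (z i .small_cell + δ)
    have hcd : 0 < C i .small_cell / C i .macro_cell * δ := mul_pos (div_pos hd hc) hδ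
    have hdδ := mul_pos hd hδ
    have h6 := hN.le_payoff hC hz h (y := tierPair
      (z i .macro_cell - C i .small_cell / C i .macro_cell * δ) (z i .small_cell + δ))
      (tierPair_nonneg (by linarith) (by linarith))
      (h.macroFills_of_lt (by simp only [tierPair_macro, tierPair_small, h2, hM, hS]; linarith)
        (by simp only [tierPair_macro, h2, hM]; linarith)
        (by simp only [tierPair_macro]; linarith) hMpos)
      (Or.inr (by simp only [tierPair_macro, tierPair_small, h2]; constructor <;> linarith))
    rw [payoff_full (hfull i) hz] at h6
    simp only [tierPair_macro, tierPair_small] at h6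
    have h7 := g.transfer_gain (a' := z i .small_cell + δ) (s := z i .macro_cell) hd hc.le hzS
      (by linarith) h1 (hz _ _) (by field_simp; ring)
    linarith

/-- In equilibrium, small increases of a macro price do not leave both services of the SP full. -/
lemma IsNash.not_eventually_macroFills (hN : g.IsNash C z) (hC : ∀ i t, 0 ≤ C i t)
    (hz : ∀ i t, 0 ≤ z i t) (h : g.IsFilling C z K) (hc : 0 < C i .macro_cell)
    (hM : ∀ᶠ δ in 𝓝[>] (0 : ℝ),
      g.MacroFills C z i (tierPair (z i .macro_cell + δ) (z i .small_cell)))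
    (hS : ∀ᶠ δ in 𝓝[>] (0 : ℝ),
      g.SmallFills C z i (tierPair (z i .macro_cell + δ) (z i .small_cell))) : False := by
  obtain ⟨δ, h1, h2, h3⟩ := (hM.and (hS.and self_mem_nhdsWithin)).exists
  have h3' : 0 < δ := h3
  have h6 := hN.le_payoff hC hz h
    (tierPair_nonneg (add_nonneg (hz i .macro_cell) h3'.le) (hz i _)) h1 h2
  rw [payoff_full (fun t => hN.full hC hz h i t) hz] at h6
  simp only [tierPair_macro, tierPair_small] at h6
  have h7 := mul_lt_mul_of_pos_left
    (Real.rpow_lt_rpow (hz i .macro_cell) (lt_add_of_pos_right (z i .macro_cell) h3) g.α_pos) hc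
  linarith

/-- If there are macro-cells, all mobile users are served. -/
lemma IsNash.sum_mobile (hN : g.IsNash C z) (hC : ∀ i t, 0 ≤ C i t) (hz : ∀ i t, 0 ≤ z i t)
    (h : g.IsFilling C z K) (hc : 0 < C i .macro_cell) : ∑ j, K.mobile j = g.Nm := by
  refine h.mobile_le.antisymm (le_of_not_gt fun hlt => ?_)
  have hfull := fun j t => hN.full hC hz h j t
  have hmob := h.mobile_unserved hlt
  have htot := h.total i
  have htot' := h.total_small i
  have hfM := h.sum_fixed_macro_nonneg
  have hM := hfull i .macro_cell
  have hS := hfull i .small_cell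
  rw [hM, hS] at htot
  rw [hS] at htot'
  -- Otherwise the unserved mobile users allow a small increase of the macro price.
  refine hN.not_eventually_macroFills hC hz h hc ?_ ?_
  · filter_upwards [eventually_add_mul_lt hlt (C i .macro_cell)] with δ hδ
    right; left
    have h1 := h.supply_le_mobile (i := i) (x := z i .macro_cell + δ) fun j _ _ => hmob j
    have h2 := sum_eq_add_erase i K.mobile
    have h3 := hmob i
    simp only [tierPair_macro]
    linarith
  · rcases (hC i .small_cell).eq_or_lt with hd | hd
    · exact Eventually.of_forall fun δ => Or.inl (by rw [← hd, zero_mul])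
    filter_upwards [eventually_add_mul_lt hlt (C i .macro_cell)] with δ hδ
    right
    have h1 : ∀ t, supply C z i t (z i .small_cell) ≤ ∑ j ∈ Finset.univ.erase i, K.load j t :=
      fun t => h.supply_le fun j _ _ => hfull j t
    have h2 := h1 .macro_cell
    have h3 := h1 .small_cell
    have h4 := hN.small_eq_wifi hC hz h hd
    simp only [tierPair_macro, tierPair_small]
    constructor <;> linarith

/-- All macro-cells have the same price: a cheaper one could be raised in price. -/
lemma IsNash.macro_le_macro (hN : g.IsNash C z) (hC : ∀ i t, 0 ≤ C i t)
    (hz : ∀ i t, 0 ≤ z i t) (h : g.IsFilling C z K) {j : Fin N} (hc : 0 < C i .macro_cell)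
    (hcj : 0 < C j .macro_cell) : z j .macro_cell ≤ z i .macro_cell := by
  by_contra! hlt
  have hW := g.wifiCapacity_pos
  have hfull := fun j t => hN.full hC hz h j t
  have hij : j ≠ i := by rintro rfl; exact lt_irrefl _ hlt
  have hwj : K.wifi < g.wifiCapacity * z j .macro_cell :=
    (hN.wifi_le_macro hC hz h hc).trans_lt (mul_lt_mul_of_pos_left hlt hW)
  have hfj : K.fixed j .macro_cell = 0 := le_antisymm (le_of_not_gt fun hf =>
    absurd (h.fixed_not_wifi j _ hf) (not_le.2 hwj)) (h.fixed_nonneg _ _)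
  have hjpos := hN.load_macro_pos hC hz h hcj
  have hmj : K.mobile j = K.load j .macro_cell := by simp [Association.load, hfj]
  have hmob : ∀ k, z k .macro_cell < z j .macro_cell →
      K.mobile k = C k .macro_cell * z k .macro_cell := fun k hk =>
    h.mobile_choice j k (hmj ▸ hjpos) hk
  have htot := h.total i
  have htot' := h.total_small i
  have hfM := h.sum_fixed_macro_nonneg
  have hNm := h.mobile_le
  have hM := hfull i .macro_cell
  have hS := hfull i .small_cell
  rw [hM, hS] at htot
  rw [hS] at htot'
  have hjmem : j ∈ Finset.univ.erase i := Finset.mem_erase.2 ⟨hij, Finset.mem_univ _⟩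
  -- After a small increase, macro service `i` is still cheaper than macro service `j`, and so is its
  -- small-cell; the users that `j` has now are enough to keep both full.
  refine hN.not_eventually_macroFills hC hz h hc ?_ ?_
  · filter_upwards [eventually_add_mul_lt hjpos (C i .macro_cell),
      eventually_add_mul_lt hlt 1] with δ hδ hδ'
    right; left
    have h1 : supply C z i .macro_cell (z i .macro_cell + δ) + K.mobile j ≤
        ∑ k ∈ Finset.univ.erase i, K.mobile k := by
      rw [supply, ← Finset.add_sum_erase _ _ hjmem, ← Finset.add_sum_erase _ K.mobile hjmem,
        if_neg (by linarith), zero_add, add_comm]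
      refine add_le_add le_rfl (Finset.sum_le_sum fun k _ => ?_)
      split_ifs with hk
      · exact (hmob k (by linarith)).ge
      · exact h.mobile_nonneg k
    have h2 := sum_eq_add_erase i K.mobile
    have h3 := hmob i hlt
    simp only [tierPair_macro]
    linarith
  · rcases (hC i .small_cell).eq_or_lt with hd | hd
    · exact Eventually.of_forall fun δ => Or.inl (by rw [← hd, zero_mul])
    have h4 := hN.small_eq_wifi hC hz h hd
    filter_upwards [eventually_add_mul_lt hjpos (C i .macro_cell)] with δ hδ
    right
    have h1 : supply C z i .macro_cell (z i .small_cell) + K.load j .macro_cell ≤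
        ∑ k ∈ Finset.univ.erase i, K.load k .macro_cell := by
      rw [supply, ← Finset.add_sum_erase _ _ hjmem,
        ← Finset.add_sum_erase _ (fun k => K.load k .macro_cell) hjmem, if_neg (by
          rw [not_le]; exact lt_of_mul_lt_mul_left (h4.trans_lt hwj) hW.le), zero_add, add_comm]
      refine add_le_add le_rfl (Finset.sum_le_sum fun k _ => ?_)
      split_ifs with hk
      · exact (hfull k _).ge
      · exact h.load_nonneg k _
    have h3 : supply C z i .small_cell (z i .small_cell) ≤
        ∑ j ∈ Finset.univ.erase i, K.load j .small_cell := h.supply_le fun j _ _ => hfull j _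
    simp only [tierPair_macro, tierPair_small]
    constructor <;> linarith

/-- Every price equilibrium is market-clearing. -/
theorem IsNash.exists_isClearing (hN : g.IsNash C z) (hC : ∀ i t, 0 ≤ C i t)
    (hz : ∀ i t, 0 ≤ z i t) : ∃ zM zS,
      g.IsClearing (∑ i, C i .macro_cell) (∑ i, C i .small_cell) zM zS ∧
      ∀ i t, 0 < C i t → z i t = tierPair zM zS t := by
  obtain ⟨K, h⟩ := g.exists_isFilling hC hz
  have hW := g.wifiCapacity_pos
  have hfull := fun j t => hN.full hC hz h j t
  set zS := K.wifi / g.wifiCapacity with hzS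
  have hWz : g.wifiCapacity * zS = K.wifi := by rw [hzS]; field_simp
  have hzS0 : 0 < zS := div_pos h.wifi_pos hW
  have hsmall : ∀ i, 0 < C i .small_cell → z i .small_cell = zS := fun i hi => by
    have := hN.small_eq_wifi hC hz h hi
    exact mul_left_cancel₀ hW.ne' (this.trans hWz.symm)
  have hmul : ∀ t x, (∀ i, 0 < C i t → z i t = x) → ∑ i, K.load i t = (∑ i, C i t) * x :=
    fun t x hx => by
      rw [Finset.sum_mul]
      refine Finset.sum_congr rfl fun i _ => ?_
      rw [hfull]
      rcases (hC i t).eq_or_lt with h0 | h0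
      · rw [← h0, zero_mul, zero_mul]
      · rw [hx i h0]
  have hS := hmul .small_cell zS hsmall
  have hft := h.fixed_total
  have hlM : ∑ i, K.load i .macro_cell = ∑ i, K.mobile i + ∑ i, K.fixed i .macro_cell := by
    simp only [Association.load, Finset.sum_add_distrib]
  have hlS : ∑ i, K.load i .small_cell = ∑ i, K.fixed i .small_cell := rfl
  rw [Finset.sum_add_distrib] at hft
  by_cases hex : ∃ i, 0 < C i .macro_cell
  · obtain ⟨i, hi⟩ := hex
    have hmac : ∀ j, 0 < C j .macro_cell → z j .macro_cell = z i .macro_cell := fun j hj =>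
      le_antisymm (hN.macro_le_macro hC hz h hi hj) (hN.macro_le_macro hC hz h hj hi)
    have hM := hmul .macro_cell _ hmac
    have hNm := hN.sum_mobile hC hz h hi
    have hwle := hN.wifi_le_macro hC hz h hi
    have hCM : 0 < ∑ j, C j .macro_cell :=
      Finset.sum_pos' (fun j _ => hC j _) ⟨i, Finset.mem_univ _, hi⟩
    refine ⟨z i .macro_cell, zS, ⟨hzS0, le_of_mul_le_mul_left (hWz.trans_le hwle) hW, ?_⟩, ?_⟩
    · rcases hwle.eq_or_lt with heq | hlt
      · right
        have hzz : z i .macro_cell = zS := mul_left_cancel₀ hW.ne' (heq.symm.trans hWz.symm)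
        have hf := h.sum_fixed_macro_nonneg
        refine ⟨hzz, hCM, by linarith, ?_⟩
        rw [hzz] at hM
        linarith
      · left
        have hf : ∑ j, K.fixed j .macro_cell = 0 := Finset.sum_eq_zero fun j _ => by
          refine le_antisymm (le_of_not_gt fun hf => ?_) (h.fixed_nonneg _ _)
          have h1 := h.fixed_not_wifi j _ hf
          rcases (hC j .macro_cell).eq_or_lt with h0 | h0
          · have h2 := Association.fixed_le_load (h.mobile_nonneg j) .macro_cell (K := K)
            rw [h.load_eq_zero h0.symm] at h2
            linarith
          · rw [hmac j h0] at h1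
            linarith
        exact ⟨Or.inr (by linarith), by linarith⟩
    · rintro j (_ | _) hj
      exacts [hmac j hj, hsmall j hj]
  · push Not at hex
    have hC0 : ∀ i, C i .macro_cell = 0 := fun i => le_antisymm (hex i) (hC i _)
    refine ⟨zS, zS, ⟨hzS0, le_rfl, Or.inl ⟨Or.inl (Finset.sum_eq_zero fun i _ => hC0 i), ?_⟩⟩, ?_⟩
    · have hM : ∑ i, K.load i .macro_cell = 0 :=
        Finset.sum_eq_zero fun i _ => h.load_eq_zero (hC0 i)
      have hf := h.sum_fixed_macro_nonneg
      have hm : 0 ≤ ∑ i, K.mobile i := Finset.sum_nonneg fun i _ => h.mobile_nonneg i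
      linarith
    · rintro j (_ | _) hj
      exacts [absurd hj (not_lt.2 (hex j)), hsmall j hj]

end Market

namespace Market

variable {N : ℕ} {g : Market N} {C z : Fin N → Tier → ℝ} {K : Association N} {i : Fin N}
  {CM CS zM zS : ℝ}

lemma exists_isClearing (g : Market N) (hM : 0 ≤ CM) (hS : 0 ≤ CS) :
    ∃ zM zS, g.IsClearing CM CS zM zS := by
  have hNm := g.Nm_pos
  have hNf := g.Nf_pos
  have hT : 0 < CS + g.wifiCapacity := add_pos_of_nonneg_of_pos hS g.wifiCapacity_pos
  rcases hM.eq_or_lt with h0 | h0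
  · exact ⟨g.Nf / (CS + g.wifiCapacity), g.Nf / (CS + g.wifiCapacity), div_pos hNf hT, le_rfl,
      Or.inl ⟨Or.inl h0.symm, mul_div_cancel₀ _ hT.ne'⟩⟩
  rcases le_or_gt (g.Nf * CM) (g.Nm * (CS + g.wifiCapacity)) with h | h
  · exact ⟨g.Nm / CM, g.Nf / (CS + g.wifiCapacity), div_pos hNf hT,
      by rwa [div_le_div_iff₀ hT h0], Or.inl ⟨Or.inr (mul_div_cancel₀ _ h0.ne'),
        mul_div_cancel₀ _ hT.ne'⟩⟩
  · have hpos : 0 < CM + CS + g.wifiCapacity := by linarith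
    refine ⟨(g.Nm + g.Nf) / (CM + CS + g.wifiCapacity), (g.Nm + g.Nf) / (CM + CS + g.wifiCapacity),
      div_pos (by linarith) hpos, le_rfl, Or.inr ⟨rfl, h0, ?_, mul_div_cancel₀ _ hpos.ne'⟩⟩
    rw [← mul_div_assoc, le_div_iff₀ hpos]
    linarith

namespace IsClearing

lemma total_le (h : g.IsClearing CM CS zM zS) :
    CM * zM + (CS + g.wifiCapacity) * zS ≤ g.Nm + g.Nf := by
  rcases h.clears with ⟨h0 | h1, h2⟩ | ⟨h1, -, -, h2⟩
  · have := g.Nm_pos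
    rw [h0, zero_mul]; linarith
  · linarith
  · rw [h1]; linarith

lemma separate (h : g.IsClearing CM CS zM zS)
    (hle : g.Nf * CM ≤ g.Nm * (CS + g.wifiCapacity)) :
    (CM = 0 ∨ CM * zM = g.Nm) ∧ (CS + g.wifiCapacity) * zS = g.Nf := by
  rcases h.clears with h' | ⟨h1, -, h3, h4⟩
  · exact h'
  · subst h1
    have h5 := mul_le_mul_of_nonneg_right hle h.pos.le
    have h6 := mul_le_mul_of_nonneg_left h3 g.Nf_pos.le
    have h7 : (CS + g.wifiCapacity) * zM = g.Nf := by
      refine le_antisymm (by linarith) (le_of_mul_le_mul_left ?_ g.Nm_pos)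
      linarith
    exact ⟨Or.inr (by linarith), h7⟩

lemma mixed (h : g.IsClearing CM CS zM zS) (hT : 0 ≤ CS + g.wifiCapacity) (hM : 0 ≤ CM)
    (hlt : g.Nm * (CS + g.wifiCapacity) < g.Nf * CM) :
    zM = zS ∧ (CM + CS + g.wifiCapacity) * zS = g.Nm + g.Nf := by
  rcases h.clears with ⟨h0 | h1, h2⟩ | ⟨h1, -, -, h2⟩
  · rw [h0, mul_zero] at hlt
    exact absurd hlt (not_lt.2 (mul_nonneg g.Nm_pos.le hT))
  · rw [← h1, ← h2] at hlt
    have := mul_le_mul_of_nonneg_left h.le (mul_nonneg hT hM)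
    linarith
  · exact ⟨h1, h2⟩

lemma unique {zM' zS' : ℝ} (hM : 0 ≤ CM) (hS : 0 ≤ CS) (h : g.IsClearing CM CS zM zS)
    (h' : g.IsClearing CM CS zM' zS') : zS = zS' ∧ (0 < CM → zM = zM') := by
  have hT : 0 < CS + g.wifiCapacity := add_pos_of_nonneg_of_pos hS g.wifiCapacity_pos
  rcases le_or_gt (g.Nf * CM) (g.Nm * (CS + g.wifiCapacity)) with hle | hlt
  · obtain ⟨h1, h2⟩ := h.separate hle
    obtain ⟨h3, h4⟩ := h'.separate hle
    exact ⟨mul_left_cancel₀ hT.ne' (h2.trans h4.symm), fun h0 => mul_left_cancel₀ h0.ne'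
      ((h1.resolve_left h0.ne').trans (h3.resolve_left h0.ne').symm)⟩
  · obtain ⟨h1, h2⟩ := h.mixed hT.le hM hlt
    obtain ⟨h3, h4⟩ := h'.mixed hT.le hM hlt
    have h5 : zS = zS' := mul_left_cancel₀ (by linarith : CM + CS + g.wifiCapacity ≠ 0)
      (h2.trans h4.symm)
    exact ⟨h5, fun _ => by rw [h1, h3, h5]⟩

end IsClearing

/-- The price of a service without capacity is immaterial. -/
lemma IsFilling.congr {z' : Fin N → Tier → ℝ} (h : g.IsFilling C z K)
    (hz : ∀ i t, C i t ≠ 0 → z i t = z' i t) : g.IsFilling C z' K := by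
  have hCz : ∀ i t, C i t * z' i t = C i t * z i t := fun i t => by
    by_cases h0 : C i t = 0
    · rw [h0, zero_mul, zero_mul]
    · rw [hz i t h0]
  have hm0 : ∀ i, C i .macro_cell = 0 → K.mobile i = 0 := fun i h0 =>
    le_antisymm ((h.mobile_le_load i).trans (h.load_eq_zero h0).le) (h.mobile_nonneg i)
  have hf0 : ∀ i t, C i t = 0 → K.fixed i t = 0 := fun i t h0 =>
    le_antisymm ((Association.fixed_le_load (h.mobile_nonneg i) t).trans (h.load_eq_zero h0).le)
      (h.fixed_nonneg i t)
  have hm : ∀ i, 0 < K.mobile i → C i .macro_cell ≠ 0 := fun i hi h0 => hi.ne' (hm0 i h0)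
  have hf : ∀ i t, 0 < K.fixed i t → C i t ≠ 0 := fun i t hi h0 => hi.ne' (hf0 i t h0)
  refine ⟨h.mobile_nonneg, h.fixed_nonneg, h.wifi_pos, fun i t => hCz i t ▸ h.load_le i t,
    h.mobile_le, fun hlt i => hCz i _ ▸ h.mobile_unserved hlt i, fun i j hi hij => ?_,
    fun i j hij => ?_, h.fixed_total, fun i t j s hi hij => ?_, fun i t hi => ?_, fun i t hi => ?_,
    fun i t j s hij hlt => ?_⟩
  · by_cases hj : C j .macro_cell = 0
    · rw [hj, zero_mul, hm0 j hj]
    · rw [← hz i _ (hm i hi), ← hz j _ hj] at hij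
      rw [hCz]
      exact h.mobile_choice i j hi hij
  · by_cases hi : C i .macro_cell = 0
    · rw [hi, mul_zero, hm0 i hi, zero_mul]
    by_cases hj : C j .macro_cell = 0
    · rw [hj, mul_zero, hm0 j hj, zero_mul]
    rw [← hz i _ hi, ← hz j _ hj] at hij
    exact h.mobile_tie i j hij
  · by_cases hj : C j s = 0
    · rw [hj, zero_mul, h.load_eq_zero hj]
    · rw [← hz i _ (hf i t hi), ← hz j _ hj] at hij
      rw [hCz]
      exact h.fixed_choice i t j s hi hij
  · rw [← hz i t (hf i t hi)]
    exact h.fixed_not_wifi i t hi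
  · by_cases h0 : C i t = 0
    · rw [h0, zero_mul, h.load_eq_zero h0]
    · rw [← hz i t h0] at hi
      rw [hCz]
      exact h.wifi_choice i t hi
  · by_cases hi : C i t = 0
    · rw [hi, zero_mul, h.load_eq_zero hi]
    by_cases hj : C j s = 0
    · rw [hj, mul_zero, hf0 j s hj, zero_mul] at hlt
      exact absurd hlt (lt_irrefl _)
    rw [← hz i t hi, ← hz j s hj] at hij
    rw [hCz]
    exact h.fixed_tie i t j s hij hlt

/-! ### Market-clearing prices are in equilibrium -/

lemma IsClearing.nonneg (h : g.IsClearing CM CS zM zS) (t : Tier) : 0 ≤ tierPair zM zS t :=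
  tierPair_nonneg (h.pos.le.trans h.le) h.pos.le t

lemma supply_le_sum (hC : ∀ i t, 0 ≤ C i t) (h : ∀ t, 0 ≤ tierPair zM zS t) (i : Fin N) (t : Tier)
    (x : ℝ) : supply C (fun _ => tierPair zM zS) i t x ≤
      (∑ j ∈ Finset.univ.erase i, C j t) * tierPair zM zS t := by
  rw [Finset.sum_mul]
  refine Finset.sum_le_sum fun j _ => ?_
  split_ifs
  · exact le_rfl
  · exact mul_nonneg (hC _ _) (h _)

lemma IsFilling.full_of_isClearing (hC : ∀ i t, 0 ≤ C i t)
    (hcl : g.IsClearing (∑ i, C i .macro_cell) (∑ i, C i .small_cell) zM zS)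
    (h : g.IsFilling C (fun _ => tierPair zM zS) K) (i : Fin N) (t : Tier) :
    K.load i t = C i t * tierPair zM zS t := by
  have h' : g.IsFilling C (Function.update (fun _ => tierPair zM zS) i (tierPair zM zS)) K := by
    rwa [Function.update_eq_self_iff.2 rfl]
  have hM := sum_eq_add_erase i fun i => C i .macro_cell
  have hS := sum_eq_add_erase i fun i => C i .small_cell
  have hs := fun t x => supply_le_sum hC hcl.nonneg i t x
  have hW := g.wifiCapacity_pos
  have htot := hcl.total_le
  have hz0 := hcl.pos
  have hzz := hcl.le
  rw [hM, hS] at htot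
  cases t
  · refine h'.load_macro_eq ?_
    by_cases hc : C i .macro_cell = 0
    · exact Or.inl (by rw [hc, zero_mul])
    have hCM : ∑ i, C i .macro_cell ≠ 0 := fun h0 =>
      hc ((Finset.sum_eq_zero_iff_of_nonneg fun j _ => hC j _).1 h0 i (Finset.mem_univ i))
    right
    have h1 := hs .macro_cell zM
    have h2 := hs .small_cell zM
    simp only [tierPair_macro, tierPair_small] at h1 h2 ⊢
    rcases hcl.clears with ⟨h3, -⟩ | ⟨h3, -, -, h4⟩
    · left
      have := h3.resolve_left hCM
      rw [hM] at this
      linarith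
    · right
      rw [h3] at h1 h2 htot ⊢
      linarith
  · refine h'.load_small_eq (Or.inr ?_)
    have h1 := hs .macro_cell zS
    have h2 := hs .small_cell zS
    simp only [tierPair_macro, tierPair_small] at h1 h2 ⊢
    refine ⟨?_, by linarith⟩
    rcases hcl.clears with ⟨-, h3⟩ | ⟨h3, -, h4, h5⟩
    · rw [hS] at h3; linarith
    · rw [h3] at h4
      rw [hS] at h5
      linarith

/-- Strictly cheaper small-cells keep the fixed users out of the macro-cells. -/
lemma IsFilling.fixed_macro_eq_zero (hC : ∀ i t, 0 ≤ C i t)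
    (hcl : g.IsClearing (∑ i, C i .macro_cell) (∑ i, C i .small_cell) zM zS)
    (h : g.IsFilling C (fun _ => tierPair zM zS) K) (hlt : zS < zM) (i : Fin N) :
    K.fixed i .macro_cell = 0 := by
  refine le_antisymm (le_of_not_gt fun hf => ?_) (h.fixed_nonneg _ _)
  have h1 := h.fixed_not_wifi i _ hf
  have h2 : (∑ i, C i .small_cell + g.wifiCapacity) * zS = g.Nf := by
    rcases hcl.clears with ⟨-, h3⟩ | ⟨h3, -⟩
    · exact h3
    · exact absurd h3 hlt.ne'
  have h3 : ∑ i, K.load i .small_cell = (∑ i, C i .small_cell) * zS := by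
    rw [Finset.sum_mul]
    exact Finset.sum_congr rfl fun j _ => h.full_of_isClearing hC hcl j _
  have h4 := h.total_small i
  have h5 := sum_eq_add_erase i fun i => K.load i .small_cell
  have h6 := h.sum_fixed_macro_nonneg
  have h7 := mul_lt_mul_of_pos_left hlt g.wifiCapacity_pos
  simp only [tierPair_macro] at h1
  linarith

/-- The revenue of a service as a function of its load, at any price at which the load can be
served, lies below its tangent at full load. -/
lemma load_mul_rpow_le (g : Market N) {C L y z : ℝ} (hC : 0 ≤ C) (hL : 0 ≤ L) (hz : 0 < z)
    (h : L ≤ C * y) :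
    L * y ^ (g.α - 1) ≤ C * z ^ g.α + g.α * z ^ (g.α - 1) * (L - C * z) := by
  have hzα := g.mul_rpow_sub_one hz.le
  rcases hL.eq_or_lt with h0 | h0
  · rw [← h0, zero_mul, ← hzα]
    have h1 := mul_nonneg (mul_nonneg hC hz.le) (Real.rpow_nonneg hz.le (g.α - 1))
    nlinarith [g.one_sub_α_pos]
  · have hC0 : 0 < C := hC.lt_of_ne fun h1 => by rw [← h1, zero_mul] at h; linarith
    have hk : 0 < L / C := div_pos h0 hC0
    have hky : L / C ≤ y := by rwa [div_le_iff₀ hC0, mul_comm]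
    have h1 : y ^ (g.α - 1) ≤ (L / C) ^ (g.α - 1) := by
      rcases hky.eq_or_lt with h2 | h2
      · rw [h2]
      · exact (g.rpow_sub_one_lt hk h2).le
    have hCk : C * (L / C) = L := mul_div_cancel₀ _ hC0.ne'
    calc L * y ^ (g.α - 1) ≤ L * (L / C) ^ (g.α - 1) := mul_le_mul_of_nonneg_left h1 hL
      _ = C * (L / C) ^ g.α := by rw [← g.mul_rpow_sub_one hk.le, ← mul_assoc, hCk]
      _ ≤ C * (z ^ g.α + g.α * z ^ (g.α - 1) * (L / C - z)) :=
        mul_le_mul_of_nonneg_left (g.rpow_le_tangent hk.le hz) hC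
      _ = C * z ^ g.α + g.α * z ^ (g.α - 1) * (C * (L / C) - C * z) := by ring
      _ = _ := by rw [hCk]

section Deviation

variable {y : Tier → ℝ}

/-- If fixed users use a service of SP `i` that is more expensive than all services of the others,
then these are full, and there are as many users as there is room at the others' prices. -/
lemma IsFilling.total_lt_of_fixed
    (h : g.IsFilling C (Function.update (fun _ => tierPair zM zS) i y) K) (hle : zS ≤ zM)
    {t : Tier} (ht : 0 < K.fixed i t) (hy : zM < y t) :
    (∑ j ∈ Finset.univ.erase i, C j .macro_cell) * zM +
      (∑ j ∈ Finset.univ.erase i, C j .small_cell) * zS + K.load i .macro_cell +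
      K.load i .small_cell + g.wifiCapacity * zS < g.Nm + g.Nf := by
  have hs : ∀ s, tierPair zM zS s < y t := by
    rintro (_ | _)
    exacts [hy, hle.trans_lt hy]
  have hr : ∀ s, ∑ j ∈ Finset.univ.erase i, K.load j s =
      (∑ j ∈ Finset.univ.erase i, C j s) * tierPair zM zS s := fun s => by
    rw [Finset.sum_mul]
    refine Finset.sum_congr rfl fun j hj => ?_
    have hji := Finset.ne_of_mem_erase hj
    have := h.fixed_choice i t j s ht (by
      rw [Function.update_self, Function.update_of_ne hji]; exact hs s)
    rwa [Function.update_of_ne hji] at this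
  have h1 := h.fixed_not_wifi i t ht
  rw [Function.update_self] at h1
  have h2 := mul_lt_mul_of_pos_left (hle.trans_lt hy) g.wifiCapacity_pos
  have h3 := h.total i
  have h4 := h.mobile_le
  rw [hr, hr] at h3
  simp only [tierPair_macro, tierPair_small] at h3
  linarith

lemma lt_of_lt_load (h : g.IsFilling C (Function.update z i y) K) (hC : ∀ i t, 0 ≤ C i t) {t : Tier}
    {x : ℝ} (hlt : C i t * x < K.load i t) : x < y t := by
  have h1 := h.load_le i t
  rw [Function.update_self] at h1
  exact lt_of_mul_lt_mul_left (hlt.trans_le h1) (hC i t)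

/-- While fixed users use small-cells and WiFi only, the load of small-cells cannot be raised above
its market-clearing level. -/
lemma IsClearing.load_small_le (hC : ∀ i t, 0 ≤ C i t)
    (hS : (∑ i, C i .small_cell + g.wifiCapacity) * zS = g.Nf)
    (h : g.IsFilling C (Function.update (fun _ => tierPair zM zS) i y) K) :
    K.load i .small_cell ≤ C i .small_cell * zS := by
  by_contra! hlt
  have hy := lt_of_lt_load h hC hlt
  have hz : 0 ≤ zS := by
    have h1 : 0 < ∑ i, C i .small_cell + g.wifiCapacity :=
      add_pos_of_nonneg_of_pos (Finset.sum_nonneg fun j _ => hC j _) g.wifiCapacity_pos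
    exact (pos_of_mul_pos_right (hS ▸ g.Nf_pos) h1.le).le
  have ht : 0 < K.fixed i .small_cell := (mul_nonneg (hC _ _) hz).trans_lt hlt
  have hr : ∑ j ∈ Finset.univ.erase i, K.load j .small_cell =
      (∑ j ∈ Finset.univ.erase i, C j .small_cell) * zS := by
    rw [Finset.sum_mul]
    refine Finset.sum_congr rfl fun j hj => ?_
    have hji := Finset.ne_of_mem_erase hj
    have := h.fixed_choice i .small_cell j .small_cell ht (by
      rw [Function.update_self, Function.update_of_ne hji]; exact hy)
    rwa [Function.update_of_ne hji] at this
  have h1 := h.fixed_not_wifi i .small_cell ht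
  rw [Function.update_self] at h1
  have h2 := mul_lt_mul_of_pos_left hy g.wifiCapacity_pos
  have h3 := h.total_small i
  have h4 := h.sum_fixed_macro_nonneg
  have h5 := sum_eq_add_erase i fun i => C i .small_cell
  rw [hr] at h3
  rw [h5] at hS
  linarith

/-- A deviating SP cannot raise its total load. -/
lemma IsClearing.load_add_load_le (hC : ∀ i t, 0 ≤ C i t)
    (hcl : g.IsClearing (∑ i, C i .macro_cell) (∑ i, C i .small_cell) zM zS)
    (h : g.IsFilling C (Function.update (fun _ => tierPair zM zS) i y) K) :
    K.load i .macro_cell + K.load i .small_cell ≤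
      C i .macro_cell * zM + C i .small_cell * zS := by
  by_contra! hlt
  have hM := sum_eq_add_erase i fun i => C i .macro_cell
  have hS := sum_eq_add_erase i fun i => C i .small_cell
  have hcM := hC i .macro_cell
  by_cases hlS : C i .small_cell * zS < K.load i .small_cell
  · rcases hcl.clears with ⟨-, hsep⟩ | ⟨hzz, -, -, hmix⟩
    · exact absurd (IsClearing.load_small_le hC hsep h) (not_le.2 hlS)
    · have ht : 0 < K.fixed i .small_cell := (mul_nonneg (hC _ _) hcl.pos.le).trans_lt hlS
      have h1 := h.total_lt_of_fixed hcl.le ht (hzz ▸ lt_of_lt_load h hC hlS)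
      rw [hM, hS] at hmix
      rw [hzz] at h1 hlt
      linarith
  · have hlM : C i .macro_cell * zM < K.load i .macro_cell := by linarith
    have hzM : 0 ≤ zM := hcl.pos.le.trans hcl.le
    have hc : 0 < C i .macro_cell := hcM.lt_of_ne fun h0 => by
      rw [h.load_eq_zero h0.symm, ← h0, zero_mul] at hlM
      exact lt_irrefl _ hlM
    have hCM : 0 < ∑ i, C i .macro_cell :=
      Finset.sum_pos' (fun j _ => hC j _) ⟨i, Finset.mem_univ _, hc⟩
    have hy := lt_of_lt_load h hC hlM
    have hNm : g.Nm ≤ (∑ i, C i .macro_cell) * zM := by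
      rcases hcl.clears with ⟨hsep, -⟩ | ⟨-, -, h1, -⟩
      · exact (hsep.resolve_left hCM.ne').ge
      · exact h1
    have htot : g.Nm + g.Nf ≤ (∑ i, C i .macro_cell) * zM +
        (∑ i, C i .small_cell + g.wifiCapacity) * zS := by
      rcases hcl.clears with ⟨hsep, h1⟩ | ⟨hzz, -, -, h1⟩
      · have := hsep.resolve_left hCM.ne'
        linarith
      · rw [hzz]; linarith
    rw [hM] at hNm htot
    rw [hS] at htot
    rcases (h.fixed_nonneg i .macro_cell).eq_or_lt with hf | hf
    · have hm : K.mobile i = K.load i .macro_cell := by simp [Association.load, ← hf]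
      have hm0 : 0 < K.mobile i := by rw [hm]; exact (mul_nonneg hcM hzM).trans_lt hlM
      have hr : ∑ j ∈ Finset.univ.erase i, K.mobile j =
          (∑ j ∈ Finset.univ.erase i, C j .macro_cell) * zM := by
        rw [Finset.sum_mul]
        refine Finset.sum_congr rfl fun j hj => ?_
        have hji := Finset.ne_of_mem_erase hj
        have := h.mobile_choice i j hm0 (by
          rw [Function.update_self, Function.update_of_ne hji]; exact hy)
        rwa [Function.update_of_ne hji] at this
      have h1 := sum_eq_add_erase i K.mobile
      have h2 := h.mobile_le
      linarith
    · have h1 := h.total_lt_of_fixed hcl.le hf hy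
      linarith

end Deviation

/-- Market-clearing prices are in equilibrium: a deviating SP cannot raise its total load, nor that
of its small-cells if these have the higher marginal revenue, and its revenue is concave in its
loads. -/
theorem IsClearing.isNash (hC : ∀ i t, 0 ≤ C i t)
    (hcl : g.IsClearing (∑ i, C i .macro_cell) (∑ i, C i .small_cell) zM zS) :
    g.IsNash C (fun _ => tierPair zM zS) := by
  intro K i y K' h _ h'
  have hzM : 0 < zM := hcl.pos.trans_le hcl.le
  rw [payoff_full (z := fun _ => tierPair zM zS) (fun t => h.full_of_isClearing hC hcl i t)
    fun _ => hcl.nonneg, payoff]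
  have hl : ∀ t, K'.load i t ≤ C i t * y t := fun t => by
    have := h'.load_le i t
    rwa [Function.update_self] at this
  have h1 := g.load_mul_rpow_le (hC i _) (h'.load_nonneg i _) hzM (hl .macro_cell)
  have h2 := g.load_mul_rpow_le (hC i _) (h'.load_nonneg i _) hcl.pos (hl .small_cell)
  have h3 := IsClearing.load_add_load_le hC hcl h'
  have hαM : 0 < g.α * zM ^ (g.α - 1) := mul_pos g.α_pos (Real.rpow_pos_of_pos hzM _)
  simp only [tierPair_macro, tierPair_small]
  rcases hcl.le.eq_or_lt with hzz | hzz
  · rw [← hzz] at hαM h1 h3 ⊢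
    nlinarith
  · have hsep : (∑ i, C i .small_cell + g.wifiCapacity) * zS = g.Nf := by
      rcases hcl.clears with ⟨-, h4⟩ | ⟨h4, -⟩
      · exact h4
      · exact absurd h4 hzz.ne'
    have h4 := IsClearing.load_small_le hC hsep h'
    have h5 := mul_lt_mul_of_pos_left (g.rpow_sub_one_lt hcl.pos hzz) g.α_pos
    nlinarith

/-! ### Price equilibria of the game -/

lemma capacity_nonneg {b : Bandwidths N} (hb : g.Feasible b) (i : Fin N) (t : Tier) :
    0 ≤ g.capacity b i t := by
  have h1 := (hb i).1 t
  have h2 := g.R₀_pos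
  have h3 := g.one_lt_lamS
  cases t
  · exact mul_nonneg h1 h2.le
  · exact mul_nonneg (mul_nonneg (by linarith) h1) h2.le

theorem existsUnique_isUserAssociation (g : Market N) {b : Bandwidths N} {p : Prices N}
    (hb : g.Feasible b) (hp : ∀ i t, 0 ≤ p i t) : ∃! K, g.IsUserAssociation b p K := by
  obtain ⟨K, hK⟩ := g.exists_isFilling (capacity_nonneg hb) (g.perCapacity_nonneg hp)
  refine ⟨K, (isUserAssociation_iff hp).2 hK, fun K' hK' => ?_⟩
  exact ((isUserAssociation_iff hp).1 hK').unique (capacity_nonneg hb) hK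

lemma isFilling_association {b : Bandwidths N} {p : Prices N} (hb : g.Feasible b)
    (hp : ∀ i t, 0 ≤ p i t) :
    g.IsFilling (g.capacity b) (g.perCapacity p) (g.association b p) :=
  (isUserAssociation_iff hp).1
    (Classical.epsilon_spec (g.existsUnique_isUserAssociation hb hp).exists)

lemma revenue_eq {b : Bandwidths N} {p : Prices N} (hb : g.Feasible b) (hp : ∀ i t, 0 ≤ p i t)
    (i : Fin N) : g.revenue b p i = g.payoff (g.association b p) i (g.perCapacity p i) := by
  have h := isFilling_association hb hp
  have ht : ∀ t, g.tierRevenue b p i t =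
      (g.association b p).load i t * g.perCapacity p i t ^ (g.α - 1) := fun t => by
    rw [tierRevenue]
    rcases (hp i t).eq_or_lt with h0 | h0
    · have h1 := h.load_le i t
      rw [perCapacity, ← h0, Real.zero_rpow (one_div_ne_zero g.α_pos.ne'), mul_zero] at h1
      rw [le_antisymm h1 (h.load_nonneg i t), zero_mul, zero_mul]
    · congr 1
      rw [perCapacity, demand, ← Real.rpow_mul h0.le, one_div (p i t), Real.inv_rpow h0.le, mul_sub,
        one_div_mul_cancel g.α_pos.ne', mul_one, Real.rpow_sub h0, Real.rpow_one]
      exact (div_eq_mul_inv _ _).symm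
  rw [revenue, ht, ht, payoff]

lemma perCapacity_update (g : Market N) (p : Prices N) (i : Fin N) (q : Tier → ℝ) :
    g.perCapacity (Function.update p i q) =
      Function.update (g.perCapacity p) i fun t => q t ^ (1 / g.α) := by
  funext j t
  by_cases hj : j = i
  · subst hj; simp [perCapacity]
  · simp [perCapacity, Function.update_of_ne hj]

lemma update_nonneg {p : Prices N} {q : Tier → ℝ} (hp : ∀ i t, 0 ≤ p i t) (hq : ∀ t, 0 ≤ q t)
    (i j : Fin N) (t : Tier) : 0 ≤ Function.update p i q j t := by
  by_cases hj : j = i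
  · subst hj; simpa using hq t
  · simpa [Function.update_of_ne hj] using hp j t

lemma isPriceEquilibrium_iff {b : Bandwidths N} {p : Prices N} (hb : g.Feasible b) :
    g.IsPriceEquilibrium b p ↔
      (∀ i t, 0 ≤ p i t) ∧ g.IsNash (g.capacity b) (g.perCapacity p) := by
  refine and_congr_right fun hp => ⟨fun h K i y K' hK hy hK' => ?_, fun h i q hq => ?_⟩
  · have hyα : (fun t => (y t ^ g.α) ^ (1 / g.α)) = y := funext fun t => by
      rw [← Real.rpow_mul (hy t), mul_one_div_cancel g.α_pos.ne', Real.rpow_one]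
    have hq : ∀ t, 0 ≤ y t ^ g.α := fun t => Real.rpow_nonneg (hy t) _
    have hz := g.perCapacity_update p i fun t => y t ^ g.α
    have hp' := update_nonneg hp hq i
    have hK1 := hK.unique (capacity_nonneg hb) (isFilling_association hb hp)
    have hK2 : K' = _ := IsFilling.unique (g := g) (capacity_nonneg hb) hK' (by
      have := isFilling_association hb hp'
      rwa [hz, hyα] at this)
    have h1 := h i (fun t => y t ^ g.α) hq
    rw [revenue_eq hb hp, revenue_eq hb hp', hz, hyα, Function.update_self] at h1
    rwa [hK1, hK2]
  · have hp' := update_nonneg hp hq i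
    rw [revenue_eq hb hp, revenue_eq hb hp']
    have h1 := isFilling_association hb hp'
    have h2 := h (g.association b p) i (fun t => q t ^ (1 / g.α))
      (g.association b (Function.update p i q)) (isFilling_association hb hp)
      (fun t => Real.rpow_nonneg (hq t) _) (by rwa [perCapacity_update] at h1)
    rwa [perCapacity_update, Function.update_self]

/-- Total capacity of a tier. -/
def totalCapacity (g : Market N) (b : Bandwidths N) (t : Tier) : ℝ := ∑ i, g.capacity b i t

lemma exists_isPriceEquilibrium (g : Market N) {b : Bandwidths N} (hb : g.Feasible b) :
    ∃ p, g.IsPriceEquilibrium b p := by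
  have hC := capacity_nonneg hb
  obtain ⟨zM, zS, hcl⟩ := g.exists_isClearing (Finset.sum_nonneg fun i _ => hC i .macro_cell)
    (Finset.sum_nonneg fun i _ => hC i .small_cell)
  refine ⟨fun _ t => tierPair zM zS t ^ g.α, (isPriceEquilibrium_iff hb).2
    ⟨fun _ t => Real.rpow_nonneg (hcl.nonneg t) _, ?_⟩⟩
  have : g.perCapacity (fun _ t => tierPair zM zS t ^ g.α) = fun _ => tierPair zM zS := by
    funext i t
    rw [perCapacity, ← Real.rpow_mul (hcl.nonneg t), mul_one_div_cancel g.α_pos.ne', Real.rpow_one]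
  rw [this]
  exact hcl.isNash hC

lemma capacity_pos_iff (g : Market N) (b : Bandwidths N) (i : Fin N) (t : Tier) :
    0 < g.capacity b i t ↔ 0 < b i t := by
  have h2 := g.R₀_pos
  have h3 : 0 < g.lamS := zero_lt_one.trans g.one_lt_lamS
  cases t
  · exact mul_pos_iff_of_pos_right h2
  · rw [capacity, mul_pos_iff_of_pos_right h2, mul_pos_iff_of_pos_left h3]

/-- What price equilibria look like: prices are market-clearing, and all capacity is sold. -/
theorem IsPriceEquilibrium.exists_isClearing {b : Bandwidths N} {p : Prices N} (hb : g.Feasible b)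
    (h : g.IsPriceEquilibrium b p) : ∃ zM zS,
      g.IsClearing (g.totalCapacity b .macro_cell) (g.totalCapacity b .small_cell) zM zS ∧
      (∀ i t, 0 < b i t → p i t = tierPair zM zS t ^ g.α) ∧
      g.IsFilling (g.capacity b) (fun _ => tierPair zM zS) (g.association b p) ∧
      ∀ i, g.revenue b p i = g.capacity b i .macro_cell * zM ^ g.α +
        g.capacity b i .small_cell * zS ^ g.α := by
  obtain ⟨hp, hN⟩ := (isPriceEquilibrium_iff hb).1 h
  have hC := capacity_nonneg hb
  obtain ⟨zM, zS, hcl, hz⟩ := hN.exists_isClearing hC (g.perCapacity_nonneg hp)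
  have hK := isFilling_association hb hp
  have hK' : g.IsFilling (g.capacity b) (fun _ => tierPair zM zS) (g.association b p) :=
    hK.congr fun i t h0 => hz i t ((hC i t).lt_of_ne h0.symm)
  refine ⟨zM, zS, hcl, fun i t hit => ?_, hK', fun i => ?_⟩
  · rw [← hz i t ((g.capacity_pos_iff b i t).2 hit), perCapacity, ← Real.rpow_mul (hp i t),
      one_div_mul_cancel g.α_pos.ne', Real.rpow_one]
  · rw [revenue_eq hb hp, payoff_full (fun t => hN.full hC (g.perCapacity_nonneg hp) hK i t)
      (g.perCapacity_nonneg hp)]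
    have hCz : ∀ t, g.capacity b i t * g.perCapacity p i t ^ g.α =
        g.capacity b i t * tierPair zM zS t ^ g.α := fun t => by
      rcases (hC i t).eq_or_lt with h0 | h0
      · rw [← h0, zero_mul, zero_mul]
      · rw [hz i t h0]
    rw [hCz, hCz]
    rfl

end Market

namespace Market

variable {N : ℕ} {g : Market N}

/-! ### The best bandwidth split of an SP -/

/-- Revenue of a service of capacity `x` that clears a mass `n` of users together with other
services of capacity `X` in the same market. -/
noncomputable def share (g : Market N) (n X x : ℝ) : ℝ := x * (n / (x + X)) ^ g.α

/-- Derivative of `share` in the capacity of the service. -/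
noncomputable def marginal (g : Market N) (n X x : ℝ) : ℝ :=
  (n / (x + X)) ^ g.α * (1 - g.α * (x / (x + X)))

/-- Revenue of an SP with capacities `x` in macro-cells and `y` in small-cells at market-clearing
prices, if the others have capacity `X` in macro-cells and `Y` in small-cells and WiFi. The two
markets are separate unless the mobile users are too few for the macro-cells. -/
noncomputable def splitRevenue (g : Market N) (X Y x y : ℝ) : ℝ :=
  if g.Nf * (x + X) ≤ g.Nm * (y + Y) then g.share g.Nm X x + g.share g.Nf Y y
  else g.share (g.Nm + g.Nf) (X + Y) (x + y)

/-- `(x, y)` are revenue-maximizing capacities for an SP whose bandwidth yields the capacity `β` if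
all of it is used for macro-cells. -/
structure IsBestSplit (g : Market N) (β X Y x y : ℝ) : Prop where
  macro_nonneg : 0 ≤ x
  small_nonneg : 0 ≤ y
  budget : g.lamS * x + y ≤ g.lamS * β
  best : ∀ x' y', 0 ≤ x' → 0 ≤ y' → g.lamS * x' + y' ≤ g.lamS * β →
    g.splitRevenue X Y x' y' ≤ g.splitRevenue X Y x y

lemma share_lt_share (g : Market N) {n X x x' : ℝ} (hn : 0 < n) (hX : 0 ≤ X) (hx : 0 ≤ x)
    (hxx : x < x') : g.share n X x < g.share n X x' := by
  have hx' : 0 < x' := hx.trans_lt hxx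
  have key : ∀ {x : ℝ}, 0 < x → g.share n X x = x ^ (1 - g.α) * (n * (x / (x + X))) ^ g.α := by
    intro x hx
    have h1 : x ^ (1 - g.α) * x ^ g.α = x := by
      rw [← Real.rpow_add hx, sub_add_cancel, Real.rpow_one]
    rw [share, show n * (x / (x + X)) = x * (n / (x + X)) by ring,
      Real.mul_rpow hx.le (div_nonneg hn.le (by linarith)), ← mul_assoc, h1]
  rcases hx.eq_or_lt with rfl | hx
  · rw [share, zero_mul]
    exact mul_pos hx' (Real.rpow_pos_of_pos (div_pos hn (by linarith)) _)
  · rw [key hx, key hx']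
    refine mul_lt_mul (Real.rpow_lt_rpow hx.le hxx g.one_sub_α_pos)
      (Real.rpow_le_rpow (by positivity) (mul_le_mul_of_nonneg_left ?_ hn.le) g.α_pos.le)
      (Real.rpow_pos_of_pos (mul_pos hn (div_pos hx (by linarith))) _)
      (Real.rpow_nonneg hx'.le _)
    rw [div_le_div_iff₀ (by linarith) (by linarith)]
    nlinarith

lemma one_sub_mul_le_rpow_neg (g : Market N) {u : ℝ} (hu : 0 < u) :
    1 - g.α * (u - 1) ≤ u ^ (-g.α) := by
  have h1 := Real.log_le_sub_one_of_pos hu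
  have h2 := Real.add_one_le_exp (Real.log u * -g.α)
  rw [Real.rpow_def_of_pos hu]
  nlinarith [g.α_pos]

/-- The revenue of a service is concave in its capacity. -/
lemma share_le_tangent (g : Market N) {n X x x₀ : ℝ} (hn : 0 < n) (hX : 0 ≤ X) (hx : 0 < x + X)
    (hx₀ : 0 < x₀ + X) :
    g.share n X x ≤ g.share n X x₀ + g.marginal n X x₀ * (x - x₀) := by
  set s := x₀ + X with hs
  set u := (x + X) / s with hu
  have hu0 : 0 < u := div_pos hx hx₀
  have hsu : x + X = s * u := by rw [hu]; field_simp
  have h1 : (n / (x + X)) ^ g.α = (n / s) ^ g.α * u ^ (-g.α) := by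
    rw [hsu, ← div_div, div_eq_mul_inv _ u, Real.mul_rpow (div_nonneg hn.le hx₀.le)
      (inv_nonneg.2 hu0.le), Real.inv_rpow hu0.le, Real.rpow_neg hu0.le]
  have h2 : u * u ^ (-g.α) = u ^ (1 - g.α) := by
    rw [sub_eq_add_neg, Real.rpow_add hu0, Real.rpow_one]
  have h3 := g.one_sub_mul_le_rpow_neg hu0
  have h4 := rpow_one_add_le_one_add_mul_self (s := u - 1) (p := 1 - g.α) (by linarith)
    g.one_sub_α_pos.le (by linarith [g.α_pos])
  rw [add_sub_cancel, ← h2] at h4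
  have h5 : x * u ^ (-g.α) ≤ x₀ + (1 - g.α * (x₀ / s)) * (x - x₀) := by
    have h6 : x = s * u - X := by linarith
    have h7 : x₀ = s - X := by linarith
    have h8 : g.α * ((s - X) / s) * (s * u - s) = g.α * (s - X) * (u - 1) := by field_simp
    have h9 := mul_le_mul_of_nonneg_left h4 hx₀.le
    have h10 := mul_le_mul_of_nonneg_left h3 hX
    rw [h6, h7]
    linear_combination h9 + h10 + h8
  have hP : 0 ≤ (n / s) ^ g.α := Real.rpow_nonneg (div_nonneg hn.le hx₀.le) _
  calc g.share n X x = (n / s) ^ g.α * (x * u ^ (-g.α)) := by rw [share, h1]; ring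
    _ ≤ (n / s) ^ g.α * (x₀ + (1 - g.α * (x₀ / s)) * (x - x₀)) := mul_le_mul_of_nonneg_left h5 hP
    _ = _ := by rw [share, marginal]; ring

lemma continuousAt_marginal (g : Market N) {n X x : ℝ} (hn : 0 < n) (hx : 0 < x + X) :
    ContinuousAt (g.marginal n X) x := by
  unfold marginal
  have h1 : ContinuousAt (fun x => n / (x + X)) x :=
    continuousAt_const.div (by fun_prop) hx.ne'
  have h2 : ContinuousAt (fun x => x / (x + X)) x :=
    continuousAt_id.div (by fun_prop) hx.ne'
  exact (h1.rpow_const (Or.inl (div_pos hn hx).ne')).mul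
    (continuousAt_const.sub (continuousAt_const.mul h2))

lemma tendsto_marginal (g : Market N) {n X x : ℝ} (hn : 0 < n) (hx : 0 < x + X) (k : ℝ) :
    Tendsto (fun δ => g.marginal n X (x + k * δ)) (𝓝[>] (0 : ℝ)) (𝓝 (g.marginal n X x)) := by
  have h1 : Continuous fun δ : ℝ => x + k * δ := by fun_prop
  have h2 : Tendsto (fun δ : ℝ => x + k * δ) (𝓝[>] 0) (𝓝 x) := by
    simpa using (h1.tendsto 0).mono_left (nhdsWithin_le_nhds (s := Set.Ioi 0))
  exact (g.continuousAt_marginal hn hx).tendsto.comp h2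

lemma lamS_pos (g : Market N) : 0 < g.lamS := zero_lt_one.trans g.one_lt_lamS

namespace IsBestSplit

variable {β X Y x y : ℝ}

/-- In a common market an SP does better by moving bandwidth to the more efficient small-cells. -/
lemma separate (h : g.IsBestSplit β X Y x y) (hX : 0 ≤ X) (hY : 0 < Y) (hx : 0 < x) :
    g.Nf * (x + X) ≤ g.Nm * (y + Y) := by
  by_contra! hlt
  obtain ⟨δ, h1, h2, h3⟩ := ((eventually_add_mul_lt hlt (g.Nf + g.Nm * g.lamS)).and
    ((eventually_add_mul_lt hx 1).and self_mem_nhdsWithin)).exists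
  have h3' : 0 < δ := h3
  have hl := g.one_lt_lamS
  have hlδ₁ : δ < g.lamS * δ := lt_mul_of_one_lt_left h3' hl
  have hy := h.small_nonneg
  have hb := h.best (x - δ) (y + g.lamS * δ) (by linarith) (by linarith)
    (by linarith [h.budget])
  rw [splitRevenue, splitRevenue, if_neg (by linarith), if_neg (by linarith)] at hb
  exact absurd hb (not_le.2 (g.share_lt_share (add_pos g.Nm_pos g.Nf_pos) (by linarith)
    (by linarith) (by linarith)))

lemma budget_eq (h : g.IsBestSplit β X Y x y) (hY : 0 < Y)
    (hsep : g.Nf * (x + X) ≤ g.Nm * (y + Y)) : g.lamS * x + y = g.lamS * β := by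
  refine h.budget.antisymm (le_of_not_gt fun hlt => ?_)
  have hyy : y < g.lamS * β - g.lamS * x := by linarith
  have hb := h.best x (g.lamS * β - g.lamS * x) h.macro_nonneg (h.small_nonneg.trans hyy.le)
    (by linarith)
  have h1 := mul_lt_mul_of_pos_left hyy g.Nm_pos
  rw [splitRevenue, splitRevenue, if_pos (by linarith), if_pos hsep] at hb
  have h2 := g.share_lt_share g.Nf_pos hY.le h.small_nonneg hyy
  linarith

/-- Without competitors, the first macro-cells have unbounded marginal revenue. -/
lemma macro_pos (h : g.IsBestSplit β X Y x y) (hβ : 0 < β) (hX : X = 0) (hY : 0 < Y) : 0 < x := by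
  refine h.macro_nonneg.lt_of_ne fun hx => ?_
  have hl := lamS_pos g
  have hy := h.small_nonneg
  have hsep : g.Nf * (x + X) ≤ g.Nm * (y + Y) := by
    rw [← hx, hX, add_zero, mul_zero]
    exact mul_nonneg g.Nm_pos.le (by linarith)
  have hfull := h.budget_eq hY hsep
  rw [← hx, mul_zero, zero_add] at hfull
  have hy0 : 0 < y := hfull ▸ mul_pos hl hβ
  set Q := (g.Nf / (y + Y)) ^ g.α with hQ
  have hQ0 : 0 ≤ Q := Real.rpow_nonneg (div_nonneg g.Nf_pos.le (by linarith)) _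
  have hR : 0 ≤ (g.lamS * Q) ^ (1 / g.α) := Real.rpow_nonneg (mul_nonneg hl.le hQ0) _
  obtain ⟨δ, h1, h2, h3, hδ⟩ := ((eventually_add_mul_lt hy0 g.lamS).and
    ((eventually_add_mul_lt (mul_pos g.Nm_pos (by linarith : 0 < y + Y))
      (g.Nf + g.Nm * g.lamS)).and ((eventually_add_mul_lt g.Nm_pos
        ((g.lamS * Q) ^ (1 / g.α))).and self_mem_nhdsWithin))).exists
  have hδ' : 0 < δ := hδ
  have hlδ := mul_pos hl hδ'
  have hb := h.best δ (y - g.lamS * δ) hδ'.le (by linarith) (by linarith)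
  rw [splitRevenue, splitRevenue, if_pos (by rw [hX]; linarith), if_pos hsep, ← hx, hX] at hb
  simp only [share, add_zero, zero_mul, zero_add] at hb
  have h4 : Q ≤ (g.Nf / (y - g.lamS * δ + Y)) ^ g.α :=
    Real.rpow_le_rpow (div_nonneg g.Nf_pos.le (by linarith))
      (div_le_div_of_nonneg_left g.Nf_pos.le (by linarith) (by linarith)) g.α_pos.le
  have h5 : g.lamS * Q < (g.Nm / δ) ^ g.α := by
    have h6 : (g.lamS * Q) ^ (1 / g.α) < g.Nm / δ := by
      rw [lt_div_iff₀ hδ']; linarith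
    have h7 := Real.rpow_lt_rpow hR h6 g.α_pos
    rwa [← Real.rpow_mul (mul_nonneg hl.le hQ0), one_div_mul_cancel g.α_pos.ne',
      Real.rpow_one] at h7
  have h8 := mul_lt_mul_of_pos_left h5 hδ'
  have h9 := mul_le_mul_of_nonneg_left h4 (by linarith : 0 ≤ y - g.lamS * δ)
  rw [← hQ] at hb
  linarith

/-- First-order condition of an SP that moves bandwidth from macro- to small-cells. -/
lemma marginal_small_le (h : g.IsBestSplit β X Y x y) (hX : 0 ≤ X) (hY : 0 < Y) (hx : 0 < x)
    (hsep : g.Nf * (x + X) ≤ g.Nm * (y + Y)) :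
    g.lamS * g.marginal g.Nf Y y ≤ g.marginal g.Nm X x := by
  have hl := lamS_pos g
  have hy := h.small_nonneg
  have hlim1 := g.tendsto_marginal g.Nm_pos (by linarith : 0 < x + X) (-1)
  have hlim2 := (g.tendsto_marginal g.Nf_pos (by linarith : 0 < y + Y) g.lamS).const_mul g.lamS
  simp only [neg_mul, one_mul, ← sub_eq_add_neg] at hlim1
  refine le_of_tendsto_of_tendsto hlim2 hlim1 ?_
  filter_upwards [eventually_add_mul_lt hx 1, self_mem_nhdsWithin] with δ h1 hδ
  have hδ' : 0 < δ := hδ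
  have hlδ := mul_pos hl hδ'
  have hb := h.best (x - δ) (y + g.lamS * δ) (by linarith) (by linarith) (by linarith [h.budget])
  have h2 := mul_pos g.Nf_pos hδ'
  have h3 := mul_pos g.Nm_pos hlδ
  rw [splitRevenue, splitRevenue, if_pos (by linarith), if_pos hsep] at hb
  have h4 := g.share_le_tangent (x := x) (x₀ := x - δ) g.Nm_pos hX (by linarith) (by linarith)
  have h5 := g.share_le_tangent (x := y) (x₀ := y + g.lamS * δ) g.Nf_pos hY.le (by linarith)
    (by linarith)
  refine le_of_mul_le_mul_right ?_ hδ'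
  linarith

/-- First-order condition of an SP that moves bandwidth from small- to macro-cells. -/
lemma marginal_macro_le (h : g.IsBestSplit β X Y x y) (hX : 0 ≤ X) (hY : 0 < Y) (hxX : 0 < x + X)
    (hy0 : 0 < y) (hsep : g.Nf * (x + X) < g.Nm * (y + Y)) :
    g.marginal g.Nm X x ≤ g.lamS * g.marginal g.Nf Y y := by
  have hl := lamS_pos g
  have hx := h.macro_nonneg
  have hlim1 := g.tendsto_marginal g.Nm_pos hxX 1
  have hlim2 := (g.tendsto_marginal g.Nf_pos (by linarith : 0 < y + Y) (-g.lamS)).const_mul g.lamS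
  simp only [neg_mul, one_mul, ← sub_eq_add_neg] at hlim1 hlim2
  refine le_of_tendsto_of_tendsto hlim1 hlim2 ?_
  filter_upwards [eventually_add_mul_lt hy0 g.lamS,
    eventually_add_mul_lt hsep (g.Nf + g.Nm * g.lamS), self_mem_nhdsWithin] with δ h1 h1' hδ
  have hδ' : 0 < δ := hδ
  have hb := h.best (x + δ) (y - g.lamS * δ) (by linarith) (by linarith) (by linarith [h.budget])
  rw [splitRevenue, splitRevenue, if_pos (by linarith), if_pos hsep.le] at hb
  have h4 := g.share_le_tangent (x := x) (x₀ := x + δ) g.Nm_pos hX (by linarith) (by linarith)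
  have h5 := g.share_le_tangent (x := y) (x₀ := y - g.lamS * δ) g.Nf_pos hY.le (by linarith)
    (by linarith)
  refine le_of_mul_le_mul_right ?_ hδ'
  linarith

/-- The first-order conditions are sufficient. While the markets remain separate, the revenue is
concave. A deviation `(x', y')` to a common market sells at most the capacity of the split
`(xb, yb)` at the boundary between the two cases that uses the whole bandwidth. -/
lemma of_marginal (hX : 0 < X) (hY : 0 < Y) (hx : 0 < x) (hy : 0 ≤ y)
    (hfull : g.lamS * x + y = g.lamS * β) (hsep : g.Nf * (x + X) < g.Nm * (y + Y))
    (hle : g.lamS * g.marginal g.Nf Y y ≤ g.marginal g.Nm X x)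
    (heq : 0 < y → g.lamS * g.marginal g.Nf Y y = g.marginal g.Nm X x) :
    g.IsBestSplit β X Y x y := by
  have hl := lamS_pos g
  have hl₁ := g.one_lt_lamS
  have hNm := g.Nm_pos
  have hNf := g.Nf_pos
  have hmarg : 0 ≤ g.marginal g.Nf Y y := by
    refine mul_nonneg (Real.rpow_nonneg (by positivity) _) ?_
    have h1 : y / (y + Y) ≤ 1 := by rw [div_le_one (by linarith)]; linarith
    have h2 : 0 ≤ y / (y + Y) := by positivity
    nlinarith [g.α_pos, g.α_lt_one]
  have hconc : ∀ x' y', 0 ≤ x' → 0 ≤ y' → g.lamS * x' + y' ≤ g.lamS * β →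
      g.share g.Nm X x' + g.share g.Nf Y y' ≤ g.share g.Nm X x + g.share g.Nf Y y := by
    intro x' y' hx' hy' hb
    have h1 := g.share_le_tangent (x := x') (x₀ := x) hNm hX.le (by linarith) (by linarith)
    have h2 := g.share_le_tangent (x := y') (x₀ := y) hNf hY.le (by linarith) (by linarith)
    have h3 : y' - y + g.lamS * (x' - x) ≤ 0 := by linarith
    have h4 := mul_nonpos_of_nonneg_of_nonpos hmarg h3
    rcases hy.eq_or_lt with h0 | h0
    · have h5 : x' ≤ x := by
        refine le_of_mul_le_mul_left ?_ hl
        linarith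
      have h6 := mul_nonneg (sub_nonneg.2 hle) (sub_nonneg.2 h5)
      linarith
    · have h5 := heq h0
      rw [← h5] at h1
      linarith
  refine ⟨hx.le, hy, hfull.le, fun x' y' hx' hy' hb => ?_⟩
  rw [splitRevenue, splitRevenue, if_pos hsep.le]
  split_ifs with hs
  · exact hconc x' y' hx' hy' hb
  · rw [not_le] at hs
    have hD : 0 < g.Nf + g.lamS * g.Nm := by positivity
    set xb := (g.Nm * (g.lamS * β + Y) - g.Nf * X) / (g.Nf + g.lamS * g.Nm) with hxb
    have hxbD : xb * (g.Nf + g.lamS * g.Nm) = g.Nm * (g.lamS * β + Y) - g.Nf * X := by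
      rw [hxb]; field_simp
    set yb := g.lamS * (β - xb) with hyb
    have hbd : g.Nf * (xb + X) = g.Nm * (yb + Y) := by rw [hyb]; linarith
    have hxxb : x ≤ xb := by
      rw [hxb, le_div_iff₀ hD]
      have : y = g.lamS * β - g.lamS * x := by linarith
      rw [this] at hsep
      linarith
    have hx'β : x' ≤ β := le_of_mul_le_mul_left (by linarith) hl
    have hxbβ : xb ≤ β := by
      rw [hxb, div_le_iff₀ hD]
      have h1 := mul_nonneg hNm.le hy'
      have h2 := mul_le_mul_of_nonneg_left hx'β hNf.le
      linarith
    have hyb0 : 0 ≤ yb := mul_nonneg hl.le (by linarith)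
    have hxb0 : 0 < xb := hx.trans_le hxxb
    have hsum : x' + y' ≤ xb + yb := by
      rcases le_or_gt xb x' with h1 | h1
      · have h2 := mul_le_mul_of_nonneg_left h1 (sub_nonneg.2 hl₁.le)
        rw [hyb]
        linarith
      · have h2 := mul_lt_mul_of_pos_left h1 hNf
        have h3 : y' < yb := lt_of_mul_lt_mul_left (by linarith) hNm.le
        linarith
    have hmono : g.share (g.Nm + g.Nf) (X + Y) (x' + y') ≤
        g.share (g.Nm + g.Nf) (X + Y) (xb + yb) := by
      rcases hsum.eq_or_lt with h1 | h1
      · rw [h1]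
      · exact (g.share_lt_share (by linarith) (by linarith) (by linarith) h1).le
    have h1 : 0 < xb + X := by linarith
    have h2 : 0 < yb + Y := by linarith
    have hb1 : g.Nm / (xb + X) = (g.Nm + g.Nf) / (xb + yb + (X + Y)) := by
      rw [div_eq_div_iff h1.ne' (by linarith)]
      linarith
    have hb2 : g.Nf / (yb + Y) = (g.Nm + g.Nf) / (xb + yb + (X + Y)) := by
      rw [div_eq_div_iff h2.ne' (by linarith)]
      linarith
    refine (hmono.trans (le_of_eq ?_)).trans
      (hconc xb yb hxb0.le hyb0 (by rw [hyb]; linarith))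
    rw [share, share, share, hb1, hb2]
    ring

end IsBestSplit

end Market

namespace Market

variable {N : ℕ} {g : Market N} {x y x' y' : Fin N → ℝ}

/-! ### Equilibrium splits -/

/-- Capacities in macro-cells (`x`) and small-cells (`y`) that use the whole bandwidth and satisfy
the first-order conditions of all SPs. The factors `(g.Nm / ∑ j, x j) ^ g.α` and
`(g.Nf / (∑ j, y j + g.wifiCapacity)) ^ g.α` are the prices of the two tiers. -/
structure IsSplitSolution (g : Market N) (x y : Fin N → ℝ) : Prop where
  macro_pos : ∀ i, 0 < x i
  small_nonneg : ∀ i, 0 ≤ y i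
  budget : ∀ i, g.lamS * x i + y i = g.lamS * (g.R₀ * g.B i)
  foc_le : ∀ i, g.lamS * ((g.Nf / (∑ j, y j + g.wifiCapacity)) ^ g.α *
      (1 - g.α * (y i / (∑ j, y j + g.wifiCapacity)))) ≤
    (g.Nm / ∑ j, x j) ^ g.α * (1 - g.α * (x i / ∑ j, x j))
  foc_eq : ∀ i, 0 < y i → g.lamS * ((g.Nf / (∑ j, y j + g.wifiCapacity)) ^ g.α *
      (1 - g.α * (y i / (∑ j, y j + g.wifiCapacity)))) =
    (g.Nm / ∑ j, x j) ^ g.α * (1 - g.α * (x i / ∑ j, x j))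

/-- Bandwidth is less valuable in small-cells than in macro-cells, if the own price effect is left
aside: otherwise all SPs would have larger market shares in small-cells than in macro-cells, which
is impossible because of WiFi. -/
lemma lamS_mul_lt (hx : 0 < ∑ j, x j) (hy : ∀ i, 0 ≤ y i)
    (h : ∀ i, 0 < x i → g.lamS * ((g.Nf / (∑ j, y j + g.wifiCapacity)) ^ g.α *
      (1 - g.α * (y i / (∑ j, y j + g.wifiCapacity)))) ≤
    (g.Nm / ∑ j, x j) ^ g.α * (1 - g.α * (x i / ∑ j, x j))) :
    g.lamS * (g.Nf / (∑ j, y j + g.wifiCapacity)) ^ g.α < (g.Nm / ∑ j, x j) ^ g.α := by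
  by_contra! hle
  have hY : 0 ≤ ∑ j, y j := Finset.sum_nonneg fun j _ => hy j
  have hW := g.wifiCapacity_pos
  set T := ∑ j, y j + g.wifiCapacity with hT
  have hT0 : 0 < T := by linarith
  set P := (g.Nm / ∑ j, x j) ^ g.α with hP
  set Q := (g.Nf / T) ^ g.α with hQ
  have hP0 : 0 < P := Real.rpow_pos_of_pos (div_pos g.Nm_pos hx) _
  have hsum : ∑ i, x i / ∑ j, x j ≤ ∑ i, y i / T := by
    refine Finset.sum_le_sum fun i _ => ?_
    have hb0 : 0 ≤ y i / T := div_nonneg (hy i) hT0.le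
    rcases le_or_gt (x i) 0 with h0 | h0
    · exact (div_nonpos_of_nonpos_of_nonneg h0 hx.le).trans hb0
    · have hb1 : y i / T ≤ 1 := by
        rw [div_le_one hT0]
        have := Finset.single_le_sum (fun j _ => hy j) (Finset.mem_univ i)
        linarith
      have hb2 : 0 ≤ 1 - g.α * (y i / T) := by nlinarith [g.α_pos, g.α_lt_one]
      have h1 := h i h0
      have h2 := mul_le_mul_of_nonneg_right hle hb2
      have h3 : P * (1 - g.α * (y i / T)) ≤ P * (1 - g.α * (x i / ∑ j, x j)) := by linarith
      have h4 := le_of_mul_le_mul_left h3 hP0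
      exact le_of_mul_le_mul_left (by linarith) g.α_pos
  rw [← Finset.sum_div, ← Finset.sum_div, div_self hx.ne', le_div_iff₀ hT0] at hsum
  linarith

lemma separate_of_lamS_mul_lt (hx : 0 < ∑ j, x j) (hy : ∀ i, 0 ≤ y i)
    (h : g.lamS * (g.Nf / (∑ j, y j + g.wifiCapacity)) ^ g.α < (g.Nm / ∑ j, x j) ^ g.α) :
    g.Nf * ∑ j, x j < g.Nm * (∑ j, y j + g.wifiCapacity) := by
  have hY : 0 ≤ ∑ j, y j := Finset.sum_nonneg fun j _ => hy j
  have hW := g.wifiCapacity_pos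
  have hT : 0 < ∑ j, y j + g.wifiCapacity := by linarith
  have h1 : 0 < g.Nf / (∑ j, y j + g.wifiCapacity) := div_pos g.Nf_pos hT
  have h2 := lt_mul_of_one_lt_left (Real.rpow_pos_of_pos h1 g.α) g.one_lt_lamS
  have h3 := (Real.rpow_lt_rpow_iff h1.le (div_pos g.Nm_pos hx).le g.α_pos).1 (h2.trans h)
  rwa [div_lt_div_iff₀ hT hx] at h3

/-- Mutually best splits satisfy the first-order conditions. -/
lemma isSplitSolution_of_isBestSplit (hN : 0 < N)
    (h : ∀ i, g.IsBestSplit (g.R₀ * g.B i) (∑ j ∈ Finset.univ.erase i, x j)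
      (∑ j ∈ Finset.univ.erase i, y j + g.wifiCapacity) (x i) (y i)) : g.IsSplitSolution x y := by
  have hx := fun i => (h i).macro_nonneg
  have hy := fun i => (h i).small_nonneg
  have hW := g.wifiCapacity_pos
  have hX : ∀ i, 0 ≤ ∑ j ∈ Finset.univ.erase i, x j := fun i => Finset.sum_nonneg fun j _ => hx j
  have hY : ∀ i, 0 < ∑ j ∈ Finset.univ.erase i, y j + g.wifiCapacity := fun i =>
    add_pos_of_nonneg_of_pos (Finset.sum_nonneg fun j _ => hy j) hW
  have hsx : ∀ i, x i + ∑ j ∈ Finset.univ.erase i, x j = ∑ j, x j := fun i =>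
    (sum_eq_add_erase i x).symm
  have hsy : ∀ i, y i + (∑ j ∈ Finset.univ.erase i, y j + g.wifiCapacity) =
      ∑ j, y j + g.wifiCapacity := fun i => by rw [sum_eq_add_erase i y, add_assoc]
  have hT : 0 < ∑ j, y j + g.wifiCapacity :=
    add_pos_of_nonneg_of_pos (Finset.sum_nonneg fun j _ => hy j) hW
  have hβ : ∀ i, 0 < g.R₀ * g.B i := fun i => mul_pos g.R₀_pos (g.B_pos i)
  have hsum : 0 < ∑ j, x j := by
    by_contra! hle
    have h0 := (Finset.sum_eq_zero_iff_of_nonneg fun j _ => hx j).1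
      (hle.antisymm (Finset.sum_nonneg fun j _ => hx j))
    exact ((h ⟨0, hN⟩).macro_pos (hβ _) (Finset.sum_eq_zero fun j _ => h0 j (Finset.mem_univ j))
      (hY _)).ne' (h0 _ (Finset.mem_univ _))
  obtain ⟨i₀, -, hi₀⟩ := Finset.exists_lt_of_sum_lt (s := Finset.univ) (f := fun _ : Fin N => (0 : ℝ))
    (g := x) (by simpa using hsum)
  have hsep : ∀ i, g.Nf * (x i + ∑ j ∈ Finset.univ.erase i, x j) ≤
      g.Nm * (y i + (∑ j ∈ Finset.univ.erase i, y j + g.wifiCapacity)) := fun i => by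
    have := (h i₀).separate (hX _) (hY _) hi₀
    rwa [hsx, hsy] at this ⊢
  have hle : ∀ i, 0 < x i → g.lamS * ((g.Nf / (∑ j, y j + g.wifiCapacity)) ^ g.α *
      (1 - g.α * (y i / (∑ j, y j + g.wifiCapacity)))) ≤
    (g.Nm / ∑ j, x j) ^ g.α * (1 - g.α * (x i / ∑ j, x j)) := fun i hi => by
    have := (h i).marginal_small_le (hX i) (hY i) hi (hsep i)
    rwa [marginal, marginal, hsx, hsy] at this
  have hlt := lamS_mul_lt hsum hy hle
  have hsep' := separate_of_lamS_mul_lt hsum hy hlt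
  have hge : ∀ i, 0 < y i → (g.Nm / ∑ j, x j) ^ g.α * (1 - g.α * (x i / ∑ j, x j)) ≤
      g.lamS * ((g.Nf / (∑ j, y j + g.wifiCapacity)) ^ g.α *
      (1 - g.α * (y i / (∑ j, y j + g.wifiCapacity)))) := fun i hi => by
    have := (h i).marginal_macro_le (hX i) (hY i) (by rwa [hsx]) hi (by rwa [hsx, hsy])
    rwa [marginal, marginal, hsx, hsy] at this
  have hbud := fun i => (h i).budget_eq (hY i) (hsep i)
  have hpos : ∀ i, 0 < x i := fun i => by
    refine (hx i).lt_of_ne fun h0 => ?_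
    have h1 := hbud i
    rw [← h0, mul_zero, zero_add] at h1
    have hyi : 0 < y i := h1 ▸ mul_pos g.lamS_pos (hβ i)
    have h2 := hge i hyi
    rw [← h0, zero_div, mul_zero, sub_zero, mul_one] at h2
    have h3 : 0 ≤ g.lamS * (g.Nf / (∑ j, y j + g.wifiCapacity)) ^ g.α *
        (g.α * (y i / (∑ j, y j + g.wifiCapacity))) :=
      mul_nonneg (mul_nonneg g.lamS_pos.le (Real.rpow_nonneg (div_pos g.Nf_pos hT).le _))
        (mul_nonneg g.α_pos.le (div_pos hyi hT).le)
    linarith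
  exact ⟨hpos, hy, hbud, fun i => hle i (hpos i), fun i hi => (hle i (hpos i)).antisymm (hge i hi)⟩

namespace IsSplitSolution

lemma sum_macro_pos (hN : 0 < N) (h : g.IsSplitSolution x y) : 0 < ∑ j, x j :=
  Finset.sum_pos (fun i _ => h.macro_pos i) ⟨⟨0, hN⟩, Finset.mem_univ _⟩

lemma separate (hN : 0 < N) (h : g.IsSplitSolution x y) :
    g.Nf * ∑ j, x j < g.Nm * (∑ j, y j + g.wifiCapacity) :=
  separate_of_lamS_mul_lt (h.sum_macro_pos hN) h.small_nonneg
    (lamS_mul_lt (h.sum_macro_pos hN) h.small_nonneg fun i _ => h.foc_le i)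

/-- If the first-order conditions hold, then no SP can improve its split. -/
lemma isBestSplit (hN : 2 ≤ N) (h : g.IsSplitSolution x y) (i : Fin N) :
    g.IsBestSplit (g.R₀ * g.B i) (∑ j ∈ Finset.univ.erase i, x j)
      (∑ j ∈ Finset.univ.erase i, y j + g.wifiCapacity) (x i) (y i) := by
  have hW := g.wifiCapacity_pos
  have hX : 0 < ∑ j ∈ Finset.univ.erase i, x j := by
    refine Finset.sum_pos (fun j _ => h.macro_pos j) ?_
    rw [← Finset.card_pos, Finset.card_erase_of_mem (Finset.mem_univ i), Finset.card_univ,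
      Fintype.card_fin]
    omega
  have hsx : x i + ∑ j ∈ Finset.univ.erase i, x j = ∑ j, x j := (sum_eq_add_erase i x).symm
  have hsy : y i + (∑ j ∈ Finset.univ.erase i, y j + g.wifiCapacity) =
      ∑ j, y j + g.wifiCapacity := by rw [sum_eq_add_erase i y, add_assoc]
  refine IsBestSplit.of_marginal hX (add_pos_of_nonneg_of_pos
    (Finset.sum_nonneg fun j _ => h.small_nonneg j) hW) (h.macro_pos i) (h.small_nonneg i)
    (h.budget i) ?_ ?_ fun hi => ?_
  · rw [hsx, hsy]; exact h.separate (by omega)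
  · rw [marginal, marginal, hsx, hsy]; exact h.foc_le i
  · rw [marginal, marginal, hsx, hsy]; exact h.foc_eq i hi

lemma budget_sum (h : g.IsSplitSolution x y) :
    g.lamS * ∑ j, x j + ∑ j, y j = g.lamS * ∑ j, g.R₀ * g.B j := by
  rw [Finset.mul_sum, Finset.mul_sum, ← Finset.sum_add_distrib]
  exact Finset.sum_congr rfl fun i _ => h.budget i

/-- The total capacity of small-cells is the same in all solutions: in a solution with more of it,
the SPs with small-cells have no larger share in macro-cells and a larger share in small-cells, so
that their first-order conditions, added up, require a larger price ratio, while it is smaller. -/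
lemma sum_small_le (hN : 0 < N) (h : g.IsSplitSolution x y) (h' : g.IsSplitSolution x' y') :
    ∑ j, y' j ≤ ∑ j, y j := by
  by_contra! hlt
  have hl := g.lamS_pos
  have hW := g.wifiCapacity_pos
  have hα := g.α_pos
  have hC := h.sum_macro_pos hN
  have hC' := h'.sum_macro_pos hN
  have hY : 0 ≤ ∑ j, y j := Finset.sum_nonneg fun j _ => h.small_nonneg j
  have hCC : ∑ j, x' j < ∑ j, x j := by
    refine lt_of_mul_lt_mul_left ?_ hl.le
    linarith [h.budget_sum, h'.budget_sum]
  have hfl := h.foc_le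
  have hfe := h'.foc_eq
  have hlt0 := lamS_mul_lt hC h.small_nonneg fun i _ => h.foc_le i
  set CM := ∑ j, x j
  set CM' := ∑ j, x' j
  set T := ∑ j, y j + g.wifiCapacity with hT
  set T' := ∑ j, y' j + g.wifiCapacity with hT'
  have hT0 : 0 < T := by linarith
  have hTT : T < T' := by linarith
  have hPP : (g.Nm / CM) ^ g.α ≤ (g.Nm / CM') ^ g.α :=
    Real.rpow_le_rpow (div_pos g.Nm_pos hC).le
      (div_le_div_of_nonneg_left g.Nm_pos.le hC' hCC.le) hα.le
  have hQQ : (g.Nf / T') ^ g.α ≤ (g.Nf / T) ^ g.α :=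
    Real.rpow_le_rpow (div_pos g.Nf_pos (hT0.trans hTT)).le
      (div_le_div_of_nonneg_left g.Nf_pos.le hT0 hTT.le) hα.le
  have hP0 : 0 < (g.Nm / CM) ^ g.α := Real.rpow_pos_of_pos (div_pos g.Nm_pos hC) _
  have hQ0 : 0 < (g.Nf / T') ^ g.α :=
    Real.rpow_pos_of_pos (div_pos g.Nf_pos (hT0.trans hTT)) _
  set P := (g.Nm / CM) ^ g.α
  set P' := (g.Nm / CM') ^ g.α
  set Q := (g.Nf / T) ^ g.α
  set Q' := (g.Nf / T') ^ g.α
  set I := Finset.univ.filter fun i => 0 < y' i with hI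
  have hIne : I.Nonempty := by
    obtain ⟨i, -, hi⟩ := Finset.exists_lt_of_sum_lt (s := Finset.univ)
      (f := fun _ : Fin N => (0 : ℝ)) (g := y') (by simpa using hY.trans_lt hlt)
    exact ⟨i, by simp [hI, hi]⟩
  have hcard : (1 : ℝ) ≤ I.card := by exact_mod_cast hIne.card_pos
  have hshare : ∑ i ∈ I, x' i / CM' ≤ ∑ i ∈ I, x i / CM := by
    have h1 : ∑ i ∈ I, x' i / CM' + ∑ i ∈ Finset.univ.filter (fun i => ¬ 0 < y' i), x' i / CM' = 1 := by
      rw [hI, Finset.sum_filter_add_sum_filter_not, ← Finset.sum_div, div_self hC'.ne']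
    have h2 : ∑ i ∈ I, x i / CM + ∑ i ∈ Finset.univ.filter (fun i => ¬ 0 < y' i), x i / CM = 1 := by
      rw [hI, Finset.sum_filter_add_sum_filter_not, ← Finset.sum_div, div_self hC.ne']
    have h3 : ∑ i ∈ Finset.univ.filter (fun i => ¬ 0 < y' i), x i / CM ≤
        ∑ i ∈ Finset.univ.filter (fun i => ¬ 0 < y' i), x' i / CM' := by
      refine Finset.sum_le_sum fun i hi => ?_
      have hi0 : y' i = 0 :=
        le_antisymm (not_lt.1 (Finset.mem_filter.1 hi).2) (h'.small_nonneg i)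
      have h4 : x i ≤ x' i := by
        refine le_of_mul_le_mul_left ?_ hl
        linarith [h.budget i, h'.budget i, h.small_nonneg i]
      exact div_le_div₀ (h'.macro_pos i).le h4 hC' hCC.le
    linarith
  have hb : ∑ i ∈ I, y i / T < ∑ i ∈ I, y' i / T' := by
    have h1 : ∑ i ∈ I, y' i / T' = (∑ i, y' i) / T' := by
      rw [Finset.sum_div]
      refine Finset.sum_subset (Finset.subset_univ _) fun i _ hi => ?_
      have : y' i = 0 := le_antisymm (by simpa [hI] using hi) (h'.small_nonneg i)
      rw [this, zero_div]
    have h2 : ∑ i ∈ I, y i / T ≤ (∑ i, y i) / T := by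
      rw [Finset.sum_div]
      exact Finset.sum_le_sum_of_subset_of_nonneg (Finset.subset_univ _) fun i _ _ =>
        div_nonneg (h.small_nonneg i) hT0.le
    rw [h1]
    refine h2.trans_lt ?_
    rw [div_lt_div_iff₀ hT0 (hT0.trans hTT), hT, hT']
    have := mul_lt_mul_of_pos_right hlt hW
    linarith
  have hb1 : ∑ i ∈ I, y' i / T' ≤ 1 := by
    rw [← Finset.sum_div, div_le_one (hT0.trans hTT)]
    have := Finset.sum_le_sum_of_subset_of_nonneg (Finset.subset_univ I) fun i _ _ =>
      h'.small_nonneg i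
    linarith
  have hconst : ∀ f : Fin N → ℝ, ∑ i ∈ I, (1 - g.α * f i) = I.card - g.α * ∑ i ∈ I, f i := by
    intro f
    rw [Finset.sum_sub_distrib, ← Finset.mul_sum]
    simp
  have hs1 : g.lamS * Q * (I.card - g.α * ∑ i ∈ I, y i / T) ≤
      P * (I.card - g.α * ∑ i ∈ I, x i / CM) := by
    rw [← hconst, ← hconst, Finset.mul_sum, Finset.mul_sum]
    refine Finset.sum_le_sum fun i _ => ?_
    rw [mul_assoc]
    exact hfl i
  have hs2 : g.lamS * Q' * (I.card - g.α * ∑ i ∈ I, y' i / T') =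
      P' * (I.card - g.α * ∑ i ∈ I, x' i / CM') := by
    rw [← hconst, ← hconst, Finset.mul_sum, Finset.mul_sum]
    refine Finset.sum_congr rfl fun i hi => ?_
    rw [mul_assoc]
    exact hfe i (Finset.mem_filter.1 hi).2
  set b := ∑ i ∈ I, y i / T
  set b' := ∑ i ∈ I, y' i / T'
  set a := ∑ i ∈ I, x i / CM
  set a' := ∑ i ∈ I, x' i / CM'
  have hbpos : 0 < (I.card : ℝ) - g.α * b' := by nlinarith [g.α_lt_one]
  have h1 : g.lamS * Q' * (I.card - g.α * b') < g.lamS * Q * (I.card - g.α * b) := by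
    have h2 := mul_lt_mul_of_pos_left hb hα
    have h3 : g.lamS * Q' ≤ g.lamS * Q := mul_le_mul_of_nonneg_left hQQ hl.le
    exact mul_lt_mul' h3 (by linarith) hbpos.le (mul_pos hl (hQ0.trans_le hQQ))
  have h2 : g.α * a' ≤ g.α * a := mul_le_mul_of_nonneg_left hshare hα.le
  have h3 : 0 < (I.card : ℝ) - g.α * a' := by
    have h4 : 0 < P' * (I.card - g.α * a') := by
      rw [← hs2]; exact mul_pos (mul_pos hl hQ0) hbpos
    exact pos_of_mul_pos_right h4 (hP0.trans_le hPP).le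
  have h4 : P * (I.card - g.α * a) ≤ P * (I.card - g.α * a') :=
    mul_le_mul_of_nonneg_left (by linarith) hP0.le
  have h5 : P * (I.card - g.α * a') ≤ P' * (I.card - g.α * a') :=
    mul_le_mul_of_nonneg_right hPP h3.le
  linarith

/-- The equilibrium split is unique. -/
lemma unique (hN : 0 < N) (h : g.IsSplitSolution x y) (h' : g.IsSplitSolution x' y') :
    x = x' ∧ y = y' := by
  have key : ∀ {x y x' y' : Fin N → ℝ}, g.IsSplitSolution x y → g.IsSplitSolution x' y' →
      ∀ i, y' i ≤ y i := by
    intro x y x' y' h h' i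
    by_contra! hlt
    have hl := g.lamS_pos
    have hY := le_antisymm (sum_small_le hN h' h) (sum_small_le hN h h')
    have hX : ∑ j, x j = ∑ j, x' j := by
      refine mul_left_cancel₀ hl.ne' ?_
      linarith [h.budget_sum, h'.budget_sum]
    have hxx : x' i < x i := by
      refine lt_of_mul_lt_mul_left ?_ hl.le
      linarith [h.budget i, h'.budget i]
    have hC := h.sum_macro_pos hN
    have hT : 0 < ∑ j, y j + g.wifiCapacity :=
      add_pos_of_nonneg_of_pos (Finset.sum_nonneg fun j _ => h.small_nonneg j) g.wifiCapacity_pos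
    have h1 := h.foc_le i
    have h2 := h'.foc_eq i ((h.small_nonneg i).trans_lt hlt)
    rw [← hX, ← hY] at h2
    have hP : 0 < (g.Nm / ∑ j, x j) ^ g.α := Real.rpow_pos_of_pos (div_pos g.Nm_pos hC) _
    have hQ : 0 < (g.Nf / (∑ j, y j + g.wifiCapacity)) ^ g.α :=
      Real.rpow_pos_of_pos (div_pos g.Nf_pos hT) _
    have h3 := mul_lt_mul_of_pos_left (mul_lt_mul_of_pos_left
      (div_lt_div_of_pos_right hxx hC) g.α_pos) hP
    have h4 := mul_lt_mul_of_pos_left (mul_lt_mul_of_pos_left (mul_lt_mul_of_pos_left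
      (div_lt_div_of_pos_right hlt hT) g.α_pos) hQ) hl
    linarith
  have hy : y = y' := funext fun i => le_antisymm (key h' h i) (key h h' i)
  refine ⟨funext fun i => mul_left_cancel₀ g.lamS_pos.ne' ?_, hy⟩
  have h1 := h.budget i
  have h2 := h'.budget i
  rw [hy] at h1
  linarith

end IsSplitSolution

/-- First-order conditions determine the split from the total capacity `C` of the macro-cells,
and by the intermediate value theorem there is a `C` for which these splits add up to `C`. For small
`C` they leave too much to the macro-cells because there is more than one SP. -/
theorem exists_isSplitSolution (hN : 2 ≤ N) (g : Market N) : ∃ x y, g.IsSplitSolution x y := by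
  have hl := g.lamS_pos
  have hW := g.wifiCapacity_pos
  have hα := g.α_pos
  have hNm := g.Nm_pos
  have hNf := g.Nf_pos
  set β : Fin N → ℝ := fun i => g.R₀ * g.B i with hβdef
  have hβ : ∀ i, 0 < β i := fun i => mul_pos g.R₀_pos (g.B_pos i)
  set S := ∑ i, β i with hS
  have hN2 : (2 : ℝ) ≤ N := by exact_mod_cast hN
  have hS0 : 0 < S := Finset.sum_pos (fun i _ => hβ i) ⟨⟨0, by omega⟩, Finset.mem_univ _⟩
  -- `T C` is the capacity of all small-cells and WiFi, and `ρ C` the ratio of the small-cell price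
  -- to the macro price, weighted by `lamS`, when the macro-cells have total capacity `C`.
  set T : ℝ → ℝ := fun C => g.lamS * (S - C) + g.wifiCapacity with hTdef
  have hT : ∀ C ≤ S, 0 < T C := fun C hC => by
    have := mul_nonneg hl.le (sub_nonneg.2 hC)
    simp only [hTdef]; linarith
  have hTc : Continuous T := by simp only [hTdef]; fun_prop
  set ρ : ℝ → ℝ := fun C => g.lamS * (g.Nf * C / (g.Nm * T C)) ^ g.α with hρ
  have hρ0 : ∀ C, 0 ≤ C → C ≤ S → 0 ≤ ρ C := fun C h0 h1 =>
    mul_nonneg hl.le (Real.rpow_nonneg (div_nonneg (mul_nonneg hNf.le h0)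
      (mul_pos hNm (hT C h1)).le) _)
  have hρc : ∀ C ≤ S, ContinuousAt ρ C := fun C hC => by
    have h1 : ContinuousAt (fun C => g.Nf * C / (g.Nm * T C)) C :=
      ContinuousAt.div (by fun_prop) (by fun_prop) (mul_pos hNm (hT C hC)).ne'
    exact continuousAt_const.mul (h1.rpow_const (Or.inr hα.le))
  set D : ℝ → ℝ := fun C => g.α * (1 + g.lamS * ρ C * C / T C) with hD
  have hDge : ∀ C, 0 ≤ C → C ≤ S → g.α ≤ D C := fun C h0 h1 => by
    have h2 : 0 ≤ g.lamS * ρ C * C / T C :=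
      div_nonneg (mul_nonneg (mul_nonneg hl.le (hρ0 C h0 h1)) h0) (hT C h1).le
    simp only [hD]
    nlinarith
  have hDc : ∀ C ≤ S, ContinuousAt D C := fun C hC =>
    continuousAt_const.mul (continuousAt_const.add
      (((continuousAt_const.mul (hρc C hC)).mul continuousAt_id).div hTc.continuousAt (hT C hC).ne'))
  -- `Y i C` solves the first-order condition of SP `i`, linear in its small-cell capacity, truncated
  -- at `0`.
  set Y : Fin N → ℝ → ℝ := fun i C => max 0 (g.lamS * ((ρ C - 1) * C + g.α * β i) / D C) with hY
  have hYc : ∀ i, ∀ C, 0 ≤ C → C ≤ S → ContinuousAt (Y i) C := fun i C h0 h1 => by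
    refine continuousAt_const.max (ContinuousAt.div ?_ (hDc C h1) (hα.trans_le (hDge C h0 h1)).ne')
    exact continuousAt_const.mul ((((hρc C h1).sub continuousAt_const).mul continuousAt_id).add
      continuousAt_const)
  have hρlim : ∀ᶠ C in 𝓝[>] (0 : ℝ), ρ C < 1 / 2 := by
    have h1 : ρ 0 < 1 / 2 := by
      simp only [hρ, mul_zero, zero_div, Real.zero_rpow hα.ne']
      norm_num
    exact ((hρc 0 hS0.le).tendsto.mono_left nhdsWithin_le_nhds).eventually_lt_const h1
  have hβlim : ∀ᶠ C in 𝓝[>] (0 : ℝ), ∀ i, C < g.α * β i := by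
    rw [eventually_all]
    intro i
    filter_upwards [Ioo_mem_nhdsGT (mul_pos hα (hβ i))] with C hC using hC.2
  obtain ⟨ε, hρε, hβε, hε⟩ := (hρlim.and (hβlim.and (Ioo_mem_nhdsGT hS0))).exists
  have hGc : ContinuousOn (fun C => ∑ i, Y i C - g.lamS * (S - C)) (Set.Icc ε S) := by
    intro C hC
    refine ContinuousAt.continuousWithinAt (ContinuousAt.sub ?_ (by fun_prop))
    exact tendsto_finsetSum _ fun i _ => hYc i C (hε.1.le.trans hC.1) hC.2
  have hGε : ∑ i, Y i ε - g.lamS * (S - ε) ≤ 0 := by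
    have h1 : ∀ i, Y i ε ≤ g.lamS * (β i - (1 - ρ ε) * ε / g.α) := fun i => by
      have hρε0 := hρ0 ε hε.1.le hε.2.le
      have h2 : 0 ≤ (ρ ε - 1) * ε + g.α * β i := by nlinarith [hβε i, hε.1]
      have h3 : g.lamS * (β i - (1 - ρ ε) * ε / g.α) =
          g.lamS * ((ρ ε - 1) * ε + g.α * β i) / g.α := by field_simp; ring
      rw [h3]
      refine max_le (div_nonneg (mul_nonneg hl.le h2) hα.le) ?_
      exact div_le_div_of_nonneg_left (mul_nonneg hl.le h2) hα (hDge ε hε.1.le hε.2.le)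
    have h2 : ∑ i, Y i ε ≤ g.lamS * (S - N * ((1 - ρ ε) * ε / g.α)) := by
      refine (Finset.sum_le_sum fun i _ => h1 i).trans (le_of_eq ?_)
      rw [← Finset.mul_sum, Finset.sum_sub_distrib]
      simp [hS]
    -- `N * (1 - ρ ε) ≥ 1 > α`, because `N ≥ 2` and `ρ ε < 1 / 2`.
    have h3 : ε ≤ N * ((1 - ρ ε) * ε / g.α) := by
      rw [← mul_div_assoc, le_div_iff₀ hα, ← mul_assoc, mul_comm ε]
      refine mul_le_mul_of_nonneg_right ?_ hε.1.le
      nlinarith [g.α_lt_one]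
    have h4 := mul_le_mul_of_nonneg_left h3 hl.le
    linarith
  have hGS : 0 ≤ ∑ i, Y i S - g.lamS * (S - S) := by
    rw [sub_self, mul_zero, sub_zero]
    exact Finset.sum_nonneg fun i _ => le_max_left _ _
  obtain ⟨C, hC, hCG⟩ := intermediate_value_Icc hε.2.le hGc ⟨hGε, hGS⟩
  have hC0 : 0 < C := hε.1.trans_le hC.1
  have hsy : ∑ i, Y i C = g.lamS * (S - C) := by
    simp only at hCG
    linarith
  have hsyT : ∑ i, Y i C + g.wifiCapacity = T C := by rw [hsy]
  have hsx : ∑ i, (β i - Y i C / g.lamS) = C := by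
    rw [Finset.sum_sub_distrib, ← Finset.sum_div, hsy, ← hS]
    field_simp
    ring
  have hT0 := hT C hC.2
  have hD0 : 0 < D C := hα.trans_le (hDge C hC0.le hC.2)
  have hP : 0 < (g.Nm / C) ^ g.α := Real.rpow_pos_of_pos (div_pos hNm hC0) _
  have hρP : g.lamS * (g.Nf / T C) ^ g.α = ρ C * (g.Nm / C) ^ g.α := by
    simp only [hρ]
    rw [mul_assoc, ← Real.mul_rpow (div_nonneg (mul_nonneg hNf.le hC0.le) (mul_pos hNm hT0).le)
      (div_pos hNm hC0).le]
    congr 2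
    field_simp
  have hid : ∀ i, C * ((1 - g.α * ((β i - Y i C / g.lamS) / C)) -
      ρ C * (1 - g.α * (Y i C / T C))) =
      (Y i C * D C - g.lamS * ((ρ C - 1) * C + g.α * β i)) / g.lamS := fun i => by
    simp only [hD]
    field_simp
    ring
  have hle : ∀ i, g.lamS * ((g.Nf / (∑ j, Y j C + g.wifiCapacity)) ^ g.α *
      (1 - g.α * (Y i C / (∑ j, Y j C + g.wifiCapacity)))) ≤
      (g.Nm / ∑ j, (β j - Y j C / g.lamS)) ^ g.α *
      (1 - g.α * ((β i - Y i C / g.lamS) / ∑ j, (β j - Y j C / g.lamS))) := fun i => by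
    rw [hsyT, hsx, ← mul_assoc, hρP, mul_comm (ρ C), mul_assoc]
    refine mul_le_mul_of_nonneg_left (sub_nonneg.1 ?_) hP.le
    refine nonneg_of_mul_nonneg_right ?_ hC0
    rw [hid]
    refine div_nonneg (sub_nonneg.2 ?_) hl.le
    rw [← div_le_iff₀ hD0]
    exact le_max_right _ _
  have heq : ∀ i, 0 < Y i C → g.lamS * ((g.Nf / (∑ j, Y j C + g.wifiCapacity)) ^ g.α *
      (1 - g.α * (Y i C / (∑ j, Y j C + g.wifiCapacity)))) =
      (g.Nm / ∑ j, (β j - Y j C / g.lamS)) ^ g.α *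
      (1 - g.α * ((β i - Y i C / g.lamS) / ∑ j, (β j - Y j C / g.lamS))) := fun i hi => by
    rw [hsyT, hsx, ← mul_assoc, hρP, mul_comm (ρ C), mul_assoc]
    congr 1
    refine (sub_eq_zero.1 ((mul_eq_zero_iff_left hC0.ne').1 ?_)).symm
    have hmax : Y i C = g.lamS * ((ρ C - 1) * C + g.α * β i) / D C := by
      rcases max_choice 0 (g.lamS * ((ρ C - 1) * C + g.α * β i) / D C) with h1 | h1
      · exact absurd h1 hi.ne'
      · exact h1
    rw [mul_comm, mul_comm _ C, hid, (eq_div_iff hD0.ne').1 hmax, sub_self, zero_div]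
  have hlt := lamS_mul_lt (x := fun i => β i - Y i C / g.lamS) (y := fun i => Y i C)
    (by rw [hsx]; exact hC0) (fun i => le_max_left _ _) fun i _ => hle i
  refine ⟨fun i => β i - Y i C / g.lamS, fun i => Y i C, fun i => ?_, fun i => le_max_left _ _,
    fun i => by field_simp; ring, hle, heq⟩
  have hY0 : 0 ≤ Y i C := le_max_left _ _
  rcases hY0.eq_or_lt with h0 | h0
  · rw [← h0, zero_div, sub_zero]
    exact hβ i
  · have h1 := heq i h0
    rw [hsyT, hsx] at h1 hlt
    have h2 : 0 ≤ g.lamS * (g.Nf / T C) ^ g.α * (g.α * (Y i C / T C)) :=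
      mul_nonneg (mul_nonneg hl.le (Real.rpow_nonneg (div_pos hNf hT0).le _))
        (mul_nonneg hα.le (div_pos h0 hT0).le)
    have h3 : 0 < (g.Nm / C) ^ g.α * (g.α * ((β i - Y i C / g.lamS) / C)) := by linarith
    have h4 := pos_of_mul_pos_right (pos_of_mul_pos_right h3 hP.le) hα.le
    exact (div_pos_iff_of_pos_right hC0).1 h4

end Market

namespace Market

variable {N : ℕ} {g : Market N} {b : Bandwidths N} {p : Prices N}

/-! ### Subgame-perfect equilibria -/

/-- Total capacity of the other SPs in a tier. -/
def othersCapacity (g : Market N) (b : Bandwidths N) (i : Fin N) (t : Tier) : ℝ :=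
  ∑ j ∈ Finset.univ.erase i, g.capacity b j t

lemma totalCapacity_eq (g : Market N) (b : Bandwidths N) (i : Fin N) (t : Tier) :
    g.totalCapacity b t = g.capacity b i t + g.othersCapacity b i t :=
  sum_eq_add_erase i fun i => g.capacity b i t

lemma othersCapacity_update (g : Market N) (b : Bandwidths N) (i : Fin N) (β : Tier → ℝ) (t : Tier) :
    g.othersCapacity (Function.update b i β) i t = g.othersCapacity b i t := by
  refine Finset.sum_congr rfl fun j hj => ?_
  cases t <;> simp only [capacity, Function.update_of_ne (Finset.ne_of_mem_erase hj)]

lemma feasible_update (hb : g.Feasible b) {i : Fin N} {β : Tier → ℝ} (hβ : g.FeasibleSplit i β) :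
    g.Feasible (Function.update b i β) := fun j => by
  by_cases hj : j = i
  · subst hj; rwa [Function.update_self]
  · rw [Function.update_of_ne hj]; exact hb j

/-- Revenue of an SP in the price equilibrium after a bandwidth profile. -/
lemma IsPriceEquilibrium.revenue_eq_splitRevenue (hb : g.Feasible b)
    (h : g.IsPriceEquilibrium b p) (i : Fin N) :
    g.revenue b p i = g.splitRevenue (g.othersCapacity b i .macro_cell)
      (g.othersCapacity b i .small_cell + g.wifiCapacity) (g.capacity b i .macro_cell)
      (g.capacity b i .small_cell) := by
  have hC := capacity_nonneg hb
  have hW := g.wifiCapacity_pos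
  obtain ⟨zM, zS, hcl, -, -, hrev⟩ := h.exists_isClearing hb
  have hCM := Finset.sum_nonneg fun i (_ : i ∈ Finset.univ) => hC i .macro_cell
  have hCS := Finset.sum_nonneg fun i (_ : i ∈ Finset.univ) => hC i .small_cell
  change 0 ≤ g.totalCapacity b .macro_cell at hCM
  change 0 ≤ g.totalCapacity b .small_cell at hCS
  have hM := g.totalCapacity_eq b i .macro_cell
  have hS := g.totalCapacity_eq b i .small_cell
  rw [hrev, splitRevenue, share, share, share, ← hM, ← add_assoc, ← hS]
  split_ifs with hs
  · obtain ⟨h1, h2⟩ := hcl.separate hs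
    have hS' : zS = g.Nf / (g.totalCapacity b .small_cell + g.wifiCapacity) := by
      rw [eq_div_iff (by linarith), mul_comm]; exact h2
    rw [hS']
    congr 1
    rcases h1 with h0 | h0
    · have : g.capacity b i .macro_cell = 0 :=
        (Finset.sum_eq_zero_iff_of_nonneg fun j _ => hC j _).1 h0 i (Finset.mem_univ i)
      rw [this, zero_mul, zero_mul]
    · have hne : g.totalCapacity b .macro_cell ≠ 0 := fun h0' => by
        rw [h0', zero_mul] at h0
        exact g.Nm_pos.ne h0
      rw [(eq_div_iff hne).2 ((mul_comm ..).trans h0)]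
  · obtain ⟨h1, h2⟩ := hcl.mixed (by linarith) hCM (not_le.1 hs)
    have h3 : zS = (g.Nm + g.Nf) / (g.capacity b i .macro_cell + g.capacity b i .small_cell +
        (g.othersCapacity b i .macro_cell + (g.othersCapacity b i .small_cell +
          g.wifiCapacity))) := by
      rw [eq_div_iff (by linarith), mul_comm, ← h2, hM, hS]
      ring
    rw [h1, ← h3]
    ring

/-- The split of an SP that yields capacities `x` in macro-cells and `y` in small-cells. -/
noncomputable def splitOf (g : Market N) (x y : ℝ) : Tier → ℝ :=
  tierPair (x / g.R₀) (y / (g.lamS * g.R₀))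

lemma capacity_eq_of_splitOf {i : Fin N} {x y : ℝ} (h : b i = g.splitOf x y) :
    g.capacity b i .macro_cell = x ∧ g.capacity b i .small_cell = y := by
  have h1 := g.R₀_pos
  have h2 := g.lamS_pos
  constructor
  · simp only [capacity, h, splitOf, tierPair_macro]; field_simp
  · simp only [capacity, h, splitOf, tierPair_small]; field_simp

lemma feasibleSplit_splitOf {i : Fin N} {x y : ℝ} (hx : 0 ≤ x) (hy : 0 ≤ y)
    (h : g.lamS * x + y ≤ g.lamS * (g.R₀ * g.B i)) : g.FeasibleSplit i (g.splitOf x y) := by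
  have h1 := g.R₀_pos
  have h2 := g.lamS_pos
  refine ⟨tierPair_nonneg (div_nonneg hx h1.le) (div_nonneg hy (mul_pos h2 h1).le), ?_⟩
  have h3 : x / g.R₀ + y / (g.lamS * g.R₀) = (g.lamS * x + y) / (g.lamS * g.R₀) := by field_simp
  simp only [splitOf, tierPair_macro, tierPair_small]
  rw [h3, div_le_iff₀ (mul_pos h2 h1)]
  linarith

lemma capacity_budget (hb : g.Feasible b) (i : Fin N) :
    g.lamS * g.capacity b i .macro_cell + g.capacity b i .small_cell ≤
      g.lamS * (g.R₀ * g.B i) := by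
  have h1 := mul_le_mul_of_nonneg_left (hb i).2 (mul_pos g.lamS_pos g.R₀_pos).le
  simp only [capacity]
  linarith

lemma IsSubgamePerfect.isSplitSolution (hN : 0 < N) {π : Bandwidths N → Prices N}
    (h : g.IsSubgamePerfect b π) :
    g.IsSplitSolution (fun i => g.capacity b i .macro_cell)
      (fun i => g.capacity b i .small_cell) := by
  have hC := capacity_nonneg h.feasible
  refine isSplitSolution_of_isBestSplit hN fun i =>
    ⟨hC _ _, hC _ _, capacity_budget h.feasible i, fun x y hx hy hb => ?_⟩
  have hf := feasibleSplit_splitOf (i := i) hx hy hb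
  have hf' := feasible_update h.feasible hf
  have h1 := h.bandwidth_equilibrium i _ hf
  obtain ⟨h2, h3⟩ := capacity_eq_of_splitOf (g := g) (b := Function.update b i (g.splitOf x y))
    (i := i) (x := x) (y := y) (Function.update_self ..)
  rw [(h.price_equilibrium _ hf').revenue_eq_splitRevenue hf',
    (h.price_equilibrium _ h.feasible).revenue_eq_splitRevenue h.feasible, othersCapacity_update,
    othersCapacity_update, h2, h3] at h1
  exact h1

theorem exists_isSubgamePerfect (hN : 2 ≤ N) (g : Market N) :
    ∃ (b : Bandwidths N) (π : Bandwidths N → Prices N), g.IsSubgamePerfect b π := by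
  classical
  obtain ⟨x, y, hxy⟩ := exists_isSplitSolution hN g
  have hπ : ∀ b, ∃ p, g.Feasible b → g.IsPriceEquilibrium b p := fun b => by
    by_cases hb : g.Feasible b
    · obtain ⟨p, hp⟩ := g.exists_isPriceEquilibrium hb
      exact ⟨p, fun _ => hp⟩
    · exact ⟨fun _ _ => 0, fun h => absurd h hb⟩
  choose π hπ using hπ
  set b : Bandwidths N := fun i => g.splitOf (x i) (y i) with hb
  have hbf : g.Feasible b := fun i =>
    feasibleSplit_splitOf (hxy.macro_pos i).le (hxy.small_nonneg i) (hxy.budget i).le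
  have hcap : ∀ i, g.capacity b i .macro_cell = x i ∧ g.capacity b i .small_cell = y i :=
    fun i => capacity_eq_of_splitOf rfl
  refine ⟨b, π, hbf, fun b' hb' => hπ b' hb', fun i β hβ => ?_⟩
  have hf' := feasible_update hbf hβ
  rw [(hπ _ hf').revenue_eq_splitRevenue hf', (hπ _ hbf).revenue_eq_splitRevenue hbf,
    othersCapacity_update, othersCapacity_update]
  have h1 := hxy.isBestSplit hN i
  have hoM : g.othersCapacity b i .macro_cell = ∑ j ∈ Finset.univ.erase i, x j :=
    Finset.sum_congr rfl fun j _ => (hcap j).1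
  have hoS : g.othersCapacity b i .small_cell = ∑ j ∈ Finset.univ.erase i, y j :=
    Finset.sum_congr rfl fun j _ => (hcap j).2
  rw [hoM, hoS, (hcap i).1, (hcap i).2]
  exact h1.best _ _ (capacity_nonneg hf' i _) (capacity_nonneg hf' i _) (capacity_budget hf' i)

/-- Price equilibria are unique up to the prices of services without bandwidth. -/
theorem IsPriceEquilibrium.unique {p' : Prices N} (hb : g.Feasible b)
    (h : g.IsPriceEquilibrium b p) (h' : g.IsPriceEquilibrium b p') :
    (∀ i t, 0 < b i t → p i t = p' i t) ∧ g.association b p = g.association b p' := by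
  have hC := capacity_nonneg hb
  obtain ⟨zM, zS, hcl, hp, hK, -⟩ := h.exists_isClearing hb
  obtain ⟨zM', zS', hcl', hp', hK', -⟩ := h'.exists_isClearing hb
  obtain ⟨h1, h2⟩ := hcl.unique (Finset.sum_nonneg fun i _ => hC i _)
    (Finset.sum_nonneg fun i _ => hC i _) hcl'
  have hz : ∀ i t, 0 < g.capacity b i t → tierPair zM zS t = tierPair zM' zS' t := by
    rintro i (_ | _) hi
    · exact h2 (Finset.sum_pos' (fun j _ => hC j _) ⟨i, Finset.mem_univ _, hi⟩)
    · exact h1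
  refine ⟨fun i t hit => ?_, (hK.congr fun i t h0 => ?_).unique hC hK'⟩
  · rw [hp i t hit, hp' i t hit, hz i t ((g.capacity_pos_iff b i t).2 hit)]
  · exact hz i t ((hC i t).lt_of_ne h0.symm)

lemma IsSubgamePerfect.bandwidths_unique (hN : 0 < N) {b' : Bandwidths N}
    {π π' : Bandwidths N → Prices N} (h : g.IsSubgamePerfect b π) (h' : g.IsSubgamePerfect b' π') :
    b = b' := by
  obtain ⟨hx, hy⟩ := (h.isSplitSolution hN).unique hN (h'.isSplitSolution hN)
  funext i t
  cases t
  · exact mul_right_cancel₀ g.R₀_pos.ne' (congrFun hx i)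
  · exact mul_left_cancel₀ g.lamS_pos.ne' (mul_right_cancel₀ g.R₀_pos.ne' (congrFun hy i))

lemma demand_lt_demand (g : Market N) {p q : ℝ} (hp : 0 < p) (hpq : p < q) :
    g.demand q < g.demand p :=
  Real.rpow_lt_rpow (one_div_pos.2 (hp.trans hpq)).le (one_div_lt_one_div_of_lt hp hpq)
    (one_div_pos.2 g.α_pos)

/-- In equilibrium macro-cells are strictly more expensive than small-cells, and serve mobile users
only. -/
lemma IsSubgamePerfect.separate (hN : 0 < N) {π : Bandwidths N → Prices N}
    (h : g.IsSubgamePerfect b π) :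
    (∀ i, (g.association b (π b)).fixed i .macro_cell = 0) ∧
      ∀ i j, 0 < (g.association b (π b)).fixed i .small_cell →
        g.demand (π b j .macro_cell) < g.demand (π b i .small_cell) := by
  have hC := capacity_nonneg h.feasible
  obtain ⟨zM, zS, hcl, hp, hK, -⟩ := (h.price_equilibrium b h.feasible).exists_isClearing h.feasible
  have hsol := h.isSplitSolution hN
  have hsep := hsol.separate hN
  have hCM := hsol.sum_macro_pos hN
  obtain ⟨h1, h2⟩ := hcl.separate hsep.le
  have h3 := h1.resolve_left hCM.ne'
  have hT : 0 < g.totalCapacity b .small_cell + g.wifiCapacity :=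
    add_pos_of_nonneg_of_pos (Finset.sum_nonneg fun i _ => hC i _) g.wifiCapacity_pos
  have hlt : zS < zM := by
    change g.Nf * g.totalCapacity b .macro_cell <
      g.Nm * (g.totalCapacity b .small_cell + g.wifiCapacity) at hsep
    rw [← h2, ← h3] at hsep
    refine lt_of_mul_lt_mul_left ?_ (mul_pos hT hCM).le
    change (g.totalCapacity b .small_cell + g.wifiCapacity) * g.totalCapacity b .macro_cell * zS <
      (g.totalCapacity b .small_cell + g.wifiCapacity) * g.totalCapacity b .macro_cell * zM
    linarith
  refine ⟨fun i => hK.fixed_macro_eq_zero hC hcl hlt i, fun i j hi => ?_⟩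
  have hbi : 0 < b i .small_cell := by
    rw [← g.capacity_pos_iff]
    refine (hC _ _).lt_of_ne fun h0 => ?_
    exact hi.ne' (hK.load_eq_zero h0.symm)
  rw [hp i _ hbi, hp j _ ((g.capacity_pos_iff b j _).1 (hsol.macro_pos j))]
  exact g.demand_lt_demand (Real.rpow_pos_of_pos hcl.pos _)
    (Real.rpow_lt_rpow hcl.pos.le hlt g.α_pos)

end Market

/-- If all SPs have macro-cells, then exactly one of the three types occurs. -/
lemma exactly_one_type {N : ℕ} (hN : 0 < N) {b : Bandwidths N} (hM : ∀ i, 0 < b i .macro_cell)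
    (hS : ∀ i, 0 ≤ b i .small_cell) :
    (IsMSNE b ∧ ¬ IsMPNE b ∧ ¬ IsMNE b) ∨ (IsMPNE b ∧ ¬ IsMSNE b ∧ ¬ IsMNE b) ∨
      (IsMNE b ∧ ¬ IsMSNE b ∧ ¬ IsMPNE b) := by
  have hdisj : ∀ i, UsesBoth (b i) → ¬ MacroOnly (b i) := fun i h h' => h.2.ne' h'.2
  have hor : ∀ i, UsesBoth (b i) ∨ MacroOnly (b i) := fun i =>
    (hS i).lt_or_eq.imp (fun h => ⟨hM i, h⟩) fun h => ⟨hM i, h.symm⟩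
  by_cases h1 : IsMSNE b
  · exact Or.inl ⟨h1, fun ⟨_, ⟨i, hi⟩, _⟩ => hdisj i (h1 i) hi,
      fun h => hdisj ⟨0, hN⟩ (h1 _) (h _)⟩
  by_cases h2 : IsMNE b
  · exact Or.inr (Or.inr ⟨h2, h1, fun ⟨⟨i, hi⟩, _⟩ => hdisj i hi (h2 i)⟩)
  · obtain ⟨i, hi⟩ := not_forall.1 h1
    obtain ⟨j, hj⟩ := not_forall.1 h2
    exact Or.inr (Or.inl ⟨⟨⟨j, (hor j).resolve_right hj⟩, ⟨i, (hor i).resolve_left hi⟩, hor⟩,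
      h1, h2⟩)

end HetNet

theorem mainTheorem6 (N : ℕ) (hN : 2 ≤ N) (g : HetNet.Market N) :
    -- users' choices are determined by bandwidths and prices
    (∀ (b : HetNet.Bandwidths N) (p : HetNet.Prices N), g.Feasible b → (∀ i t, 0 ≤ p i t) →
      ∃! K : HetNet.Association N, g.IsUserAssociation b p K) ∧
    -- existence
    (∃ (b : HetNet.Bandwidths N) (π : HetNet.Bandwidths N → HetNet.Prices N),
      g.IsSubgamePerfect b π) ∧
    -- uniqueness, prices of services without bandwidth being immaterial
    (∀ (b₁ b₂ : HetNet.Bandwidths N) (π₁ π₂ : HetNet.Bandwidths N → HetNet.Prices N),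
      g.IsSubgamePerfect b₁ π₁ → g.IsSubgamePerfect b₂ π₂ →
      b₁ = b₂ ∧
      ∀ b, g.Feasible b →
        (∀ i t, 0 < b i t → π₁ b i t = π₂ b i t) ∧
        g.association b (π₁ b) = g.association b (π₂ b)) ∧
    -- properties of the equilibrium
    (∀ (b : HetNet.Bandwidths N) (π : HetNet.Bandwidths N → HetNet.Prices N),
      g.IsSubgamePerfect b π →
      -- separate service: macro-cells serve no fixed users
      (∀ i, (g.association b (π b)).fixed i .macro_cell = 0) ∧
      -- fixed users in small-cells get a higher rate than mobile users in macro-cells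
      (∀ i j, 0 < (g.association b (π b)).fixed i .small_cell →
        0 < (g.association b (π b)).mobile j →
        g.demand (π b j .macro_cell) < g.demand (π b i .small_cell)) ∧
      -- exactly one of the three types
      ((HetNet.IsMSNE b ∧ ¬ HetNet.IsMPNE b ∧ ¬ HetNet.IsMNE b) ∨
        (HetNet.IsMPNE b ∧ ¬ HetNet.IsMSNE b ∧ ¬ HetNet.IsMNE b) ∨
        (HetNet.IsMNE b ∧ ¬ HetNet.IsMSNE b ∧ ¬ HetNet.IsMPNE b))) := by
  have hN0 : 0 < N := by omega
  refine ⟨fun b p hb hp => g.existsUnique_isUserAssociation hb hp,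
    HetNet.Market.exists_isSubgamePerfect hN g, fun b₁ b₂ π₁ π₂ h₁ h₂ =>
      ⟨h₁.bandwidths_unique hN0 h₂, fun b hb =>
        (h₁.price_equilibrium b hb).unique hb (h₂.price_equilibrium b hb)⟩, fun b π h => ?_⟩
  obtain ⟨hfix, hdem⟩ := h.separate hN0
  exact ⟨hfix, fun i j hi _ => hdem i j hi, HetNet.exactly_one_type hN0
    (fun i => (g.capacity_pos_iff b i _).1 ((h.isSplitSolution hN0).macro_pos i))
    fun i => (h.feasible i).1 _⟩
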